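/- **Proposition (the 2-local ergotropic gap bounds mutual information).** Consider $N$ bosonic modes with Hilbert space $L^2(\mathbb R^N)$, quadratures $R=(q_1,\dots,q_N,p_1,\dots,p_N)$, $[q_k,p_l]=i\delta_{kl}$, Weyl operators $W(\xi)=e^{i\xi\cdot R}$ $(\xi\in\mathbb R^{2N})$ and Hamiltonian $H=\frac12\sum_{k=1}^N(q_k^2+p_k^2)$. Let the modes be partitioned into two non-empty sets $\mathcal A_1|\mathcal A_2$, and let $\rho=|\psi\rangle\langle\psi|$ be a pure Gaussian state with zero displacement, i.e. $\|\psi\|=1$ and, for some real symmetric matrix $\Sigma$ (the covariance matrix), $\langle\psi,W(\xi)\psi\rangle=e^{-\frac14\xi^{T}\Sigma\xi}$ for all $\xi$. A Gaussian unitary is a unitary $U$ for which there are a symplectic matrix $S$ and a vector $d$ with $U\,W(\xi)\,U^{-1}=e^{i d\cdot\xi}\,W(S\xi)$ for all $\xi$. Put $$\mathcal E_G(\rho)=\operatorname{Tr}(\rho H)-\inf_{U}\operatorname{Tr}(U\rho U^\dagger H),\qquad \mathcal E_{2\text{-loc}}^{\mathcal A_1|\mathcal A_2}(\rho)=\operatorname{Tr}(\rho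 H)-\inf_{U_1\otimes U_2}\operatorname{Tr}\big((U_1\otimes U_2)\rho(U_1\otimes U_2)^\dagger H\big),$$ where $U$ runs over the Gaussian unitaries on all modes and $U_j$ over the Gaussian unitaries on the modes in $\mathcal A_j$, and let $\delta_{2\text{-loc}}^{\mathcal A_1|\mathcal A_2}(\rho)=\mathcal E_G(\rho)-\mathcal E_{2\text{-loc}}^{\mathcal A_1|\mathcal A_2}(\rho)$ be the 2-local ergotropic gap. Let $\rho_{\mathcal A_1},\rho_{\mathcal A_2}$ be the reduced states of $\rho$, $S(\sigma)=-\operatorname{Tr}(\sigma\ln\sigma)$ the von Neumann entropy, and $\mathrm{MI}(\rho)=S(\rho_{\mathcal A_1})+S(\rho_{\mathcal A_2})-S(\rho)$ the quantum mutual information. Then $\operatorname{Tr}(\rho H)$ and the three entropies are finite, and $$\tfrac12\,\mathrm{MI}(\rho)\;<\;\delta_{2\text{-loc}}^{\mathcal A_1|\mathcal A_2}(\rho)+\min\{|\mathcal A_1|,|\mathcal A_2|\},$$ where $|\mathcal A_j|$ is the number of modes in $\mathcal A_j$. -/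

import Mathlib

open MeasureTheory Filter Topology
open scoped ENNReal InnerProductSpace

noncomputable section

namespace GaussianErgotropy

/-- The Hilbert space `L²(ℝ^ι)` of a system of bosonic modes labelled by `ι`
(Schrödinger representation). -/
abbrev Modes (ι : Type) [Fintype ι] : Type := Lp ℂ 2 (volume : Measure (ι → ℝ))

section Weyl

variable {ι : Type} [Fintype ι]

theorem memLp_weyl (ξ : ι ⊕ ι → ℝ) (φ : Modes ι) :
    MemLp (fun x : ι → ℝ =>
      Complex.exp (Complex.I * (((∑ i, ξ (.inl i) * x i)
        + (∑ i, ξ (.inl i) * ξ (.inr i)) / 2 : ℝ) : ℂ)) *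
        φ (fun i => x i + ξ (.inr i))) 2 volume := by
  have h : MemLp (fun x : ι → ℝ => φ (x + fun i => ξ (.inr i))) 2 volume :=
    (Lp.memLp φ).comp_measurePreserving
      (measurePreserving_add_right (volume : Measure (ι → ℝ)) (fun i => ξ (.inr i)))
  refine h.congr_norm ?_ ?_
  · refine AEStronglyMeasurable.mul ?_ h.1
    exact (by fun_prop : Continuous fun x : ι → ℝ =>
      Complex.exp (Complex.I * (((∑ i, ξ (.inl i) * x i)
        + (∑ i, ξ (.inl i) * ξ (.inr i)) / 2 : ℝ) : ℂ))).aestronglyMeasurable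
  · refine Eventually.of_forall fun x => ?_
    simp only [norm_mul, mul_comm Complex.I, Complex.norm_exp_ofReal_mul_I, one_mul]
    rfl

/-- The Weyl operator `W(ξ) = exp (i (∑ᵢ uᵢ qᵢ + ∑ᵢ vᵢ pᵢ))` for the phase-space vector `ξ = (u, v)`
(position part `u = ξ ∘ inl`, momentum part `v = ξ ∘ inr`), where `q` is multiplication by the
coordinate and `p = -i ∂`, so that `[q, p] = i`:
`(W(ξ) φ)(x) = exp (i (u·x + u·v / 2)) φ (x + v)`. -/
def weyl (ξ : ι ⊕ ι → ℝ) (φ : Modes ι) : Modes ι :=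
  (memLp_weyl ξ φ).toLp _

/-- `ψ` is a displacement-free pure Gaussian state with covariance matrix `Γ`: a unit vector whose
characteristic function is `⟨ψ, W(ξ) ψ⟩ = exp (-ξᵀ Γ ξ / 4)`. The normalisation is
`Γ_kl = ⟨R_k R_l + R_l R_k⟩` with `R = (q, p)`; the vacuum has `Γ = 1`. -/
def IsPureGaussianWithCov (ψ : Modes ι) (Γ : Matrix (ι ⊕ ι) (ι ⊕ ι) ℝ) : Prop :=
  ‖ψ‖ = 1 ∧ Γ.IsSymm ∧
    ∀ ξ : ι ⊕ ι → ℝ, ⟪ψ, weyl ξ ψ⟫_ℂ = ((Real.exp (-(ξ ⬝ᵥ Γ.mulVec ξ) / 4) : ℝ) : ℂ)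

/-- Displacement-free pure Gaussian states (as unit vectors). -/
def IsPureGaussian (ψ : Modes ι) : Prop :=
  ∃ Γ : Matrix (ι ⊕ ι) (ι ⊕ ι) ℝ, IsPureGaussianWithCov ψ Γ

variable [DecidableEq ι]

/-- A Gaussian unitary: a unitary that acts on the quadratures as an affine symplectic map,
written in exponentiated form `U W(ξ) U⁻¹ = exp (i d·ξ) W(S ξ)`. -/
def IsGaussianUnitary (U : Modes ι ≃ₗᵢ[ℂ] Modes ι) : Prop :=
  ∃ S ∈ Matrix.symplecticGroup ι ℝ, ∃ d : ι ⊕ ι → ℝ, ∀ (ξ : ι ⊕ ι → ℝ) (φ : Modes ι),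
    U (weyl ξ φ) = Complex.exp (Complex.I * ((d ⬝ᵥ ξ : ℝ) : ℂ)) • weyl (S.mulVec ξ) (U φ)

/-- `φ` is in the domain of the quadrature operator `R_k` and `R_k φ = η`, where
`R = (q, p)` and `R_k` is the self-adjoint (Stone) generator of the one-parameter unitary group
`t ↦ W(t e_k) = exp (i t R_k)`. -/
def IsQuadratureImage (k : ι ⊕ ι) (φ η : Modes ι) : Prop :=
  Tendsto (fun t : ℝ => (Complex.I * (t : ℂ))⁻¹ • (weyl (t • Pi.single k (1 : ℝ)) φ - φ))
    (𝓝[≠] 0) (𝓝 η)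

/-- `⟨φ, R_k² φ⟩ = ‖R_k φ‖²` in the sense of quadratic forms; it is `∞` outside the domain of
`R_k`. -/
def quadratureSq (k : ι ⊕ ι) (φ : Modes ι) : ℝ≥0∞ :=
  ⨅ (η : Modes ι) (_ : IsQuadratureImage k φ η), ENNReal.ofReal (‖η‖ ^ 2)

/-- The mean energy `Tr (|φ⟩⟨φ| H) = ⟨φ, H φ⟩` for `H = ½ ∑ᵢ (qᵢ² + pᵢ²)`. -/
def energy (φ : Modes ι) : ℝ≥0∞ :=
  2⁻¹ * ∑ k : ι ⊕ ι, quadratureSq k φ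

/-- The least energy reachable by global Gaussian unitaries. -/
def globalMinEnergy (ψ : Modes ι) : ℝ≥0∞ :=
  ⨅ (U : Modes ι ≃ₗᵢ[ℂ] Modes ι) (_ : IsGaussianUnitary U), energy (U ψ)

/-- Global Gaussian ergotropy. -/
def globalErgotropy (ψ : Modes ι) : ℝ :=
  (energy ψ).toReal - (globalMinEnergy ψ).toReal

end Weyl

section Bipartite

variable {α β : Type} [Fintype α] [Fintype β]

theorem integrable_tensor {f : (α → ℝ) → ℝ} {g : (β → ℝ) → ℝ}
    (hf : Integrable f) (hg : Integrable g) :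
    Integrable (fun z : α ⊕ β → ℝ => f (fun i => z (.inl i)) * g (fun j => z (.inr j))) ∧
    ∫ z : α ⊕ β → ℝ, f (fun i => z (.inl i)) * g (fun j => z (.inr j)) =
      (∫ x, f x) * ∫ y, g y := by
  have hmp := volume_measurePreserving_sumPiEquivProdPi (fun _ : α ⊕ β => ℝ)
  constructor
  · exact hmp.integrable_comp_of_integrable (hf.mul_prod hg)
  · rw [← integral_prod_mul f g]
    exact hmp.integral_comp (MeasurableEquiv.sumPiEquivProdPi _).measurableEmbedding
      (fun p : (α → ℝ) × (β → ℝ) => f p.1 * g p.2)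

theorem quasiMeasurePreserving_inl :
    Measure.QuasiMeasurePreserving (fun (z : α ⊕ β → ℝ) (i : α) => z (.inl i))
      volume volume :=
  Measure.quasiMeasurePreserving_fst.comp
    (volume_measurePreserving_sumPiEquivProdPi (fun _ : α ⊕ β => ℝ)).quasiMeasurePreserving

theorem quasiMeasurePreserving_inr :
    Measure.QuasiMeasurePreserving (fun (z : α ⊕ β → ℝ) (j : β) => z (.inr j))
      volume volume :=
  Measure.quasiMeasurePreserving_snd.comp
    (volume_measurePreserving_sumPiEquivProdPi (fun _ : α ⊕ β => ℝ)).quasiMeasurePreserving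

theorem memLp_tensor (φ : Modes α) (χ : Modes β) :
    MemLp (fun z : α ⊕ β → ℝ => φ (fun i => z (.inl i)) * χ (fun j => z (.inr j))) 2 volume := by
  have hm : AEStronglyMeasurable
      (fun z : α ⊕ β → ℝ => φ (fun i => z (.inl i)) * χ (fun j => z (.inr j))) volume :=
    ((Lp.aestronglyMeasurable φ).comp_quasiMeasurePreserving quasiMeasurePreserving_inl).mul
      ((Lp.aestronglyMeasurable χ).comp_quasiMeasurePreserving quasiMeasurePreserving_inr)
  rw [memLp_two_iff_integrable_sq_norm hm]
  simp only [norm_mul, mul_pow]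
  exact (integrable_tensor (f := fun x => ‖φ x‖ ^ 2) (g := fun y => ‖χ y‖ ^ 2)
    ((memLp_two_iff_integrable_sq_norm (Lp.aestronglyMeasurable φ)).1 (Lp.memLp φ))
    ((memLp_two_iff_integrable_sq_norm (Lp.aestronglyMeasurable χ)).1 (Lp.memLp χ))).1

theorem norm_sq_modes {ι : Type} [Fintype ι] (φ : Modes ι) : ‖φ‖ ^ 2 = ∫ x, ‖φ x‖ ^ 2 := by
  have h := congrArg Complex.re (inner_self_eq_norm_sq_to_K (𝕜 := ℂ) φ)
  rw [L2.inner_def] at h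
  have h2 : ∀ x, ⟪φ x, φ x⟫_ℂ = ((‖φ x‖ ^ 2 : ℝ) : ℂ) := fun x => by
    rw [inner_self_eq_norm_sq_to_K]; norm_cast
  simp only [h2, integral_complex_ofReal] at h
  rw [Complex.ofReal_re] at h
  rw [h]
  norm_cast

/-- The tensor product `(φ ⊗ χ)(x, y) = φ(x) χ(y)`, as a continuous bilinear map
`L²(ℝ^α) × L²(ℝ^β) → L²(ℝ^(α ⊕ β))`. -/
def tensor : Modes α →L[ℂ] Modes β →L[ℂ] Modes (α ⊕ β) :=
  LinearMap.mkContinuous₂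
    (LinearMap.mk₂ ℂ (fun (φ : Modes α) (χ : Modes β) => (memLp_tensor φ χ).toLp _)
      (fun φ₁ φ₂ χ => by
        rw [← MemLp.toLp_add, MemLp.toLp_eq_toLp_iff]
        filter_upwards [quasiMeasurePreserving_inl.ae (Lp.coeFn_add φ₁ φ₂)] with z hz
        simp only [Pi.add_apply] at hz ⊢
        rw [hz, add_mul])
      (fun c φ χ => by
        rw [← MemLp.toLp_const_smul, MemLp.toLp_eq_toLp_iff]
        filter_upwards [quasiMeasurePreserving_inl.ae (Lp.coeFn_smul c φ)] with z hz
        simp only [Pi.smul_apply, smul_eq_mul] at hz ⊢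
        rw [hz, mul_assoc])
      (fun φ χ₁ χ₂ => by
        rw [← MemLp.toLp_add, MemLp.toLp_eq_toLp_iff]
        filter_upwards [quasiMeasurePreserving_inr.ae (Lp.coeFn_add χ₁ χ₂)] with z hz
        simp only [Pi.add_apply] at hz ⊢
        rw [hz, mul_add])
      (fun c φ χ => by
        rw [← MemLp.toLp_const_smul, MemLp.toLp_eq_toLp_iff]
        filter_upwards [quasiMeasurePreserving_inr.ae (Lp.coeFn_smul c χ)] with z hz
        simp only [Pi.smul_apply, smul_eq_mul] at hz ⊢
        rw [hz, mul_left_comm]))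
    1
    (fun φ χ => by
      rw [one_mul]
      refine le_of_eq ((sq_eq_sq₀ (norm_nonneg _) (by positivity)).1 ?_)
      rw [LinearMap.mk₂_apply, norm_sq_modes, mul_pow, norm_sq_modes φ, norm_sq_modes χ]
      rw [← (integrable_tensor (f := fun x => ‖φ x‖ ^ 2) (g := fun y => ‖χ y‖ ^ 2)
        ((memLp_two_iff_integrable_sq_norm (Lp.aestronglyMeasurable φ)).1 (Lp.memLp φ))
        ((memLp_two_iff_integrable_sq_norm (Lp.aestronglyMeasurable χ)).1 (Lp.memLp χ))).2]
      refine integral_congr_ae ?_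
      filter_upwards [(memLp_tensor φ χ).coeFn_toLp] with z hz
      rw [hz, norm_mul, mul_pow])

section Local

variable [DecidableEq α] [DecidableEq β]

/-- A 2-local Gaussian unitary `U = U₁ ⊗ U₂` for the bipartition `α | β`. -/
def IsLocalGaussianUnitary (U : Modes (α ⊕ β) ≃ₗᵢ[ℂ] Modes (α ⊕ β)) : Prop :=
  ∃ (U₁ : Modes α ≃ₗᵢ[ℂ] Modes α) (U₂ : Modes β ≃ₗᵢ[ℂ] Modes β),
    IsGaussianUnitary U₁ ∧ IsGaussianUnitary U₂ ∧
      ∀ φ χ, U (tensor φ χ) = tensor (U₁ φ) (U₂ χ)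

/-- The least energy reachable by 2-local Gaussian unitaries. -/
def localMinEnergy (ψ : Modes (α ⊕ β)) : ℝ≥0∞ :=
  ⨅ (U : Modes (α ⊕ β) ≃ₗᵢ[ℂ] Modes (α ⊕ β)) (_ : IsLocalGaussianUnitary U), energy (U ψ)

/-- 2-local Gaussian ergotropy for the bipartition `α | β`. -/
def localErgotropy (ψ : Modes (α ⊕ β)) : ℝ :=
  (energy ψ).toReal - (localMinEnergy ψ).toReal

/-- The 2-local ergotropic gap: global minus 2-local Gaussian ergotropy. -/
def ergotropicGap (ψ : Modes (α ⊕ β)) : ℝ :=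
  globalErgotropy ψ - localErgotropy ψ

end Local

end Bipartite

section Entropy

variable (H : Type) [NormedAddCommGroup H] [InnerProductSpace ℂ H] [CompleteSpace H]

/-- Index set of a fixed Hilbert basis of `H`. -/
def basisSet : Set H := (exists_hilbertBasis ℂ H).choose

/-- A fixed Hilbert basis of `H`; the traces below do not depend on it. -/
def basis : HilbertBasis (basisSet H) ℂ H := (exists_hilbertBasis ℂ H).choose_spec.choose

variable {H}

/-- The trace of a positive operator, in `[0, ∞]`. -/
def posTrace (T : H →L[ℂ] H) : ℝ≥0∞ :=
  ∑' i, ENNReal.ofReal (⟪basis H i, T (basis H i)⟫_ℂ).re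

/-- The von Neumann entropy `-Tr (T log T)` of a density operator (natural logarithm), through the
continuous functional calculus for `x ↦ -x log x`. -/
def vonNeumannEntropy (T : H →L[ℂ] H) : ℝ≥0∞ :=
  posTrace (cfc Real.negMulLog T)

/-- The density operator `|ψ⟩⟨ψ|`. -/
def pureState (ψ : H) : H →L[ℂ] H := InnerProductSpace.rankOne ℂ ψ ψ

end Entropy

section Reduced

variable {α β : Type} [Fintype α] [Fintype β]

/-- The reduced state `Tr_β ρ = ∑ⱼ (1 ⊗ ⟨fⱼ|) ρ (1 ⊗ |fⱼ⟩)` on the modes `α`, with `f` a Hilbert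
basis of `L²(ℝ^β)`; the series converges in norm for trace-class `ρ`. -/
def reducedLeft (ρ : Modes (α ⊕ β) →L[ℂ] Modes (α ⊕ β)) : Modes α →L[ℂ] Modes α :=
  ∑' j, ContinuousLinearMap.adjoint (tensor.flip (basis (Modes β) j)) ∘L ρ ∘L
    tensor.flip (basis (Modes β) j)

/-- The reduced state `Tr_α ρ` on the modes `β`. -/
def reducedRight (ρ : Modes (α ⊕ β) →L[ℂ] Modes (α ⊕ β)) : Modes β →L[ℂ] Modes β :=
  ∑' i, ContinuousLinearMap.adjoint (tensor (basis (Modes α) i)) ∘L ρ ∘L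
    tensor (basis (Modes α) i)

/-- The quantum mutual information `S(ρ_α) + S(ρ_β) - S(ρ)`. -/
def mutualInformation (ρ : Modes (α ⊕ β) →L[ℂ] Modes (α ⊕ β)) : ℝ :=
  (vonNeumannEntropy (reducedLeft ρ)).toReal + (vonNeumannEntropy (reducedRight ρ)).toReal
    - (vonNeumannEntropy ρ).toReal

end Reduced

end GaussianErgotropy

end

/-! Write `m` and `n` for the numbers of modes on the two sides and let `r` be the Schmidt
coefficients of `ψ`. The global state is pure, so its entropy is zero, both reduced states have
spectrum `r` apart from zeros, and half the mutual information is `S = ∑ -r log r`. The gap is the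
local minimum energy minus the global one, so an upper bound on the latter and a lower bound on the
former suffice.

Global side (`IsPureGaussianWithCov.globalMinEnergy_le`). A linear change of position variables
followed by a quadratic phase makes the position block of the covariance `1` and its
position-momentum block antisymmetric. For a pure state the momentum block is then determined by the
others, and the canonical commutation relations make the position-momentum block symmetric, hence
zero. The transformed state therefore has energy `(m + n) / 2`.

Local side. A local unitary does not change `r`. For any vector with these coefficients, the energy
`E` of the modes on the first side satisfies `S < E + m / 2`. To see this, average `-r log r ≤ r h +
exp (-h) - r` over phase space, where `h` is the classical oscillator energy and the weights are the
Husimi functions of the Schmidt vectors. By Bessel's inequality these weights sum to at most one,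
`exp (-h)` has total integral one, and the Husimi mean of `h` is at most `E + m / 2`, because
coherent-state smoothing adds at most `1 / 2` to each of the `2m` second moments. The uncertainty
relation gives the other side energy at least `n / 2`. Hence the local minimum exceeds `S - m / 2 +
n / 2` and the gap exceeds `S - m`; exchanging the sides gives `S - n`.

Strictness must survive an infimum over unitaries, so a slack `c > 0` depending on `r` alone is
needed. The sharper inequality `negMulLog_le_slack` leaves a square that is bounded below near the
phase-space origin whenever the spectrum stays below some `Λ < 1`; a product state is treated
separately (`exists_entropy_slack`). -/

noncomputable section

namespace GaussianErgotropy

/-! ### Fourier integrals and Plancherel in coordinates. -/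

section Plancherel

open scoped FourierTransform SchwartzMap ContDiff

/-- On `L¹ ∩ L²` the `L²` Fourier transform is given by the Fourier integral. -/
theorem Lp_fourier_ae_eq {V : Type*} [NormedAddCommGroup V] [InnerProductSpace ℝ V]
    [FiniteDimensional ℝ V] [MeasurableSpace V] [BorelSpace V] {f : V → ℂ}
    (h1 : Integrable f) (h2 : MemLp f 2) :
    ((𝓕 (h2.toLp f) : Lp ℂ 2 (volume : Measure V)) : V → ℂ) =ᵐ[volume] 𝓕 f := by
  refine ae_eq_of_integral_contDiff_smul_eq ?_ ?_ ?_
  · exact (Lp.memLp _).locallyIntegrable (by norm_num)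
  · exact (VectorFourier.fourierIntegral_continuous Real.continuous_fourierChar
      (by exact continuous_inner) h1).locallyIntegrable
  · intro g hg hgs
    have hgs' : HasCompactSupport (fun x => (g x : ℂ)) := hgs.comp_left (g := Complex.ofReal) rfl
    let G : 𝓢(V, ℂ) := hgs'.toSchwartzMap (Complex.ofRealCLM.contDiff.comp hg)
    have hG : ∀ x, G x = (g x : ℂ) := fun x => rfl
    -- Both candidates are compared as distributions: on the `L²` side the transform moves to the
    -- test function by definition, on the `L¹` side by Fubini.
    have hd := congrArg (fun T : 𝓢'(V, ℂ) => T G)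
      (Lp.fourier_toTemperedDistribution_eq (h2.toLp f))
    simp only [TemperedDistribution.fourier_apply, Lp.toTemperedDistribution_apply] at hd
    have hL : ∀ F : V → ℂ, ∫ x, g x • F x = ∫ x, G x • F x := fun F => by
      simp [hG]
    rw [hL, hL, ← hd]
    have hc : ∫ x, (𝓕 G) x • (h2.toLp f : V → ℂ) x = ∫ x, (𝓕 G) x • f x :=
      integral_congr_ae (by filter_upwards [h2.coeFn_toLp] with x hx; rw [hx])
    rw [hc]
    simpa using! VectorFourier.integral_fourierIntegral_smul_eq_flip (L := innerₗ V)
      Real.continuous_fourierChar continuous_inner G.integrable h1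

variable {ι : Type*} [Fintype ι]

/-- The Fourier transform on `ℝ^ι` in coordinates. -/
def coordFourier (G : (ι → ℝ) → ℂ) (k : ι → ℝ) : ℂ :=
  ∫ y, Complex.exp (((-(2 * Real.pi * (k ⬝ᵥ y)) : ℝ) : ℂ) * Complex.I) * G y

theorem coordFourier_eq_fourier (G : (ι → ℝ) → ℂ) (k : ι → ℝ) :
    coordFourier G k =
      𝓕 (fun x : EuclideanSpace ℝ ι => G (WithLp.ofLp x)) (WithLp.toLp 2 k) := by
  rw [Real.fourier_eq', coordFourier,
    ← (PiLp.volume_preserving_ofLp ι).integral_comp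
      (MeasurableEquiv.toLp 2 (ι → ℝ)).symm.measurableEmbedding]
  refine integral_congr_ae (Eventually.of_forall fun x => ?_)
  simp only [smul_eq_mul, EuclideanSpace.inner_eq_star_dotProduct]
  congr 3
  simp

/-- The identification of `ι → ℝ` with Euclidean space preserves volume, so this is the unitarity of
the `L²` Fourier transform, which agrees with the integral because both functions are also in `L¹`.
-/
theorem plancherel_coordFourier {G K : (ι → ℝ) → ℂ} (hG1 : Integrable G) (hG2 : MemLp G 2)
    (hK1 : Integrable K) (hK2 : MemLp K 2) :
    MemLp (coordFourier G) 2 ∧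
    ∫ k, star (coordFourier G k) * coordFourier K k = ∫ y, star (G y) * K y := by
  have mp := PiLp.volume_preserving_ofLp ι
  have emb := (MeasurableEquiv.toLp 2 (ι → ℝ)).symm.measurableEmbedding
  have mp' := PiLp.volume_preserving_toLp ι
  have aux1 : ∀ {G : (ι → ℝ) → ℂ}, Integrable G →
      Integrable (fun x : EuclideanSpace ℝ ι => G (WithLp.ofLp x)) :=
    fun h => mp.integrable_comp_of_integrable h
  have aux2 : ∀ {G : (ι → ℝ) → ℂ}, MemLp G 2 →
      MemLp (fun x : EuclideanSpace ℝ ι => G (WithLp.ofLp x)) 2 :=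
    fun h => h.comp_measurePreserving mp
  have key : ∀ {G : (ι → ℝ) → ℂ}, Integrable G → MemLp G 2 →
      ∃ g F : Lp ℂ 2 (volume : Measure (EuclideanSpace ℝ ι)), 𝓕 g = F ∧
        (g : EuclideanSpace ℝ ι → ℂ) =ᵐ[volume] (fun x => G (WithLp.ofLp x)) ∧
        (fun k => F (WithLp.toLp 2 k)) =ᵐ[volume] coordFourier G := by
    intro G h1 h2
    refine ⟨(aux2 h2).toLp _, _, rfl, (aux2 h2).coeFn_toLp, ?_⟩
    refine (mp'.quasiMeasurePreserving.ae_eq_comp (Lp_fourier_ae_eq (aux1 h1) (aux2 h2))).trans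
      (Eventually.of_forall fun k => ?_)
    exact (coordFourier_eq_fourier G k).symm
  obtain ⟨g, F, hF, hg, hFg⟩ := key hG1 hG2
  obtain ⟨k, M, hM, hk, hMk⟩ := key hK1 hK2
  refine ⟨((Lp.memLp F).comp_measurePreserving mp').ae_eq hFg, ?_⟩
  have hin := Lp.inner_fourier_eq g k
  rw [hF, hM, L2.inner_def, L2.inner_def] at hin
  have e1 : ∫ k, star (coordFourier G k) * coordFourier K k = ∫ a, ⟪F a, M a⟫_ℂ := by
    rw [← mp'.integral_comp (MeasurableEquiv.toLp 2 (ι → ℝ)).measurableEmbedding]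
    refine integral_congr_ae ?_
    filter_upwards [hFg, hMk] with k h1 h2
    rw [h1, h2, RCLike.inner_apply, mul_comm]; rfl
  rw [e1, hin, ← mp.integral_comp emb]
  refine integral_congr_ae ?_
  filter_upwards [hg, hk] with x h1 h2
  rw [h1, h2, RCLike.inner_apply, mul_comm]; rfl

end Plancherel

end GaussianErgotropy

end

noncomputable section

namespace GaussianErgotropy

/-! ### Weyl operators and the Weyl relations. -/

section WeylBasics

variable {ι : Type} [Fintype ι]

/-- The multiplier in the Schrödinger form of the Weyl operator. -/
def weylPhase (ξ : ι ⊕ ι → ℝ) (x : ι → ℝ) : ℂ :=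
  Complex.exp (Complex.I * (((∑ i, ξ (.inl i) * x i)
    + (∑ i, ξ (.inl i) * ξ (.inr i)) / 2 : ℝ) : ℂ))

theorem norm_weylPhase (ξ : ι ⊕ ι → ℝ) (x : ι → ℝ) : ‖weylPhase ξ x‖ = 1 := by
  rw [weylPhase, mul_comm, Complex.norm_exp_ofReal_mul_I]

theorem weyl_coeFn (ξ : ι ⊕ ι → ℝ) (φ : Modes ι) :
    weyl ξ φ =ᵐ[volume] fun x => weylPhase ξ x * φ (fun i => x i + ξ (.inr i)) :=
  (memLp_weyl ξ φ).coeFn_toLp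

theorem measurePreserving_translate (v : ι → ℝ) :
    MeasurePreserving (fun (x : ι → ℝ) (i : ι) => x i + v i) volume volume :=
  measurePreserving_add_right (volume : Measure (ι → ℝ)) v

theorem weyl_add_right (ξ : ι ⊕ ι → ℝ) (φ χ : Modes ι) :
    weyl ξ (φ + χ) = weyl ξ φ + weyl ξ χ := by
  refine Lp.ext ?_
  filter_upwards [weyl_coeFn ξ (φ + χ), weyl_coeFn ξ φ, weyl_coeFn ξ χ,
    Lp.coeFn_add (weyl ξ φ) (weyl ξ χ),
    (measurePreserving_translate fun i => ξ (.inr i)).quasiMeasurePreserving.ae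
      (Lp.coeFn_add φ χ)] with x h1 h2 h3 h4 h5
  rw [h1, h4, Pi.add_apply, h2, h3, h5, Pi.add_apply, mul_add]

theorem weyl_smul_right (ξ : ι ⊕ ι → ℝ) (c : ℂ) (φ : Modes ι) :
    weyl ξ (c • φ) = c • weyl ξ φ := by
  refine Lp.ext ?_
  filter_upwards [weyl_coeFn ξ (c • φ), weyl_coeFn ξ φ, Lp.coeFn_smul c (weyl ξ φ),
    (measurePreserving_translate fun i => ξ (.inr i)).quasiMeasurePreserving.ae
      (Lp.coeFn_smul c φ)] with x h1 h2 h4 h5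
  rw [h1, h4, Pi.smul_apply, h2, h5, Pi.smul_apply, smul_eq_mul, smul_eq_mul, mul_left_comm]

theorem norm_weyl (ξ : ι ⊕ ι → ℝ) (φ : Modes ι) : ‖weyl ξ φ‖ = ‖φ‖ := by
  refine (sq_eq_sq₀ (norm_nonneg _) (norm_nonneg _)).1 ?_
  rw [norm_sq_modes, norm_sq_modes]
  have h := (measurePreserving_add_right (volume : Measure (ι → ℝ)) fun i => ξ (.inr i)).integral_comp
    (measurableEmbedding_addRight _) (fun x => ‖φ x‖ ^ 2)
  rw [← h]
  refine integral_congr_ae ?_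
  filter_upwards [weyl_coeFn ξ φ] with x hx
  rw [hx, norm_mul, norm_weylPhase, one_mul]
  rfl

/-- The Weyl operator as a linear isometry. -/
def weylIso (ξ : ι ⊕ ι → ℝ) : Modes ι →ₗᵢ[ℂ] Modes ι where
  toFun := weyl ξ
  map_add' := weyl_add_right ξ
  map_smul' := weyl_smul_right ξ
  norm_map' := norm_weyl ξ

theorem weylIso_apply (ξ : ι ⊕ ι → ℝ) (φ : Modes ι) : weylIso ξ φ = weyl ξ φ := rfl

theorem inner_weyl_weyl (ξ : ι ⊕ ι → ℝ) (φ χ : Modes ι) : ⟪weyl ξ φ, weyl ξ χ⟫_ℂ = ⟪φ, χ⟫_ℂ :=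
  (weylIso ξ).inner_map_map φ χ

theorem weyl_zero (φ : Modes ι) : weyl 0 φ = φ := by
  refine Lp.ext ?_
  filter_upwards [weyl_coeFn 0 φ] with x hx
  simp [hx, weylPhase]

/-- The symplectic form entering the Weyl relations. -/
def symplForm (ξ ζ : ι ⊕ ι → ℝ) : ℝ :=
  ∑ i, (ζ (.inl i) * ξ (.inr i) - ξ (.inl i) * ζ (.inr i))

theorem symplForm_swap (ξ ζ : ι ⊕ ι → ℝ) : symplForm ζ ξ = -symplForm ξ ζ := by
  rw [symplForm, symplForm, ← Finset.sum_neg_distrib]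
  exact Finset.sum_congr rfl fun i _ => by ring

theorem symplForm_self (ξ : ι ⊕ ι → ℝ) : symplForm ξ ξ = 0 := by
  simp [symplForm]

theorem symplForm_smul_left (c : ℝ) (ξ ζ : ι ⊕ ι → ℝ) :
    symplForm (c • ξ) ζ = c * symplForm ξ ζ := by
  rw [symplForm, symplForm, Finset.mul_sum]
  exact Finset.sum_congr rfl fun i _ => by simp only [Pi.smul_apply, smul_eq_mul]; ring

theorem symplForm_smul_right (c : ℝ) (ξ ζ : ι ⊕ ι → ℝ) :
    symplForm ξ (c • ζ) = c * symplForm ξ ζ := by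
  rw [symplForm, symplForm, Finset.mul_sum]
  exact Finset.sum_congr rfl fun i _ => by simp only [Pi.smul_apply, smul_eq_mul]; ring

/-- The Weyl relations. -/
theorem weyl_weyl (ξ ζ : ι ⊕ ι → ℝ) (φ : Modes ι) :
    weyl ξ (weyl ζ φ) =
      Complex.exp (Complex.I * ((symplForm ξ ζ / 2 : ℝ) : ℂ)) • weyl (ξ + ζ) φ := by
  refine Lp.ext ?_
  filter_upwards [weyl_coeFn ξ (weyl ζ φ), weyl_coeFn (ξ + ζ) φ,
    Lp.coeFn_smul (Complex.exp (Complex.I * ((symplForm ξ ζ / 2 : ℝ) : ℂ))) (weyl (ξ + ζ) φ),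
    (measurePreserving_translate fun i => ξ (.inr i)).quasiMeasurePreserving.ae
      (weyl_coeFn ζ φ)] with x h1 h2 h3 h4
  rw [h1, h3, Pi.smul_apply, h2, h4, smul_eq_mul, ← mul_assoc, ← mul_assoc]
  have e : (fun i => x i + ξ (.inr i) + ζ (.inr i)) = fun i => x i + (ξ + ζ) (.inr i) := by
    funext i; simp [add_assoc]
  rw [e]
  congr 1
  simp only [weylPhase, ← Complex.exp_add, ← mul_add, ← Complex.ofReal_add]
  congr 3
  simp only [symplForm, Finset.sum_div, ← Finset.sum_add_distrib]
  refine Finset.sum_congr rfl fun i _ => ?_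
  simp only [Pi.add_apply]
  ring

theorem inner_weyl_left (ξ : ι ⊕ ι → ℝ) (φ χ : Modes ι) :
    ⟪weyl ξ φ, χ⟫_ℂ = ⟪φ, weyl (-ξ) χ⟫_ℂ := by
  have h : weyl ξ (weyl (-ξ) χ) = χ := by
    rw [weyl_weyl, add_neg_cancel, weyl_zero]
    have : symplForm ξ (-ξ) = 0 := by
      rw [← neg_one_smul ℝ ξ, symplForm_smul_right, symplForm_self, mul_zero]
    simp [this]
  conv_lhs => rw [← h]
  exact inner_weyl_weyl ξ _ _

end WeylBasics

/-! ### Product vectors under inner products and Weyl operators. -/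

section TensorBasics

variable {α β : Type} [Fintype α] [Fintype β]

theorem tensor_coeFn (φ : Modes α) (χ : Modes β) :
    tensor φ χ =ᵐ[volume]
      fun z : α ⊕ β → ℝ => φ (fun i => z (.inl i)) * χ (fun j => z (.inr j)) :=
  (memLp_tensor φ χ).coeFn_toLp

theorem inner_tensor_tensor (φ φ' : Modes α) (χ χ' : Modes β) :
    ⟪tensor φ χ, tensor φ' χ'⟫_ℂ = ⟪φ, φ'⟫_ℂ * ⟪χ, χ'⟫_ℂ := by
  rw [L2.inner_def, L2.inner_def, L2.inner_def,
    ← integral_prod_mul (fun x => ⟪φ x, φ' x⟫_ℂ) (fun y => ⟪χ y, χ' y⟫_ℂ)]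
  have hmp := volume_measurePreserving_sumPiEquivProdPi (fun _ : α ⊕ β => ℝ)
  refine Eq.trans ?_ (hmp.integral_comp (MeasurableEquiv.sumPiEquivProdPi _).measurableEmbedding
      (fun p : (α → ℝ) × (β → ℝ) => ⟪φ p.1, φ' p.1⟫_ℂ * ⟪χ p.2, χ' p.2⟫_ℂ))
  refine integral_congr_ae ?_
  filter_upwards [tensor_coeFn φ χ, tensor_coeFn φ' χ'] with z h1 h2
  rw [h1, h2]
  simp only [RCLike.inner_apply, map_mul, MeasurableEquiv.coe_sumPiEquivProdPi,
    Equiv.sumPiEquivProdPi]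
  change _ = φ' (fun i => z (.inl i)) * _ * (χ' (fun j => z (.inr j)) * _)
  ring_nf
  rfl

/-- The part of a phase-space vector belonging to the left modes. -/
def leftPart (ξ : (α ⊕ β) ⊕ (α ⊕ β) → ℝ) : α ⊕ α → ℝ :=
  Sum.elim (fun a => ξ (.inl (.inl a))) (fun a => ξ (.inr (.inl a)))

/-- The part of a phase-space vector belonging to the right modes. -/
def rightPart (ξ : (α ⊕ β) ⊕ (α ⊕ β) → ℝ) : β ⊕ β → ℝ :=
  Sum.elim (fun b => ξ (.inl (.inr b))) (fun b => ξ (.inr (.inr b)))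

theorem weyl_tensor (ξ : (α ⊕ β) ⊕ (α ⊕ β) → ℝ) (φ : Modes α) (χ : Modes β) :
    weyl ξ (tensor φ χ) = tensor (weyl (leftPart ξ) φ) (weyl (rightPart ξ) χ) := by
  refine Lp.ext ?_
  filter_upwards [weyl_coeFn ξ (tensor φ χ),
    tensor_coeFn (weyl (leftPart ξ) φ) (weyl (rightPart ξ) χ),
    quasiMeasurePreserving_inl.ae (weyl_coeFn (leftPart ξ) φ),
    quasiMeasurePreserving_inr.ae (weyl_coeFn (rightPart ξ) χ),
    (measurePreserving_translate fun i => ξ (.inr i)).quasiMeasurePreserving.ae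
      (tensor_coeFn φ χ)] with z h1 h2 h3 h4 h5
  rw [h1, h2, h3, h4, h5]
  have e : weylPhase ξ z = weylPhase (leftPart ξ) (fun i => z (.inl i)) *
      weylPhase (rightPart ξ) (fun j => z (.inr j)) := by
    simp only [weylPhase, ← Complex.exp_add, ← mul_add, ← Complex.ofReal_add,
      Fintype.sum_sum_type, leftPart, rightPart, Sum.elim_inl, Sum.elim_inr]
    congr 3
    ring
  rw [e]
  simp only [leftPart, rightPart, Sum.elim_inr]
  ring

end TensorBasics

end GaussianErgotropy

end

noncomputable section

namespace GaussianErgotropy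

/-! ### Field operators, commutation relations and the energy of a Gaussian state. -/

section Quadratures

variable {ι : Type} [Fintype ι]

/-- The difference quotient of `t ↦ W(t ξ) φ` at `0`, divided by `i`. -/
def weylQuot (ξ : ι ⊕ ι → ℝ) (φ : Modes ι) (t : ℝ) : Modes ι :=
  (Complex.I * (t : ℂ))⁻¹ • (weyl (t • ξ) φ - φ)

/-- `φ` is in the domain of the field operator `ξ · R`, and `(ξ · R) φ = η`. -/
def HasField (ξ : ι ⊕ ι → ℝ) (φ η : Modes ι) : Prop :=
  Tendsto (weylQuot ξ φ) (𝓝[≠] 0) (𝓝 η)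

theorem HasField.tendsto_weyl {ξ : ι ⊕ ι → ℝ} {φ η : Modes ι} (h : HasField ξ φ η) :
    Tendsto (fun t : ℝ => weyl (t • ξ) φ) (𝓝[≠] 0) (𝓝 φ) := by
  have h1 : Tendsto (fun t : ℝ => Complex.I * (t : ℂ)) (𝓝[≠] 0) (𝓝 0) := by
    have : Continuous fun t : ℝ => Complex.I * (t : ℂ) := by fun_prop
    simpa using (this.tendsto 0).mono_left nhdsWithin_le_nhds
  have h2 := (h1.smul h).add_const φ
  rw [zero_smul, zero_add] at h2
  refine h2.congr' ?_
  filter_upwards [self_mem_nhdsWithin] with t ht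
  have : Complex.I * (t : ℂ) ≠ 0 := mul_ne_zero Complex.I_ne_zero (by exact_mod_cast ht)
  rw [weylQuot, smul_smul, mul_inv_cancel₀ this, one_smul, sub_add_cancel]

theorem tendsto_neg_punctured : Tendsto (fun t : ℝ => -t) (𝓝[≠] 0) (𝓝[≠] 0) := by
  refine tendsto_nhdsWithin_iff.2 ⟨?_, ?_⟩
  · simpa using (continuous_neg.tendsto (0 : ℝ)).mono_left nhdsWithin_le_nhds
  · filter_upwards [self_mem_nhdsWithin] with t ht
    simpa using ht

/-- The slope at `0` of `s ↦ exp (c s)`. -/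
theorem tendsto_exp_sub_one_div (c : ℂ) :
    Tendsto (fun s : ℝ => (Complex.exp (c * s) - 1) / s) (𝓝[≠] 0) (𝓝 c) := by
  have h : HasDerivAt (fun s : ℝ => Complex.exp (c * s)) c 0 := by
    have h1 : HasDerivAt (fun s : ℂ => Complex.exp (c * s)) c ((0 : ℝ) : ℂ) := by
      simpa using ((hasDerivAt_id ((0 : ℝ) : ℂ)).const_mul c).cexp
    exact h1.comp_ofReal
  have h2 := hasDerivAt_iff_tendsto_slope.1 h
  refine h2.congr fun s => ?_
  simp [slope_def_module, div_eq_inv_mul]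

theorem tendsto_mul_punctured :
    Tendsto (fun p : ℝ × ℝ => p.1 * p.2) (𝓝[≠] 0 ×ˢ 𝓝[≠] 0) (𝓝[≠] 0) := by
  refine tendsto_nhdsWithin_iff.2 ⟨?_, ?_⟩
  · have h1 : Tendsto (fun p : ℝ × ℝ => p.1) (𝓝[≠] 0 ×ˢ 𝓝[≠] 0) (𝓝 0) :=
      tendsto_fst.mono_right nhdsWithin_le_nhds
    have h2 : Tendsto (fun p : ℝ × ℝ => p.2) (𝓝[≠] 0 ×ˢ 𝓝[≠] 0) (𝓝 0) :=
      tendsto_snd.mono_right nhdsWithin_le_nhds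
    simpa using h1.mul h2
  · have h1 : ∀ᶠ p : ℝ × ℝ in 𝓝[≠] 0 ×ˢ 𝓝[≠] 0, p.1 ≠ 0 :=
      tendsto_fst.eventually self_mem_nhdsWithin
    have h2 : ∀ᶠ p : ℝ × ℝ in 𝓝[≠] 0 ×ˢ 𝓝[≠] 0, p.2 ≠ 0 :=
      tendsto_snd.eventually self_mem_nhdsWithin
    filter_upwards [h1, h2] with p a b
    exact mul_ne_zero a b

/-- The canonical commutation relations for field operators. -/
theorem HasField.commutator {ξ ζ : ι ⊕ ι → ℝ} {φ η θ : Modes ι} (h1 : HasField ξ φ η)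
    (h2 : HasField ζ φ θ) :
    ⟪η, θ⟫_ℂ - ⟪θ, η⟫_ℂ = -(Complex.I * (symplForm ξ ζ : ℝ)) * ⟪φ, φ⟫_ℂ := by
  -- The left quotient is taken at `-t`, so that passing to the adjoint gives Weyl operators at
  -- `+t`. The terms with a single Weyl operator then cancel in the commutator, and no vector has to
  -- lie in the domain of a product of fields.
  have n1 : Tendsto (fun t => weylQuot ξ φ (-t)) (𝓝[≠] 0) (𝓝 η) := h1.comp tendsto_neg_punctured
  have n2 : Tendsto (fun t => weylQuot ζ φ (-t)) (𝓝[≠] 0) (𝓝 θ) := h2.comp tendsto_neg_punctured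
  have lim := (n1.inner h2 (𝕜 := ℂ)).sub (n2.inner h1 (𝕜 := ℂ))
  refine tendsto_nhds_unique lim ?_
  have hW : Tendsto (fun t : ℝ => weyl (t • ξ) (weyl (t • ζ) φ)) (𝓝[≠] 0) (𝓝 φ) := by
    rw [tendsto_iff_norm_sub_tendsto_zero]
    have a1 := tendsto_iff_norm_sub_tendsto_zero.1 h1.tendsto_weyl
    have a2 := tendsto_iff_norm_sub_tendsto_zero.1 h2.tendsto_weyl
    refine squeeze_zero (fun _ => norm_nonneg _) (fun t => ?_) (by simpa using a2.add a1)
    calc ‖weyl (t • ξ) (weyl (t • ζ) φ) - φ‖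
        = ‖weylIso (t • ξ) (weyl (t • ζ) φ - φ) + (weyl (t • ξ) φ - φ)‖ := by
          rw [map_sub, weylIso_apply, weylIso_apply]; congr 1; abel
      _ ≤ _ := (norm_add_le _ _).trans (by rw [LinearIsometry.norm_map])
  have hsq : Tendsto (fun t : ℝ => t * t) (𝓝[≠] 0) (𝓝[≠] 0) :=
    tendsto_mul_punctured.comp (tendsto_id.prodMk tendsto_id)
  have hE := (tendsto_exp_sub_one_div (-(Complex.I * (symplForm ξ ζ : ℝ)))).comp hsq
  have hin : Tendsto (fun t : ℝ => ⟪φ, weyl (t • ξ) (weyl (t • ζ) φ)⟫_ℂ) (𝓝[≠] 0) (𝓝 ⟪φ, φ⟫_ℂ) :=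
    tendsto_const_nhds.inner hW
  refine (hE.mul hin).congr' ?_
  filter_upwards [self_mem_nhdsWithin] with t ht
  have ht' : (t : ℂ) ≠ 0 := by exact_mod_cast ht
  have hc : weyl (t • ζ) (weyl (t • ξ) φ) =
      Complex.exp (-(Complex.I * (symplForm ξ ζ : ℝ)) * ((t * t : ℝ) : ℂ)) •
        weyl (t • ξ) (weyl (t • ζ) φ) := by
    rw [weyl_weyl, weyl_weyl, smul_smul, add_comm (t • ζ), ← Complex.exp_add]
    congr 2
    simp only [symplForm_smul_left, symplForm_smul_right, symplForm_swap ξ ζ]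
    push_cast
    ring
  have expand : ∀ (ξ ζ : ι ⊕ ι → ℝ), ⟪weylQuot ξ φ (-t), weylQuot ζ φ t⟫_ℂ =
      -((t * t : ℝ) : ℂ)⁻¹ * (⟪φ, weyl (t • ξ) (weyl (t • ζ) φ)⟫_ℂ - ⟪φ, weyl (t • ξ) φ⟫_ℂ
        - ⟪φ, weyl (t • ζ) φ⟫_ℂ + ⟪φ, φ⟫_ℂ) := by
    intro ξ ζ
    simp only [weylQuot, inner_smul_left, inner_smul_right, inner_sub_left, inner_sub_right,
      inner_weyl_left, neg_smul, neg_neg]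
    have : (starRingEnd ℂ) (Complex.I * ((-t : ℝ) : ℂ))⁻¹ * (Complex.I * (t : ℂ))⁻¹ =
        -((t * t : ℝ) : ℂ)⁻¹ := by
      simp only [map_inv₀, map_mul, Complex.conj_I, Complex.conj_ofReal]
      push_cast
      field_simp
      simp
    rw [← this]
    ring
  simp only [Function.comp]
  rw [expand, expand, hc, inner_smul_right]
  push_cast
  field_simp
  ring

theorem HasField.uncertainty {ξ ζ : ι ⊕ ι → ℝ} {φ η θ : Modes ι} (h1 : HasField ξ φ η)
    (h2 : HasField ζ φ θ) (hφ : ‖φ‖ = 1) : |symplForm ξ ζ| ≤ ‖η‖ ^ 2 + ‖θ‖ ^ 2 := by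
  have h := h1.commutator h2
  have hn := congrArg norm h
  rw [inner_self_eq_norm_sq_to_K, hφ] at hn
  simp only [norm_mul, norm_neg, Complex.norm_I, one_mul, Complex.norm_real,
    Real.norm_eq_abs] at hn
  have h3 : ‖⟪η, θ⟫_ℂ - ⟪θ, η⟫_ℂ‖ ≤ ‖η‖ * ‖θ‖ + ‖θ‖ * ‖η‖ :=
    (norm_sub_le _ _).trans (add_le_add (norm_inner_le_norm _ _) (norm_inner_le_norm _ _))
  have h4 : ‖((1 : ℝ) : ℂ) ^ 2‖ = 1 := by simp
  have h5 : |symplForm ξ ζ| ≤ ‖η‖ * ‖θ‖ + ‖θ‖ * ‖η‖ := by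
    refine le_trans (le_of_eq ?_) (hn ▸ h3)
    rw [show ‖((1 : ℝ) : ℂ) ^ 2‖ = 1 by simp] at *
    simp
  nlinarith [sq_nonneg (‖η‖ - ‖θ‖)]

theorem dotProduct_mulVec_comm {n : Type*} [Fintype n] {Γ : Matrix n n ℝ} (hΓ : Γ.IsSymm)
    (ξ ζ : n → ℝ) : ζ ⬝ᵥ Γ.mulVec ξ = ξ ⬝ᵥ Γ.mulVec ζ := by
  rw [Matrix.dotProduct_mulVec, ← Matrix.mulVec_transpose, hΓ.eq, dotProduct_comm]

/-- With `k ξ` the characteristic function along `ξ`, the inner product is `(k ξ s * k ζ t * exp (c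
s t) - k ξ s - k ζ t + 1) / (s t)`. It splits as `((k ξ s - 1) / s) * ((k ζ t - 1) / t)`, which
vanishes because `k` is even and smooth, plus `k ξ s * k ζ t * (exp (c s t) - 1) / (s t)`, which
tends to `c`. The limit is a joint one in `s` and `t`, as the Cauchy criterion requires. -/
theorem IsPureGaussianWithCov.tendsto_inner_weylQuot {ψ : Modes ι}
    {Γ : Matrix (ι ⊕ ι) (ι ⊕ ι) ℝ} (hψ : IsPureGaussianWithCov ψ Γ) (ξ ζ : ι ⊕ ι → ℝ) :
    Tendsto (fun p : ℝ × ℝ => ⟪weylQuot ξ ψ p.1, weylQuot ζ ψ p.2⟫_ℂ) (𝓝[≠] 0 ×ˢ 𝓝[≠] 0)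
      (𝓝 ((((ξ ⬝ᵥ Γ.mulVec ζ : ℝ) : ℂ) - Complex.I * (symplForm ξ ζ : ℝ)) / 2)) := by
  obtain ⟨hn, hs, hc⟩ := hψ
  set k : (ι ⊕ ι → ℝ) → ℝ → ℂ := fun ξ t => Complex.exp (-(((ξ ⬝ᵥ Γ.mulVec ξ : ℝ) : ℂ) / 4) * (t * t : ℝ))
    with hk
  have hsq : Tendsto (fun t : ℝ => t * t) (𝓝[≠] 0) (𝓝[≠] 0) :=
    tendsto_mul_punctured.comp (tendsto_id.prodMk tendsto_id)
  have hk1 : ∀ ξ, Tendsto (k ξ) (𝓝[≠] 0) (𝓝 1) := fun ξ => by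
    have : Continuous (k ξ) := by rw [hk]; fun_prop
    simpa [hk] using (this.tendsto 0).mono_left nhdsWithin_le_nhds
  have hk2 : ∀ ξ, Tendsto (fun t : ℝ => (k ξ t - 1) / t) (𝓝[≠] 0) (𝓝 0) := fun ξ => by
    have h1 := (tendsto_exp_sub_one_div (-(((ξ ⬝ᵥ Γ.mulVec ξ : ℝ) : ℂ) / 4))).comp hsq
    have h2 : Tendsto (fun t : ℝ => (t : ℂ)) (𝓝[≠] 0) (𝓝 0) := by
      simpa using (Complex.continuous_ofReal.tendsto 0).mono_left nhdsWithin_le_nhds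
    have h3 := h1.mul h2
    rw [mul_zero] at h3
    refine h3.congr' ?_
    filter_upwards [self_mem_nhdsWithin] with t ht
    have ht' : (t : ℂ) ≠ 0 := by exact_mod_cast ht
    simp only [Function.comp, hk]
    push_cast
    field_simp
  set c : ℂ := (((ξ ⬝ᵥ Γ.mulVec ζ : ℝ) : ℂ) - Complex.I * (symplForm ξ ζ : ℝ)) / 2 with hcdef
  have hA := ((hk2 ξ).comp tendsto_fst).mul
    ((hk2 ζ).comp (tendsto_snd (f := (𝓝[≠] (0 : ℝ)))))
  have hB := (((hk1 ξ).comp tendsto_fst).mul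
    ((hk1 ζ).comp (tendsto_snd (f := (𝓝[≠] (0 : ℝ)))))).mul
      ((tendsto_exp_sub_one_div c).comp tendsto_mul_punctured)
  have hAB := hA.add hB
  rw [mul_zero, zero_add, one_mul, one_mul] at hAB
  refine hAB.congr' ?_
  have e1 : ∀ᶠ p : ℝ × ℝ in 𝓝[≠] 0 ×ˢ 𝓝[≠] 0, p.1 ≠ 0 :=
    tendsto_fst.eventually self_mem_nhdsWithin
  have e2 : ∀ᶠ p : ℝ × ℝ in 𝓝[≠] 0 ×ˢ 𝓝[≠] 0, p.2 ≠ 0 :=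
    tendsto_snd.eventually self_mem_nhdsWithin
  filter_upwards [e1, e2] with p h1 h2
  have h1' : (p.1 : ℂ) ≠ 0 := by exact_mod_cast h1
  have h2' : (p.2 : ℂ) ≠ 0 := by exact_mod_cast h2
  have hchar : ∀ (ξ : ι ⊕ ι → ℝ) (t : ℝ), ⟪ψ, weyl (t • ξ) ψ⟫_ℂ = k ξ t := by
    intro ξ t
    rw [hc, hk]
    simp only [Complex.ofReal_exp]
    congr 1
    rw [Matrix.mulVec_smul, smul_dotProduct, dotProduct_smul]
    push_cast [smul_eq_mul]
    ring
  have hcross : ⟪ψ, weyl (-(p.1 • ξ)) (weyl (p.2 • ζ) ψ)⟫_ℂ =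
      k ξ p.1 * k ζ p.2 * Complex.exp (c * ((p.1 * p.2 : ℝ) : ℂ)) := by
    rw [weyl_weyl, inner_smul_right, hc, hk, hcdef, Complex.ofReal_exp]
    simp only [← Complex.exp_add]
    congr 1
    rw [← neg_smul, symplForm_smul_left, symplForm_smul_right]
    simp only [Matrix.mulVec_add, Matrix.mulVec_smul, add_dotProduct, dotProduct_add,
      smul_dotProduct, dotProduct_smul, smul_eq_mul, dotProduct_mulVec_comm hs ξ ζ]
    push_cast
    ring
  have hψψ : ⟪ψ, ψ⟫_ℂ = 1 := by rw [inner_self_eq_norm_sq_to_K, hn]; simp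
  have hneg : ⟪ψ, weyl (-(p.1 • ξ)) ψ⟫_ℂ = k ξ p.1 := by
    rw [← neg_smul, hchar, hk]; simp
  have hcoef : (starRingEnd ℂ) (Complex.I * (p.1 : ℂ))⁻¹ * (Complex.I * (p.2 : ℂ))⁻¹ =
      ((p.1 * p.2 : ℝ) : ℂ)⁻¹ := by
    simp only [map_inv₀, map_mul, Complex.conj_I, Complex.conj_ofReal]
    push_cast
    field_simp
    simp
  have expand : ⟪weylQuot ξ ψ p.1, weylQuot ζ ψ p.2⟫_ℂ = ((p.1 * p.2 : ℝ) : ℂ)⁻¹ *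
      (k ξ p.1 * k ζ p.2 * Complex.exp (c * ((p.1 * p.2 : ℝ) : ℂ)) - k ξ p.1 - k ζ p.2 + 1) := by
    simp only [weylQuot, inner_smul_left, inner_smul_right, inner_sub_left, inner_sub_right,
      inner_weyl_left, hcross, hneg, hchar, hψψ, ← hcoef]
    ring
  rw [expand]
  simp only [Function.comp]
  push_cast
  field_simp
  ring

/-- Expanding `‖a s - a t‖²` gives `L + L - 2 L = 0` in the limit, so `a` is Cauchy. -/
theorem exists_tendsto_of_tendsto_inner {E T : Type*} [NormedAddCommGroup E]
    [InnerProductSpace ℂ E] [CompleteSpace E] {l : Filter T} [l.NeBot] {a : T → E} {L : ℝ}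
    (h : Tendsto (fun p : T × T => ⟪a p.1, a p.2⟫_ℂ) (l ×ˢ l) (𝓝 (L : ℂ))) :
    ∃ η, Tendsto a l (𝓝 η) := by
  refine cauchy_map_iff_exists_tendsto.1 (cauchy_map_iff'.2 ?_)
  rw [Metric.uniformity_eq_comap_nhds_zero, tendsto_comap_iff]
  have hL' : Tendsto (fun p : T × T => (⟪a p.1, a p.2⟫_ℂ).re) (l ×ˢ l) (𝓝 L) :=
    (Complex.continuous_re.tendsto _).comp h
  have hd : Tendsto (fun t : T => (⟪a t, a t⟫_ℂ).re) l (𝓝 L) :=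
    hL'.comp (tendsto_id.prodMk tendsto_id)
  have h1 := (hd.comp (tendsto_fst (g := l))).add (hd.comp (tendsto_snd (f := l)))
  have h2 := (h1.sub (hL'.const_mul 2)).sqrt
  rw [show L + L - 2 * L = 0 by ring, Real.sqrt_zero] at h2
  refine h2.congr fun p => ?_
  simp only [Function.comp, dist_eq_norm]
  rw [← Real.sqrt_sq (norm_nonneg (a p.1 - a p.2)), @norm_sub_sq ℂ]
  congr 1
  rw [← @inner_self_eq_norm_sq ℂ, ← @inner_self_eq_norm_sq ℂ]
  simp only [RCLike.re_to_complex]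
  ring

/-- A Gaussian vector lies in the domain of every field: on the diagonal `ζ = ξ` the symplectic term
vanishes and the limiting inner product is real. -/
theorem IsPureGaussianWithCov.exists_hasField {ψ : Modes ι} {Γ : Matrix (ι ⊕ ι) (ι ⊕ ι) ℝ}
    (hψ : IsPureGaussianWithCov ψ Γ) (ξ : ι ⊕ ι → ℝ) : ∃ η, HasField ξ ψ η := by
  refine exists_tendsto_of_tendsto_inner (L := (ξ ⬝ᵥ Γ.mulVec ξ) / 2) ?_
  have hL := hψ.tendsto_inner_weylQuot ξ ξ
  have e : (((ξ ⬝ᵥ Γ.mulVec ξ : ℝ) : ℂ) - Complex.I * (symplForm ξ ξ : ℝ)) / 2 =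
      (((ξ ⬝ᵥ Γ.mulVec ξ) / 2 : ℝ) : ℂ) := by
    rw [symplForm_self]; push_cast; ring
  rwa [e] at hL

theorem IsPureGaussianWithCov.inner_field {ψ : Modes ι} {Γ : Matrix (ι ⊕ ι) (ι ⊕ ι) ℝ}
    (hψ : IsPureGaussianWithCov ψ Γ) {ξ ζ : ι ⊕ ι → ℝ} {η θ : Modes ι} (h1 : HasField ξ ψ η)
    (h2 : HasField ζ ψ θ) :
    ⟪η, θ⟫_ℂ = (((ξ ⬝ᵥ Γ.mulVec ζ : ℝ) : ℂ) - Complex.I * (symplForm ξ ζ : ℝ)) / 2 :=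
  tendsto_nhds_unique ((h1.comp tendsto_fst).inner (h2.comp tendsto_snd))
    (hψ.tendsto_inner_weylQuot ξ ζ)

theorem IsPureGaussianWithCov.norm_sq_field {ψ : Modes ι} {Γ : Matrix (ι ⊕ ι) (ι ⊕ ι) ℝ}
    (hψ : IsPureGaussianWithCov ψ Γ) {ξ : ι ⊕ ι → ℝ} {η : Modes ι} (h : HasField ξ ψ η) :
    ‖η‖ ^ 2 = (ξ ⬝ᵥ Γ.mulVec ξ) / 2 := by
  have h1 := congrArg Complex.re (hψ.inner_field h h)
  rw [symplForm_self] at h1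
  have h2 := @inner_self_eq_norm_sq ℂ _ _ _ _ η
  rw [RCLike.re_to_complex] at h2
  rw [← h2, h1]
  simp

variable [DecidableEq ι]

theorem IsQuadratureImage.hasField {k : ι ⊕ ι} {φ η : Modes ι} (h : IsQuadratureImage k φ η) :
    HasField (Pi.single k 1) φ η := h

theorem quadratureSq_eq {k : ι ⊕ ι} {φ η : Modes ι} (h : IsQuadratureImage k φ η) :
    quadratureSq k φ = ENNReal.ofReal (‖η‖ ^ 2) := by
  refine le_antisymm (iInf₂_le η h) (le_iInf₂ fun θ hθ => ?_)
  rw [tendsto_nhds_unique hθ h]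

theorem exists_image_of_quadratureSq_ne_top {k : ι ⊕ ι} {φ : Modes ι}
    (h : quadratureSq k φ ≠ ⊤) : ∃ η, IsQuadratureImage k φ η := by
  by_contra hne
  push Not at hne
  exact h (by simp [quadratureSq, hne])

theorem one_le_quadratureSq_add {φ : Modes ι} (hφ : ‖φ‖ = 1) (i : ι) :
    1 ≤ quadratureSq (.inl i) φ + quadratureSq (.inr i) φ := by
  by_cases h1 : quadratureSq (.inl i) φ = ⊤
  · simp [h1]
  by_cases h2 : quadratureSq (.inr i) φ = ⊤
  · simp [h2]
  obtain ⟨η, hη⟩ := exists_image_of_quadratureSq_ne_top h1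
  obtain ⟨θ, hθ⟩ := exists_image_of_quadratureSq_ne_top h2
  rw [quadratureSq_eq hη, quadratureSq_eq hθ, ← ENNReal.ofReal_add (by positivity) (by positivity)]
  have h := hη.hasField.uncertainty hθ.hasField hφ
  have e : symplForm (Pi.single (.inl i) 1 : ι ⊕ ι → ℝ) (Pi.single (.inr i) 1) = -1 := by
    simp [symplForm, Pi.single_apply]
  rw [e] at h
  simpa using h

/-- One factor `1 / 2` is that of the Hamiltonian, the other comes from the normalisation in which
`R_k²` has mean `Γ k k / 2`. -/
theorem IsPureGaussianWithCov.energy_eq {ψ : Modes ι} {Γ : Matrix (ι ⊕ ι) (ι ⊕ ι) ℝ}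
    (hψ : IsPureGaussianWithCov ψ Γ) : energy ψ = ENNReal.ofReal (Γ.trace / 4) := by
  have h : ∀ k, quadratureSq k ψ = ENNReal.ofReal (Γ k k / 2) ∧ 0 ≤ Γ k k / 2 := by
    intro k
    obtain ⟨η, hη⟩ := hψ.exists_hasField (Pi.single k 1)
    have h2 := hψ.norm_sq_field hη
    rw [Matrix.mulVec_single_one, single_one_dotProduct] at h2
    have h2 : ‖η‖ ^ 2 = Γ k k / 2 := h2
    exact ⟨by rw [quadratureSq_eq hη, h2], h2 ▸ by positivity⟩
  simp only [energy, h]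
  rw [← ENNReal.ofReal_sum_of_nonneg fun k _ => (h k).2]
  rw [show (2⁻¹ : ℝ≥0∞) = ENNReal.ofReal 2⁻¹ by rw [ENNReal.ofReal_inv_of_pos two_pos]; simp,
    ← ENNReal.ofReal_mul (by norm_num), ← Finset.sum_div, Matrix.trace]
  congr 1
  simp only [Matrix.diag_apply]
  ring

end Quadratures

end GaussianErgotropy

end

noncomputable section

namespace GaussianErgotropy

/-! ### Gaussian unitaries made of a linear substitution and a quadratic phase. -/

section SqueezeChirp

open Matrix

variable {ι : Type} [Fintype ι] [DecidableEq ι]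

theorem measurePreserving_mulVec {L : Matrix ι ι ℝ} (hL : L.det ≠ 0) :
    MeasurePreserving (fun x : ι → ℝ => L *ᵥ x) volume
      (ENNReal.ofReal |L.det⁻¹| • volume) :=
  ⟨(LinearMap.continuous_of_finiteDimensional (Matrix.toLin' L)).measurable,
    Real.map_matrix_volume_pi_eq_smul_volume_pi hL⟩

theorem quasiMeasurePreserving_mulVec {L : Matrix ι ι ℝ} (hL : L.det ≠ 0) :
    Measure.QuasiMeasurePreserving (fun x : ι → ℝ => L *ᵥ x) volume volume :=
  ⟨(measurePreserving_mulVec hL).measurable, by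
    rw [(measurePreserving_mulVec hL).map_eq]
    exact Measure.smul_absolutelyContinuous⟩

/-- The multiplier `|det L|^½ exp (i x·Yx / 2)`. -/
def chirp (L Y : Matrix ι ι ℝ) (x : ι → ℝ) : ℂ :=
  (Real.sqrt |L.det| : ℂ) * Complex.exp (Complex.I * ((x ⬝ᵥ Y *ᵥ x / 2 : ℝ) : ℂ))

theorem norm_chirp_sq (L Y : Matrix ι ι ℝ) (x : ι → ℝ) : ‖chirp L Y x‖ ^ 2 = |L.det| := by
  rw [chirp, norm_mul, mul_comm Complex.I, Complex.norm_exp_ofReal_mul_I, mul_one,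
    Complex.norm_real, Real.norm_eq_abs, sq_abs, Real.sq_sqrt (abs_nonneg _)]

theorem continuous_chirp (L Y : Matrix ι ι ℝ) : Continuous (chirp L Y) := by
  unfold chirp
  fun_prop

theorem memLp_squeezeChirp {L : Matrix ι ι ℝ} (hL : L.det ≠ 0) (Y : Matrix ι ι ℝ)
    (φ : Modes ι) : MemLp (fun x => chirp L Y x * φ (L *ᵥ x)) 2 volume := by
  have h : MemLp (fun x => φ (L *ᵥ x)) 2 volume :=
    ((Lp.memLp φ).smul_measure ENNReal.ofReal_ne_top).comp_measurePreserving
      (measurePreserving_mulVec hL)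
  refine (h.const_mul (Real.sqrt |L.det| : ℂ)).congr_norm
    ((continuous_chirp L Y).aestronglyMeasurable.mul h.1) (Eventually.of_forall fun x => ?_)
  simp only [norm_mul, chirp, mul_comm Complex.I, Complex.norm_exp_ofReal_mul_I, mul_one]

/-- The operator `(U φ)(x) = |det L|^½ exp (i x·Yx / 2) φ(L x)`. -/
def squeezeChirp {L : Matrix ι ι ℝ} (hL : L.det ≠ 0) (Y : Matrix ι ι ℝ) (φ : Modes ι) :
    Modes ι :=
  (memLp_squeezeChirp hL Y φ).toLp _

theorem squeezeChirp_coeFn {L : Matrix ι ι ℝ} (hL : L.det ≠ 0) (Y : Matrix ι ι ℝ) (φ : Modes ι) :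
    squeezeChirp hL Y φ =ᵐ[volume] fun x => chirp L Y x * φ (L *ᵥ x) :=
  (memLp_squeezeChirp hL Y φ).coeFn_toLp

theorem squeezeChirp_surjective {L : Matrix ι ι ℝ} (hL : L.det ≠ 0) (Y : Matrix ι ι ℝ) :
    Function.Surjective (squeezeChirp hL Y) := by
  intro φ
  have hu : IsUnit L.det := isUnit_iff_ne_zero.2 hL
  have hL' : L⁻¹.det ≠ 0 := by
    rw [det_nonsing_inv, Ring.inverse_eq_inv]; exact inv_ne_zero hL
  -- The inverse belongs to the same family: undo the substitution, and pull the opposite phase back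
  -- along it.
  refine ⟨squeezeChirp hL' (-(L⁻¹ᵀ * Y * L⁻¹)) φ, Lp.ext ?_⟩
  filter_upwards [squeezeChirp_coeFn hL Y (squeezeChirp hL' (-(L⁻¹ᵀ * Y * L⁻¹)) φ),
    (quasiMeasurePreserving_mulVec hL).ae (squeezeChirp_coeFn hL' (-(L⁻¹ᵀ * Y * L⁻¹)) φ)]
    with x h1 h2
  rw [h1, h2, mulVec_mulVec, nonsing_inv_mul _ hu, one_mulVec, ← mul_assoc]
  have e : (L *ᵥ x) ⬝ᵥ (-(L⁻¹ᵀ * Y * L⁻¹)) *ᵥ (L *ᵥ x) = -(x ⬝ᵥ Y *ᵥ x) := by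
    rw [neg_mulVec, dotProduct_neg, mulVec_mulVec, Matrix.mul_assoc, nonsing_inv_mul _ hu,
      Matrix.mul_one, ← mulVec_mulVec, dotProduct_mulVec, vecMul_transpose, mulVec_mulVec,
      nonsing_inv_mul _ hu, one_mulVec]
  have e2 : chirp L Y x * chirp L⁻¹ (-(L⁻¹ᵀ * Y * L⁻¹)) (L *ᵥ x) = 1 := by
    rw [chirp, chirp, e, mul_mul_mul_comm, ← Complex.exp_add, det_nonsing_inv,
      Ring.inverse_eq_inv, abs_inv, Real.sqrt_inv]
    have : Real.sqrt |L.det| ≠ 0 := by positivity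
    have h3 : ((Real.sqrt |L.det| : ℝ) : ℂ) * (((Real.sqrt |L.det|)⁻¹ : ℝ) : ℂ) = 1 := by
      rw [← Complex.ofReal_mul, mul_inv_cancel₀ this, Complex.ofReal_one]
    rw [h3, one_mul]
    convert Complex.exp_zero using 2
    push_cast
    ring
  rw [e2, one_mul]

/-- `squeezeChirp` as a unitary. -/
def squeezeChirpEquiv {L : Matrix ι ι ℝ} (hL : L.det ≠ 0) (Y : Matrix ι ι ℝ) :
    Modes ι ≃ₗᵢ[ℂ] Modes ι :=
  LinearIsometryEquiv.ofSurjective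
    { toFun := squeezeChirp hL Y
      map_add' := fun φ χ => by
        refine Lp.ext ?_
        filter_upwards [squeezeChirp_coeFn hL Y (φ + χ), squeezeChirp_coeFn hL Y φ,
          squeezeChirp_coeFn hL Y χ, Lp.coeFn_add (squeezeChirp hL Y φ) (squeezeChirp hL Y χ),
          (quasiMeasurePreserving_mulVec hL).ae (Lp.coeFn_add φ χ)] with x h1 h2 h3 h4 h5
        rw [h1, h4, Pi.add_apply, h2, h3, h5, Pi.add_apply, mul_add]
      map_smul' := fun c φ => by
        refine Lp.ext ?_
        filter_upwards [squeezeChirp_coeFn hL Y (c • φ), squeezeChirp_coeFn hL Y φ,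
          Lp.coeFn_smul c (squeezeChirp hL Y φ),
          (quasiMeasurePreserving_mulVec hL).ae (Lp.coeFn_smul c φ)] with x h1 h2 h4 h5
        rw [h1, RingHom.id_apply, h4, Pi.smul_apply, h2, h5, Pi.smul_apply, smul_eq_mul,
          smul_eq_mul, mul_left_comm]
      norm_map' := fun φ => by
        refine (sq_eq_sq₀ (norm_nonneg _) (norm_nonneg _)).1 ?_
        rw [norm_sq_modes, norm_sq_modes]
        have hmp := measurePreserving_mulVec hL
        have h := hmp.map_eq ▸ integral_map (μ := volume) (φ := fun x : ι → ℝ => L *ᵥ x)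
          (f := fun x => ‖φ x‖ ^ 2) hmp.measurable.aemeasurable
          (by rw [hmp.map_eq]
              exact ((Lp.aestronglyMeasurable φ).norm.pow 2).smul_measure _)
        rw [integral_smul_measure] at h
        have hpos : 0 < |L.det| := abs_pos.2 hL
        rw [ENNReal.toReal_ofReal (abs_nonneg _), abs_inv, smul_eq_mul] at h
        have h' : ∫ x, ‖φ x‖ ^ 2 = ∫ x, |L.det| * ‖φ (L *ᵥ x)‖ ^ 2 := by
          rw [integral_const_mul, ← h, mul_inv_cancel_left₀ hpos.ne']
        rw [h']
        refine integral_congr_ae ?_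
        filter_upwards [squeezeChirp_coeFn hL Y φ] with x hx
        simp only [LinearMap.coe_mk, AddHom.coe_mk]
        rw [hx, norm_mul, mul_pow, norm_chirp_sq] }
    (squeezeChirp_surjective hL Y)

theorem squeezeChirpEquiv_apply {L : Matrix ι ι ℝ} (hL : L.det ≠ 0) (Y : Matrix ι ι ℝ)
    (φ : Modes ι) : squeezeChirpEquiv hL Y φ = squeezeChirp hL Y φ := rfl

/-- The symplectic matrix by which `squeezeChirp` acts on phase space. -/
def squeezeChirpMatrix (L Y : Matrix ι ι ℝ) : Matrix (ι ⊕ ι) (ι ⊕ ι) ℝ :=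
  fromBlocks Lᵀ (-(Y * L⁻¹)) 0 L⁻¹

theorem squeezeChirpMatrix_mem {L Y : Matrix ι ι ℝ} (hL : L.det ≠ 0) (hY : Y.IsSymm) :
    squeezeChirpMatrix L Y ∈ symplecticGroup ι ℝ := by
  have hu : IsUnit L.det := isUnit_iff_ne_zero.2 hL
  rw [SymplecticGroup.mem_iff, squeezeChirpMatrix, J, fromBlocks_transpose, fromBlocks_multiply,
    fromBlocks_multiply]
  have h1 : Lᵀ * L⁻¹ᵀ = 1 := by rw [← transpose_mul, nonsing_inv_mul _ hu, transpose_one]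
  simp [h1, hY.eq, Matrix.mul_assoc, nonsing_inv_mul _ hu, ← Matrix.mul_assoc Lᵀ]

theorem squeezeChirp_weyl {L Y : Matrix ι ι ℝ} (hL : L.det ≠ 0) (hY : Y.IsSymm)
    (ξ : ι ⊕ ι → ℝ) (φ : Modes ι) :
    squeezeChirp hL Y (weyl ξ φ) =
      weyl (squeezeChirpMatrix L Y *ᵥ ξ) (squeezeChirp hL Y φ) := by
  have hu : IsUnit L.det := isUnit_iff_ne_zero.2 hL
  obtain ⟨u, v, rfl⟩ : ∃ u v, ξ = Sum.elim u v :=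
    ⟨fun i => ξ (.inl i), fun i => ξ (.inr i), by ext (i | i) <;> rfl⟩
  have hS : squeezeChirpMatrix L Y *ᵥ Sum.elim u v =
      Sum.elim (Lᵀ *ᵥ u - Y *ᵥ (L⁻¹ *ᵥ v)) (L⁻¹ *ᵥ v) := by
    rw [squeezeChirpMatrix, fromBlocks_mulVec]
    simp [neg_mulVec, sub_eq_add_neg]
  rw [hS]
  -- A shift by `v` after applying `L` is a shift by `w` before it; the linear part of the chirp
  -- increment along `w` supplies the change in the position component.
  set w := L⁻¹ *ᵥ v with hw
  have hv : v = L *ᵥ w := by rw [hw, mulVec_mulVec, mul_nonsing_inv _ hu, one_mulVec]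
  refine Lp.ext ?_
  filter_upwards [squeezeChirp_coeFn hL Y (weyl (Sum.elim u v) φ),
    weyl_coeFn (Sum.elim (Lᵀ *ᵥ u - Y *ᵥ w) w) (squeezeChirp hL Y φ),
    (quasiMeasurePreserving_mulVec hL).ae (weyl_coeFn (Sum.elim u v) φ),
    (measurePreserving_translate w).quasiMeasurePreserving.ae (squeezeChirp_coeFn hL Y φ)]
    with x h1 h2 h3 h4
  simp only [Sum.elim_inr] at h2 h3
  rw [h1, h2, h3, h4, ← mul_assoc, ← mul_assoc]
  have hx : (fun i => x i + w i) = x + w := rfl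
  have e1 : (fun i => (L *ᵥ x) i + v i) = L *ᵥ (x + w) := by
    rw [mulVec_add, ← hv]; rfl
  rw [e1, hx]
  congr 1
  rw [chirp, chirp, mul_assoc, mul_left_comm _ ((Real.sqrt |L.det| : ℝ) : ℂ)]
  congr 1
  rw [weylPhase, weylPhase, ← Complex.exp_add, ← Complex.exp_add, ← mul_add, ← mul_add,
    ← Complex.ofReal_add, ← Complex.ofReal_add]
  congr 3
  simp only [Sum.elim_inl, Sum.elim_inr]
  change x ⬝ᵥ Y *ᵥ x / 2 + (u ⬝ᵥ L *ᵥ x + u ⬝ᵥ v / 2) =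
    (Lᵀ *ᵥ u - Y *ᵥ w) ⬝ᵥ x + (Lᵀ *ᵥ u - Y *ᵥ w) ⬝ᵥ w / 2 + (x + w) ⬝ᵥ Y *ᵥ (x + w) / 2
  have t : ∀ y, (Lᵀ *ᵥ u) ⬝ᵥ y = u ⬝ᵥ L *ᵥ y := fun y => by
    rw [dotProduct_mulVec, mulVec_transpose]
  rw [sub_dotProduct, sub_dotProduct, t, t, ← hv, mulVec_add, add_dotProduct, dotProduct_add,
    dotProduct_add, dotProduct_comm (Y *ᵥ w) x, dotProduct_comm (Y *ᵥ w) w,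
    dotProduct_mulVec_comm hY x w]
  ring

theorem isGaussianUnitary_squeezeChirpEquiv {L Y : Matrix ι ι ℝ} (hL : L.det ≠ 0)
    (hY : Y.IsSymm) : IsGaussianUnitary (squeezeChirpEquiv hL Y) := by
  refine ⟨squeezeChirpMatrix L Y, squeezeChirpMatrix_mem hL hY, 0, fun ξ φ => ?_⟩
  rw [zero_dotProduct, Complex.ofReal_zero, mul_zero, Complex.exp_zero, one_smul,
    squeezeChirpEquiv_apply, squeezeChirpEquiv_apply, squeezeChirp_weyl hL hY]

/-- The inverse of `squeezeChirpMatrix`. -/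
def squeezeChirpMatrixInv (L Y : Matrix ι ι ℝ) : Matrix (ι ⊕ ι) (ι ⊕ ι) ℝ :=
  fromBlocks L⁻¹ᵀ (L⁻¹ᵀ * Y) 0 L

theorem squeezeChirpMatrix_mul_inv {L : Matrix ι ι ℝ} (hL : L.det ≠ 0) (Y : Matrix ι ι ℝ) :
    squeezeChirpMatrix L Y * squeezeChirpMatrixInv L Y = 1 := by
  have hu : IsUnit L.det := isUnit_iff_ne_zero.2 hL
  have h1 : Lᵀ * L⁻¹ᵀ = 1 := by rw [← transpose_mul, nonsing_inv_mul _ hu, transpose_one]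
  rw [squeezeChirpMatrix, squeezeChirpMatrixInv, fromBlocks_multiply, ← fromBlocks_one]
  congr 1
  · simp [h1]
  · rw [← Matrix.mul_assoc, h1]; simp [Matrix.mul_assoc, nonsing_inv_mul _ hu]
  · simp
  · simp [nonsing_inv_mul _ hu]

theorem IsPureGaussianWithCov.squeezeChirp {ψ : Modes ι} {Γ : Matrix (ι ⊕ ι) (ι ⊕ ι) ℝ}
    (hψ : IsPureGaussianWithCov ψ Γ) {L Y : Matrix ι ι ℝ} (hL : L.det ≠ 0) (hY : Y.IsSymm) :
    IsPureGaussianWithCov (squeezeChirpEquiv hL Y ψ)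
      ((squeezeChirpMatrixInv L Y)ᵀ * Γ * squeezeChirpMatrixInv L Y) := by
  obtain ⟨hn, hs, hc⟩ := hψ
  refine ⟨by rw [LinearIsometryEquiv.norm_map, hn], ?_, fun ξ => ?_⟩
  · rw [Matrix.IsSymm, transpose_mul, transpose_mul, transpose_transpose, hs.eq, Matrix.mul_assoc]
  · set T := squeezeChirpMatrixInv L Y
    have h1 : ξ = squeezeChirpMatrix L Y *ᵥ (T *ᵥ ξ) := by
      rw [mulVec_mulVec, squeezeChirpMatrix_mul_inv hL, one_mulVec]
    conv_lhs => rw [h1]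
    rw [squeezeChirpEquiv_apply, ← squeezeChirp_weyl hL hY, ← squeezeChirpEquiv_apply,
      ← squeezeChirpEquiv_apply, LinearIsometryEquiv.inner_map_map, hc]
    rw [← mulVec_mulVec, ← mulVec_mulVec, dotProduct_mulVec ξ, vecMul_transpose]

end SqueezeChirp

end GaussianErgotropy

end

noncomputable section

namespace GaussianErgotropy

/-! ### Standard form of a pure Gaussian state and the global minimum energy. -/

section StandardForm

open Matrix
open scoped MatrixOrder

variable {ι : Type} [Fintype ι]

theorem inner_weyl_eq_integral (ξ : ι ⊕ ι → ℝ) (φ χ : Modes ι) :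
    ⟪φ, weyl ξ χ⟫_ℂ =
      ∫ x, star (φ x) * (weylPhase ξ x * χ (fun i => x i + ξ (.inr i))) := by
  rw [L2.inner_def]
  refine integral_congr_ae ?_
  filter_upwards [weyl_coeFn ξ χ] with x hx
  rw [hx, RCLike.inner_apply, mul_comm]
  rfl

theorem integrable_norm_sq_modes (φ : Modes ι) : Integrable fun x => ‖φ x‖ ^ 2 :=
  (memLp_two_iff_integrable_sq_norm (Lp.aestronglyMeasurable φ)).1 (Lp.memLp φ)

/-- The Gaussian probability density `π^(-N/2) exp (-|x|²)`. -/
def gaussDensity (x : ι → ℝ) : ℝ :=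
  (∫ y : ι → ℝ, Real.exp (-∑ i, y i ^ 2))⁻¹ * Real.exp (-∑ i, x i ^ 2)

theorem integrable_exp_quadratic {b : ℝ} (hb : 0 < b) (c : ι → ℝ) :
    Integrable fun x : ι → ℝ => Real.exp (-b * ∑ i, x i ^ 2 + ∑ i, c i * x i) := by
  have h := (GaussianFourier.integrable_cexp_neg_mul_sum_add (b := (b : ℂ)) (by simpa using hb)
    (fun i : ι => (c i : ℂ))).re
  refine h.congr (Eventually.of_forall fun x => ?_)
  simp only [RCLike.re_to_complex]
  rw [← Complex.ofReal_re (Real.exp _)]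
  congr 1
  push_cast
  rfl

/-- Completing the square, with the Gaussian normalisation left as an integral because it cancels
wherever this is used. -/
theorem integral_cexp_quadratic_ratio {b : ℝ} (hb : 0 < b) (c : ι → ℂ) :
    ∫ x : ι → ℝ, Complex.exp (-b * ∑ i, (x i : ℂ) ^ 2 + ∑ i, c i * x i) =
      ((∫ x : ι → ℝ, Real.exp (-b * ∑ i, x i ^ 2) : ℝ) : ℂ) *
        Complex.exp ((∑ i, c i ^ 2) / (4 * b)) := by
  have h1 := GaussianFourier.integral_cexp_neg_mul_sum_add (b := (b : ℂ)) (by simpa using hb) c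
  have h2 := GaussianFourier.integral_cexp_neg_mul_sum_add (b := (b : ℂ)) (by simpa using hb)
    (fun _ : ι => (0 : ℂ))
  simp only [zero_mul, Finset.sum_const_zero, add_zero, ne_eq, OfNat.ofNat_ne_zero,
    not_false_eq_true, zero_pow, zero_div, Complex.exp_zero, mul_one] at h2
  rw [h1, ← h2, ← integral_complex_ofReal]
  congr 1
  refine integral_congr_ae (Eventually.of_forall fun x => ?_)
  push_cast
  rfl

theorem integral_exp_quadratic_ratio {b : ℝ} (hb : 0 < b) (c : ι → ℝ) :
    ∫ x : ι → ℝ, Real.exp (-b * ∑ i, x i ^ 2 + ∑ i, c i * x i) =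
      (∫ x : ι → ℝ, Real.exp (-b * ∑ i, x i ^ 2)) * Real.exp ((∑ i, c i ^ 2) / (4 * b)) := by
  have h := integral_cexp_quadratic_ratio hb (fun i => (c i : ℂ))
  apply Complex.ofReal_injective
  rw [Complex.ofReal_mul, ← integral_complex_ofReal]
  push_cast at h ⊢
  exact h

theorem integral_exp_quadratic_pos {b : ℝ} (hb : 0 < b) :
    0 < ∫ x : ι → ℝ, Real.exp (-b * ∑ i, x i ^ 2) := by
  have h := integrable_exp_quadratic (ι := ι) hb 0
  simp only [Pi.zero_apply, zero_mul, Finset.sum_const_zero, add_zero] at h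
  exact integral_exp_pos h

theorem gaussDensity_nonneg (x : ι → ℝ) : 0 ≤ gaussDensity x := by
  have : 0 ≤ ∫ y : ι → ℝ, Real.exp (-∑ i, y i ^ 2) := integral_nonneg fun _ => by positivity
  unfold gaussDensity; positivity

theorem integrable_gaussDensity : Integrable (gaussDensity (ι := ι)) := by
  have h := integrable_exp_quadratic (ι := ι) one_pos 0
  simp only [neg_mul, one_mul, Pi.zero_apply, zero_mul, Finset.sum_const_zero, add_zero] at h
  exact h.const_mul _

theorem integral_cexp_mul_gaussDensity (u : ι → ℝ) :
    ∫ x, Complex.exp (((∑ i, u i * x i : ℝ) : ℂ) * Complex.I) * (gaussDensity x : ℂ) =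
      Complex.exp (-((∑ i, u i ^ 2 : ℝ) : ℂ) / 4) := by
  have h := integral_cexp_quadratic_ratio (ι := ι) one_pos (fun i => (u i : ℂ) * Complex.I)
  have hpos := integral_exp_quadratic_pos (ι := ι) one_pos
  simp only [neg_mul, one_mul] at hpos
  set Z := ∫ y : ι → ℝ, Real.exp (-∑ i, y i ^ 2) with hZ
  have e : ∀ x : ι → ℝ, Complex.exp (((∑ i, u i * x i : ℝ) : ℂ) * Complex.I) *
      (gaussDensity x : ℂ) = (Z : ℂ)⁻¹ * Complex.exp (-((1 : ℝ) : ℂ) * ∑ i, (x i : ℂ) ^ 2 +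
        ∑ i, (u i : ℂ) * Complex.I * x i) := by
    intro x
    rw [gaussDensity, ← hZ]
    push_cast
    rw [mul_left_comm, ← Complex.exp_add]
    congr 2
    rw [add_comm, Finset.sum_mul, neg_one_mul]
    congr 1
    exact Finset.sum_congr rfl fun i _ => by ring
  simp only [e]
  rw [integral_const_mul, h]
  simp only [neg_mul, one_mul]
  rw [← hZ, ← mul_assoc, inv_mul_cancel₀ (by exact_mod_cast hpos.ne'), one_mul]
  congr 1
  simp only [mul_pow, Complex.I_sq, mul_neg, mul_one, Finset.sum_neg_distrib]
  push_cast
  ring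

/-- A Gaussian state whose position block is the identity has the position density of the
vacuum. -/
theorem norm_sq_ae_eq_gaussDensity {ψ : Modes ι}
    (h : ∀ u : ι → ℝ, ⟪ψ, weyl (Sum.elim u 0) ψ⟫_ℂ = Complex.exp (-((∑ i, u i ^ 2 : ℝ) : ℂ) / 4)) :
    (fun x => ‖ψ x‖ ^ 2) =ᵐ[volume] gaussDensity := by
  have i1 := integrable_norm_sq_modes ψ
  have i2 := integrable_gaussDensity (ι := ι)
  have m1 : AEMeasurable (fun x => ENNReal.ofReal (‖ψ x‖ ^ 2)) volume :=
    i1.1.aemeasurable.ennreal_ofReal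
  have m2 : AEMeasurable (fun x : ι → ℝ => ENNReal.ofReal (gaussDensity x)) volume :=
    i2.1.aemeasurable.ennreal_ofReal
  have f1 : IsFiniteMeasure (volume.withDensity fun x => ENNReal.ofReal (‖ψ x‖ ^ 2)) :=
    isFiniteMeasure_withDensity_ofReal i1.2
  have f2 : IsFiniteMeasure (volume.withDensity fun x : ι → ℝ => ENNReal.ofReal (gaussDensity x)) :=
    isFiniteMeasure_withDensity_ofReal i2.2
  have key : (volume.withDensity fun x => ENNReal.ofReal (‖ψ x‖ ^ 2)) =
      volume.withDensity fun x : ι → ℝ => ENNReal.ofReal (gaussDensity x) := by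
    -- Finite measures are determined by their characteristic functions, and Weyl operators without
    -- translation part give that of the position distribution.
    refine Measure.ext_of_charFunDual (funext fun Λ => ?_)
    classical
    obtain ⟨u, hΛ⟩ : ∃ u : ι → ℝ, ∀ x, Λ x = ∑ i, u i * x i := by
      refine ⟨fun i => Λ (Pi.single i 1), fun x => ?_⟩
      conv_lhs => rw [pi_eq_sum_univ' x]
      rw [map_sum]
      refine Finset.sum_congr rfl fun i _ => ?_
      rw [map_smul, smul_eq_mul, mul_comm]
    rw [charFunDual_apply, charFunDual_apply,
      integral_withDensity_eq_integral_toReal_smul₀ m1 (by simp),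
      integral_withDensity_eq_integral_toReal_smul₀ m2 (by simp)]
    have e2 := integral_cexp_mul_gaussDensity u
    have e1 := h u
    rw [inner_weyl_eq_integral] at e1
    refine Eq.trans ?_ (e1.trans (e2.symm.trans ?_))
    · refine integral_congr_ae (Eventually.of_forall fun x => ?_)
      simp only [Sum.elim_inr, Pi.zero_apply, add_zero, weylPhase, Sum.elim_inl, mul_zero,
        Finset.sum_const_zero, zero_div, hΛ]
      rw [ENNReal.toReal_ofReal (by positivity), Complex.real_smul, mul_left_comm, mul_comm Complex.I,
        mul_comm]
      congr 1
      rw [← Complex.normSq_eq_norm_sq, Complex.normSq_eq_conj_mul_self]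
      rfl
    · refine integral_congr_ae (Eventually.of_forall fun x => ?_)
      simp only [hΛ]
      rw [ENNReal.toReal_ofReal (gaussDensity_nonneg x), Complex.real_smul, mul_comm]
  have h3 := (withDensity_eq_iff_of_sigmaFinite m1 m2).1 key
  filter_upwards [h3] with x hx
  exact (ENNReal.ofReal_eq_ofReal_iff (by positivity) (gaussDensity_nonneg x)).1 hx

theorem dotProduct_fromBlocks_mulVec (A B C D : Matrix ι ι ℝ) (u v u' v' : ι → ℝ) :
    Sum.elim u v ⬝ᵥ (fromBlocks A B C D) *ᵥ Sum.elim u' v' =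
      u ⬝ᵥ A *ᵥ u' + u ⬝ᵥ B *ᵥ v' + v ⬝ᵥ C *ᵥ u' + v ⬝ᵥ D *ᵥ v' := by
  rw [fromBlocks_mulVec, sumElim_dotProduct_sumElim, dotProduct_add, dotProduct_add]
  simp only [Function.comp_def, Sum.elim_inl, Sum.elim_inr]
  ring

theorem symplForm_elim (u v u' v' : ι → ℝ) :
    symplForm (Sum.elim u v) (Sum.elim u' v') = u' ⬝ᵥ v - u ⬝ᵥ v' := by
  simp [symplForm, dotProduct, Finset.sum_sub_distrib]

/-- The form at `u` is `2 ‖(u·q) ψ‖²`. If `(u·q) ψ` were zero, its commutator with `u·p` would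
vanish on `ψ`, which forces `u = 0`. -/
theorem IsPureGaussianWithCov.posDef_position {ψ : Modes ι} {Γ : Matrix (ι ⊕ ι) (ι ⊕ ι) ℝ}
    (hψ : IsPureGaussianWithCov ψ Γ) : Γ.toBlocks₁₁.PosDef := by
  have hs : Γ.toBlocks₁₁.IsSymm := by
    ext i j
    exact congrFun (congrFun hψ.2.1 (.inl i)) (.inl j)
  refine Matrix.PosDef.of_dotProduct_mulVec_pos ?_ fun u hu => ?_
  · rw [Matrix.IsHermitian, conjTranspose_eq_transpose_of_trivial, hs.eq]
  · obtain ⟨η, hη⟩ := hψ.exists_hasField (Sum.elim u 0)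
    obtain ⟨θ, hθ⟩ := hψ.exists_hasField (Sum.elim 0 u)
    have h := hψ.norm_sq_field hη
    rw [← fromBlocks_toBlocks Γ, dotProduct_fromBlocks_mulVec] at h
    simp only [mulVec_zero, dotProduct_zero, add_zero, zero_dotProduct] at h
    have hη0 : η ≠ 0 := by
      rintro rfl
      have hc := hη.commutator hθ
      rw [symplForm_elim, inner_self_eq_norm_sq_to_K, hψ.1] at hc
      simp at hc
      exact hu hc
    have : 0 < ‖η‖ ^ 2 := by positivity
    rw [star_trivial]
    linarith

variable [DecidableEq ι]

/-- Purity in position representation. -/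
theorem IsPureGaussianWithCov.momentum_block {ψ : Modes ι} {C D : Matrix ι ι ℝ}
    (hψ : IsPureGaussianWithCov ψ (fromBlocks 1 C Cᵀ D)) (v : ι → ℝ) :
    v ⬝ᵥ D *ᵥ v = v ⬝ᵥ v + (C *ᵥ v) ⬝ᵥ (C *ᵥ v) := by
  obtain ⟨hn, hs, hc⟩ := hψ
  have hquad : ∀ u w : ι → ℝ, Sum.elim u w ⬝ᵥ (fromBlocks 1 C Cᵀ D) *ᵥ Sum.elim u w =
      u ⬝ᵥ u + 2 * (u ⬝ᵥ C *ᵥ w) + w ⬝ᵥ D *ᵥ w := fun u w => by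
    rw [dotProduct_fromBlocks_mulVec, one_mulVec, dotProduct_mulVec w Cᵀ u, vecMul_transpose,
      dotProduct_comm (C *ᵥ w) u]
    ring
  have hg := norm_sq_ae_eq_gaussDensity (ψ := ψ) fun u => by
    rw [hc, hquad]
    push_cast
    congr 1
    simp [dotProduct, sq]
  set Z := ∫ y : ι → ℝ, Real.exp (-∑ i, y i ^ 2) with hZ
  have hZpos : 0 < Z := by
    have := integral_exp_quadratic_pos (ι := ι) one_pos
    simpa only [neg_mul, one_mul] using this
  -- Plancherel for `x ↦ conj (ψ x) * ψ (x + w)`. Its modulus is known from the position density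
  -- alone, and the modulus of its Fourier transform is that of the characteristic function. Purity
  -- enters here: the off-diagonal density is a product of values of one wave function.
  have main : ∀ w : ι → ℝ,
      Real.exp (-(w ⬝ᵥ D *ᵥ w) / 2) * ((∫ x : ι → ℝ, Real.exp (-(2 * Real.pi ^ 2) * ∑ i, x i ^ 2)) *
        Real.exp ((C *ᵥ w) ⬝ᵥ (C *ᵥ w) / 2)) =
      Z⁻¹ ^ 2 * Real.exp (-(w ⬝ᵥ w)) * ((∫ x : ι → ℝ, Real.exp (-2 * ∑ i, x i ^ 2)) *
        Real.exp (w ⬝ᵥ w / 2)) := by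
    intro w
    set H : (ι → ℝ) → ℂ := fun x => star (ψ x) * ψ (fun i => x i + w i) with hH
    have mw := measurePreserving_translate w
    have hψw : MemLp (fun x : ι → ℝ => ψ (fun i => x i + w i)) 2 volume :=
      (Lp.memLp ψ).comp_measurePreserving mw
    have hH1 : Integrable H := by
      have := (Lp.memLp ψ).star.integrable_mul hψw
      exact this
    have hHn : ∀ᵐ x : ι → ℝ, ‖H x‖ ^ 2 = Z⁻¹ ^ 2 * Real.exp (-(w ⬝ᵥ w)) *
        Real.exp (-2 * ∑ i, x i ^ 2 + ∑ i, (-2 * w i) * x i) := by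
      filter_upwards [hg, mw.quasiMeasurePreserving.ae hg] with x h1 h2
      simp only [hH, norm_mul, norm_star, mul_pow, h1, h2, gaussDensity, ← hZ]
      rw [mul_mul_mul_comm, ← Real.exp_add, ← sq, mul_assoc (Z⁻¹ ^ 2), ← Real.exp_add]
      congr 2
      simp only [dotProduct, Finset.mul_sum, ← Finset.sum_neg_distrib, ← Finset.sum_add_distrib]
      exact Finset.sum_congr rfl fun i _ => by ring
    have hH2 : MemLp H 2 volume := by
      rw [memLp_two_iff_integrable_sq_norm hH1.1]
      exact ((integrable_exp_quadratic two_pos (fun i => -2 * w i)).const_mul _).congr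
        (hHn.mono fun x hx => hx.symm)
    obtain ⟨-, hP⟩ := plancherel_coordFourier hH1 hH2 hH1 hH2
    have hF : ∀ k, ‖coordFourier H k‖ ^ 2 = Real.exp (-(w ⬝ᵥ D *ᵥ w) / 2) *
        Real.exp (-(2 * Real.pi ^ 2) * ∑ i, k i ^ 2 + ∑ i, (2 * Real.pi * (C *ᵥ w) i) * k i) := by
      intro k
      have h1 := hc (Sum.elim (-(2 * Real.pi) • k) w)
      rw [inner_weyl_eq_integral, hquad] at h1
      have h2 : ∫ x, star (ψ x) * (weylPhase (Sum.elim (-(2 * Real.pi) • k) w) x *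
          ψ (fun i => x i + (Sum.elim (-(2 * Real.pi) • k) w) (.inr i))) =
          Complex.exp (Complex.I * (((-(2 * Real.pi) • k) ⬝ᵥ w / 2 : ℝ) : ℂ)) *
            coordFourier H k := by
        rw [coordFourier, ← integral_const_mul]
        refine integral_congr_ae (Eventually.of_forall fun x => ?_)
        simp only [hH, weylPhase, Sum.elim_inr, Sum.elim_inl]
        rw [mul_left_comm, ← mul_assoc (Complex.exp _) (Complex.exp _), ← Complex.exp_add]
        congr 2
        have : (∑ i, (-(2 * Real.pi) • k) i * x i) = -(2 * Real.pi * (k ⬝ᵥ x)) := by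
          rw [dotProduct, Finset.mul_sum, ← Finset.sum_neg_distrib]
          exact Finset.sum_congr rfl fun i _ => by simp; ring
        rw [this]
        push_cast [dotProduct]
        ring
      rw [h2] at h1
      have h3 := congrArg norm h1
      rw [norm_mul, mul_comm Complex.I, Complex.norm_exp_ofReal_mul_I, one_mul, Complex.norm_real,
        Real.norm_eq_abs, abs_of_pos (Real.exp_pos _)] at h3
      rw [h3, ← Real.exp_nat_mul, ← Real.exp_add]
      congr 1
      simp only [smul_dotProduct, dotProduct_smul, smul_eq_mul]
      have s1 : k ⬝ᵥ k = ∑ i, k i ^ 2 := by simp [dotProduct, sq]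
      have s2 : ∑ i, (2 * Real.pi * (C *ᵥ w) i) * k i = 2 * Real.pi * (k ⬝ᵥ C *ᵥ w) := by
        rw [dotProduct, Finset.mul_sum]
        exact Finset.sum_congr rfl fun i _ => by ring
      rw [s1, s2]
      push_cast
      ring
    have conv : ∀ z : ℂ, star z * z = ((‖z‖ ^ 2 : ℝ) : ℂ) := fun z => by
      rw [← Complex.normSq_eq_norm_sq, Complex.normSq_eq_conj_mul_self]; rfl
    simp only [conv, integral_complex_ofReal] at hP
    have hP := Complex.ofReal_injective hP
    rw [integral_congr_ae hHn, integral_congr_ae (Eventually.of_forall hF), integral_const_mul,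
      integral_const_mul, integral_exp_quadratic_ratio (by positivity),
      integral_exp_quadratic_ratio two_pos] at hP
    have s3 : (∑ i, (2 * Real.pi * (C *ᵥ w) i) ^ 2) / (4 * (2 * Real.pi ^ 2)) =
        (C *ᵥ w) ⬝ᵥ (C *ᵥ w) / 2 := by
      have : ∑ i, (2 * Real.pi * (C *ᵥ w) i) ^ 2 =
          4 * Real.pi ^ 2 * ((C *ᵥ w) ⬝ᵥ (C *ᵥ w)) := by
        rw [dotProduct, Finset.mul_sum]
        exact Finset.sum_congr rfl fun i _ => by ring
      rw [this]
      field_simp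
    have s4 : (∑ i, (-2 * w i) ^ 2) / (4 * 2) = w ⬝ᵥ w / 2 := by
      have : ∑ i, (-2 * w i) ^ 2 = 4 * (w ⬝ᵥ w) := by
        rw [dotProduct, Finset.mul_sum]
        exact Finset.sum_congr rfl fun i _ => by ring
      rw [this]
      ring
    rw [s3, s4] at hP
    exact hP
  -- The case `w = 0` relates the two Gaussian normalisations, which then cancel.
  have h0 := main 0
  have hv := main v
  simp only [mulVec_zero, dotProduct_zero, neg_zero, zero_div, Real.exp_zero, one_mul,
    mul_one] at h0
  have p1 := integral_exp_quadratic_pos (ι := ι) (b := 2 * Real.pi ^ 2) (by positivity)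
  rw [h0] at hv p1
  have h2 : Real.exp (-(v ⬝ᵥ D *ᵥ v) / 2 + (C *ᵥ v) ⬝ᵥ (C *ᵥ v) / 2) =
      Real.exp (-(v ⬝ᵥ v) + v ⬝ᵥ v / 2) := by
    rw [Real.exp_add, Real.exp_add]
    refine mul_left_cancel₀ p1.ne' ?_
    linear_combination hv
  have h3 := Real.exp_injective h2
  linarith

/-- By `momentum_block`, the vector `(w·p) ψ - ((C w)·q) ψ - i (w·q) ψ` has norm zero, so momenta
acting on `ψ` can be replaced by positions. The commutation of `v·p` and `w·p` then becomes the
symmetry of `C`. -/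
theorem IsPureGaussianWithCov.cross_block_symm {ψ : Modes ι} {C D : Matrix ι ι ℝ}
    (hψ : IsPureGaussianWithCov ψ (fromBlocks 1 C Cᵀ D)) (v w : ι → ℝ) :
    (C *ᵥ v) ⬝ᵥ w = v ⬝ᵥ C *ᵥ w := by
  choose P hP using fun w : ι → ℝ => hψ.exists_hasField (Sum.elim 0 w)
  choose Q hQ using fun u : ι → ℝ => hψ.exists_hasField (Sum.elim u 0)
  have hPP : ∀ w, ⟪P w, P w⟫_ℂ = ((w ⬝ᵥ w + (C *ᵥ w) ⬝ᵥ (C *ᵥ w) : ℝ) : ℂ) / 2 := fun w => by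
    rw [hψ.inner_field (hP w) (hP w), symplForm_self, dotProduct_fromBlocks_mulVec,
      hψ.momentum_block]
    simp
  have hQQ : ∀ a b, ⟪Q a, Q b⟫_ℂ = ((a ⬝ᵥ b : ℝ) : ℂ) / 2 := fun a b => by
    rw [hψ.inner_field (hQ a) (hQ b), symplForm_elim, dotProduct_fromBlocks_mulVec]
    simp
  have hPQ : ∀ w a, ⟪P w, Q a⟫_ℂ =
      (((C *ᵥ w) ⬝ᵥ a : ℝ) - Complex.I * ((a ⬝ᵥ w : ℝ) : ℂ)) / 2 := fun w a => by
    rw [hψ.inner_field (hP w) (hQ a), symplForm_elim, dotProduct_fromBlocks_mulVec,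
      dotProduct_mulVec w Cᵀ a, vecMul_transpose]
    simp
  have hQP : ∀ w a, ⟪Q a, P w⟫_ℂ =
      (((C *ᵥ w) ⬝ᵥ a : ℝ) + Complex.I * ((a ⬝ᵥ w : ℝ) : ℂ)) / 2 := fun w a => by
    rw [← inner_conj_symm, hPQ]
    simp [Complex.conj_ofNat]
  have hZ : ∀ w, P w = Q (C *ᵥ w) + Complex.I • Q w := fun w => by
    rw [← sub_eq_zero, ← inner_self_eq_zero (𝕜 := ℂ)]
    simp only [inner_sub_left, inner_sub_right, inner_add_left, inner_add_right, inner_smul_left,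
      inner_smul_right, hPP, hQQ, hPQ, hQP, Complex.conj_I, dotProduct_comm w (C *ᵥ w)]
    push_cast
    linear_combination (((w ⬝ᵥ w : ℝ) : ℂ) / 2) * Complex.I_mul_I
  have hcomm := (hP v).commutator (hP w)
  rw [symplForm_elim, zero_dotProduct, zero_dotProduct] at hcomm
  rw [hZ v, hZ w] at hcomm
  simp only [inner_add_left, inner_add_right, inner_smul_left, inner_smul_right, hQQ,
    Complex.conj_I] at hcomm
  have him := congrArg Complex.im hcomm
  simp at him
  rw [dotProduct_comm w (C *ᵥ v), dotProduct_comm (C *ᵥ w) v] at him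
  linarith

/-- The cross block is symmetric by `cross_block_symm` and antisymmetric by assumption, hence zero;
the momentum block then has unit diagonal. -/
theorem IsPureGaussianWithCov.trace_standard {ψ : Modes ι} {C D : Matrix ι ι ℝ}
    (hψ : IsPureGaussianWithCov ψ (fromBlocks 1 C Cᵀ D)) (hC : Cᵀ = -C) :
    (fromBlocks 1 C Cᵀ D).trace = 2 * Fintype.card ι := by
  have hC0 : C = 0 := by
    ext i j
    have h := hψ.cross_block_symm (Pi.single i 1) (Pi.single j 1)
    rw [mulVec_single_one, mulVec_single_one, dotProduct_single_one, single_one_dotProduct] at h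
    have h' : C j i = C i j := h
    have h2 := congrFun (congrFun hC i) j
    simp only [transpose_apply, Matrix.neg_apply] at h2
    simp only [Matrix.zero_apply]
    linarith
  have hD : ∀ i, D i i = 1 := fun i => by
    have h := hψ.momentum_block (Pi.single i 1)
    rw [hC0, zero_mulVec, dotProduct_zero, add_zero, mulVec_single_one,
      single_one_dotProduct] at h
    simpa using h
  simp [Matrix.trace, hD]
  ring

theorem IsPureGaussianWithCov.globalMinEnergy_le {ψ : Modes ι} {Γ : Matrix (ι ⊕ ι) (ι ⊕ ι) ℝ}
    (hψ : IsPureGaussianWithCov ψ Γ) :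
    globalMinEnergy ψ ≤ ENNReal.ofReal (Fintype.card ι / 2) := by
  have hpd := hψ.posDef_position
  obtain ⟨B, hB⟩ : ∃ B : Matrix ι ι ℝ, Γ.toBlocks₁₁ = Bᵀ * B := by
    obtain ⟨B, hB⟩ := CStarAlgebra.nonneg_iff_eq_star_mul_self.mp hpd.posSemidef.nonneg
    exact ⟨B, by rw [hB, star_eq_conjTranspose, conjTranspose_eq_transpose_of_trivial]⟩
  set L := Bᵀ with hLdef
  have hA : Γ.toBlocks₁₁ = L * Lᵀ := by rw [hB, hLdef, transpose_transpose]
  have hL : L.det ≠ 0 := by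
    intro h0
    have := hpd.det_pos
    rw [hA, det_mul, h0, zero_mul] at this
    exact lt_irrefl _ this
  have hu : IsUnit L.det := isUnit_iff_ne_zero.2 hL
  set M := L⁻¹ * Γ.toBlocks₁₂ * L with hM
  -- After the substitution by `L` the cross block is `M`, and a chirp adds the symmetric matrix
  -- `Y`. This `Y` cancels the symmetric part of `M`.
  set Y := -((1 / 2 : ℝ) • (M + Mᵀ)) with hYdef
  have hY : Y.IsSymm := by
    rw [Matrix.IsSymm, hYdef, transpose_neg, transpose_smul, transpose_add, transpose_transpose,
      add_comm]
  have hU := hψ.squeezeChirp hL hY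
  set Γ' := (squeezeChirpMatrixInv L Y)ᵀ * Γ * squeezeChirpMatrixInv L Y with hΓ'
  have h1 : Lᵀ * L⁻¹ᵀ = 1 := by rw [← transpose_mul, nonsing_inv_mul _ hu, transpose_one]
  have hblocks : Γ' = fromBlocks 1 (Y + M) (Y + M)ᵀ Γ'.toBlocks₂₂ := by
    have hform : Γ'.toBlocks₁₁ = 1 ∧ Γ'.toBlocks₁₂ = Y + M := by
      rw [hΓ', ← fromBlocks_toBlocks Γ, squeezeChirpMatrixInv, fromBlocks_transpose,
        fromBlocks_multiply, fromBlocks_multiply, toBlocks_fromBlocks₁₁, toBlocks_fromBlocks₁₂, hA]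
      simp only [transpose_transpose, transpose_zero, Matrix.zero_mul, add_zero, Matrix.mul_zero]
      constructor
      · rw [← Matrix.mul_assoc, nonsing_inv_mul _ hu, Matrix.one_mul, h1]
      · rw [← Matrix.mul_assoc L⁻¹, nonsing_inv_mul _ hu, Matrix.one_mul, ← Matrix.mul_assoc, h1,
          Matrix.one_mul]
    have h21 : Γ'.toBlocks₂₁ = (Y + M)ᵀ := by
      rw [← hform.2]
      ext i j
      exact (congrFun (congrFun hU.2.1 (.inr i)) (.inl j)).symm
    conv_lhs => rw [← fromBlocks_toBlocks Γ', hform.1, hform.2, h21]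
  have hanti : (Y + M)ᵀ = -(Y + M) := by
    rw [transpose_add, hY.eq, hYdef]
    ext i j
    simp
    ring
  have htr : Γ'.trace = 2 * Fintype.card ι := by
    rw [hblocks] at hU ⊢
    exact hU.trace_standard hanti
  refine (iInf₂_le _ (isGaussianUnitary_squeezeChirpEquiv hL hY)).trans ?_
  rw [hU.energy_eq, htr]
  exact le_of_eq (by congr 1; ring)

end StandardForm

end GaussianErgotropy

end

noncomputable section

namespace GaussianErgotropy

/-! ### Entropy of an operator with a known eigenbasis. -/

section SpectralEntropy

variable {E : Type} [NormedAddCommGroup E] [InnerProductSpace ℂ E] [CompleteSpace E]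

/-- The continuous functional calculus acts on eigenvectors through the eigenvalue. -/
theorem cfc_apply_eigenvector {T : E →L[ℂ] E} (hT : IsSelfAdjoint T) {f : ℝ → ℝ}
    (hf : Continuous f) {r : ℝ} {v : E} (hv : T v = (r : ℂ) • v) :
    cfc f T v = (f r : ℂ) • v := by
  rcases eq_or_ne v 0 with rfl | hv0
  · simp
  have hr : r ∈ spectrum ℝ T := by
    rw [spectrum.mem_iff]
    intro hu
    have h0 : (algebraMap ℝ (E →L[ℂ] E) r - T) v = 0 := by
      rw [Algebra.algebraMap_eq_smul_one]
      simp [hv]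
    obtain ⟨u, hu⟩ := hu
    have h1 : ((↑u⁻¹ : E →L[ℂ] E) * ↑u) v = 0 := by
      rw [hu, mul_apply_eq_comp, h0, map_zero]
    rw [Units.inv_mul] at h1
    exact hv0 h1
  -- True for constants and the identity, stable under algebra operations, and closed:
  -- Stone–Weierstrass does the rest.
  have key : ∀ g : C(spectrum ℝ T, ℝ), cfcHom hT g v = (g ⟨r, hr⟩ : ℂ) • v := by
    intro g
    induction g using ContinuousMap.induction_on_of_compact with
    | const s =>
      have : (ContinuousMap.const (spectrum ℝ T) s) = algebraMap ℝ _ s := rfl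
      rw [this, AlgHomClass.commutes, Algebra.algebraMap_eq_smul_one]
      simp
    | id => rw [cfcHom_id hT, hv]; rfl
    | star_id => rw [map_star, cfcHom_id hT, hT.star_eq, hv]; rfl
    | add f g hf hg => rw [map_add]; simp [hf, hg, add_smul]
    | mul f g hf hg =>
      rw [map_mul, mul_apply_eq_comp, hg, map_smul, hf, smul_smul, ContinuousMap.mul_apply,
        Complex.ofReal_mul, mul_comm]
    | frequently f hf =>
      have hcl : IsClosed {g : C(spectrum ℝ T, ℝ) | cfcHom hT g v = (g ⟨r, hr⟩ : ℂ) • v} := by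
        refine isClosed_eq ?_ ?_
        · exact (ContinuousLinearMap.apply ℂ E v).continuous.comp (cfcHom_continuous hT)
        · exact (Complex.continuous_ofReal.comp (continuous_eval_const _)).smul
            continuous_const
      exact hcl.closure_subset (mem_closure_iff_frequently.2 hf)
  rw [cfc_apply f T hT hf.continuousOn, key]
  rfl

theorem tsum_ofReal_norm_inner_sq {E I : Type*}
    [NormedAddCommGroup E] [InnerProductSpace ℂ E] (b : HilbertBasis I ℂ E) (x : E) :
    ∑' i, ENNReal.ofReal (‖⟪x, b i⟫_ℂ‖ ^ 2) = ENNReal.ofReal (‖x‖ ^ 2) := by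
  have h := b.hasSum_inner_mul_inner x x
  have e : ∀ i, ⟪x, b i⟫_ℂ * ⟪b i, x⟫_ℂ = ((‖⟪x, b i⟫_ℂ‖ ^ 2 : ℝ) : ℂ) := fun i => by
    rw [← inner_conj_symm (b i) x, Complex.mul_conj, Complex.normSq_eq_norm_sq]
  simp only [e, inner_self_eq_norm_sq_to_K] at h
  have h' : HasSum (fun i => ‖⟪x, b i⟫_ℂ‖ ^ 2) (‖x‖ ^ 2) := by
    have := Complex.hasSum_re h
    simpa [← Complex.ofReal_pow] using this
  rw [← h'.tsum_eq, ENNReal.ofReal_tsum_of_nonneg (fun i => by positivity) h'.summable]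

/-- The trace of a positive diagonal operator is the sum of its eigenvalues. -/
theorem posTrace_eq_of_eigenbasis {I : Type*} (b : HilbertBasis I ℂ E) {A : E →L[ℂ] E}
    (hA : IsSelfAdjoint A) {ν : I → ℝ} (hν : ∀ i, 0 ≤ ν i) (h : ∀ i, A (b i) = (ν i : ℂ) • b i) :
    posTrace A = ∑' i, ENNReal.ofReal (ν i) := by
  have hx : ∀ x : E, ENNReal.ofReal (⟪x, A x⟫_ℂ).re =
      ∑' i, ENNReal.ofReal (ν i) * ENNReal.ofReal (‖⟪b i, x⟫_ℂ‖ ^ 2) := by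
    intro x
    have h1 := b.hasSum_inner_mul_inner x (A x)
    have e : ∀ i, ⟪x, b i⟫_ℂ * ⟪b i, A x⟫_ℂ = ((ν i * ‖⟪b i, x⟫_ℂ‖ ^ 2 : ℝ) : ℂ) := fun i => by
      have : ⟪b i, A x⟫_ℂ = ν i * ⟪b i, x⟫_ℂ := by
        rw [← hA.isSymmetric.apply_clm, h, inner_smul_left, Complex.conj_ofReal]
      rw [this, ← inner_conj_symm x (b i), mul_left_comm, mul_comm (starRingEnd ℂ _),
        Complex.mul_conj, Complex.normSq_eq_norm_sq, Complex.ofReal_mul]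
    simp only [e] at h1
    have h2 : HasSum (fun i => ν i * ‖⟪b i, x⟫_ℂ‖ ^ 2) (⟪x, A x⟫_ℂ).re := Complex.hasSum_re h1
    rw [← h2.tsum_eq, ENNReal.ofReal_tsum_of_nonneg
      (fun i => mul_nonneg (hν i) (by positivity)) h2.summable]
    exact tsum_congr fun i => ENNReal.ofReal_mul (hν i)
  rw [posTrace]
  simp only [hx]
  -- All terms are nonnegative, so the two sums may be exchanged; Parseval then turns the inner one
  -- into the norm of a unit vector. This also makes the trace independent of the chosen basis.
  rw [ENNReal.tsum_comm]
  refine tsum_congr fun i => ?_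
  rw [ENNReal.tsum_mul_left, tsum_ofReal_norm_inner_sq, b.orthonormal.1 i]
  simp

/-- The family `u` need not be complete: the vectors that extend it to a Hilbert basis have
eigenvalue `0`, where `-x log x` vanishes. -/
theorem vonNeumannEntropy_eq_tsum {J : Type*} {u : J → E} (hu : Orthonormal ℂ u) {T : E →L[ℂ] E}
    (hT : IsSelfAdjoint T) {r : J → ℝ} (h0 : ∀ j, 0 ≤ r j) (h1 : ∀ j, r j ≤ 1)
    (h : ∀ j, T (u j) = (r j : ℂ) • u j) (hker : ∀ x, (∀ j, ⟪u j, x⟫_ℂ = 0) → T x = 0) :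
    vonNeumannEntropy T = ∑' j, ENNReal.ofReal (Real.negMulLog (r j)) := by
  classical
  have hinj : Function.Injective u := hu.linearIndependent.injective
  have hs : Orthonormal ℂ ((↑) : Set.range u → E) := hu.toSubtypeRange
  obtain ⟨w, b, hw, hb⟩ := hs.exists_hilbertBasis_extension
  let g : J → w := fun j => ⟨u j, hw ⟨j, rfl⟩⟩
  have hg : Function.Injective g := fun i j hij => hinj (congrArg Subtype.val hij)
  let ν : w → ℝ := fun x => if hx : ∃ j, g j = x then r hx.choose else 0
  have hνg : ∀ j, ν (g j) = r j := fun j => by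
    have hx : ∃ i, g i = g j := ⟨j, rfl⟩
    simp only [ν, dif_pos hx]
    rw [hg hx.choose_spec]
  have hνn : ∀ x, (¬ ∃ j, g j = x) → ν x = 0 := fun x hx => by simp only [ν, dif_neg hx]
  have hνb : ∀ x, 0 ≤ ν x ∧ ν x ≤ 1 := fun x => by
    by_cases hx : ∃ j, g j = x
    · obtain ⟨j, rfl⟩ := hx
      rw [hνg]; exact ⟨h0 j, h1 j⟩
    · rw [hνn x hx]; exact ⟨le_rfl, zero_le_one⟩
  have hTb : ∀ x, T (b x) = (ν x : ℂ) • b x := fun x => by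
    by_cases hx : ∃ j, g j = x
    · obtain ⟨j, rfl⟩ := hx
      have : b (g j) = u j := by rw [hb]
      rw [hνg, this, h]
    · rw [hνn x hx, Complex.ofReal_zero, zero_smul]
      refine hker _ fun j => ?_
      have : u j = b (g j) := by rw [hb]
      rw [this]
      exact b.orthonormal.2 fun hj => hx ⟨j, hj⟩
  rw [vonNeumannEntropy, posTrace_eq_of_eigenbasis b (cfc_predicate _ _)
    (ν := fun x => Real.negMulLog (ν x))
    (fun x => Real.negMulLog_nonneg (hνb x).1 (hνb x).2)
    (fun x => cfc_apply_eigenvector hT Real.continuous_negMulLog (hTb x))]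
  rw [← hg.tsum_eq (f := fun x => ENNReal.ofReal (Real.negMulLog (ν x)))]
  · simp only [hνg]
  · intro x hx
    by_contra hne
    refine hx ?_
    simp only
    rw [hνn x fun ⟨j, hj⟩ => hne ⟨j, hj⟩]
    simp

theorem vonNeumannEntropy_pureState {ψ : E} (hψ : ‖ψ‖ = 1) :
    vonNeumannEntropy (pureState ψ) = 0 := by
  rw [vonNeumannEntropy_eq_tsum (J := Unit) (u := fun _ => ψ) (r := fun _ => 1)]
  · simp
  · exact ⟨fun _ => hψ, fun i j hij => (hij rfl).elim⟩
  · exact (InnerProductSpace.isPositive_rankOne_self ψ).isSelfAdjoint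
  · exact fun _ => zero_le_one
  · exact fun _ => le_rfl
  · intro _
    simp [pureState, inner_self_eq_norm_sq_to_K, hψ]
  · intro x hx
    simp [pureState, hx ()]

end SpectralEntropy

end GaussianErgotropy

end

noncomputable section

namespace GaussianErgotropy

/-! ### Schmidt decomposition in an abstract Hilbert tensor product. -/

section Schmidt

set_option linter.unusedSectionVars false

open ContinuousLinearMap

/-- Glue Hilbert bases of all the eigenspaces, which are mutually orthogonal and have jointly
trivial orthogonal complement by the compact spectral theorem. -/
theorem exists_eigenbasis {E : Type} [NormedAddCommGroup E] [InnerProductSpace ℂ E]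
    [CompleteSpace E] {T : E →L[ℂ] E} (hc : IsCompactOperator T) (hs : IsSelfAdjoint T) :
    ∃ (J : Type) (b : HilbertBasis J ℂ E) (μ : J → ℂ), ∀ j, T (b j) = μ j • b j := by
  have hsym : T.IsSymmetric := hs.isSymmetric
  have hcomp : ∀ μ : ℂ, CompleteSpace (Module.End.eigenspace (T : Module.End ℂ E) μ) := fun μ => by
    have : IsClosed ((Module.End.eigenspace (T : Module.End ℂ E) μ : Submodule ℂ E) : Set E) := by
      have e : ((Module.End.eigenspace (T : Module.End ℂ E) μ : Submodule ℂ E) : Set E) =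
          {x | T x = μ • x} := by
        ext x; exact Module.End.mem_eigenspace_iff
      rw [e]
      exact isClosed_eq T.continuous (continuous_const_smul μ)
    exact this.completeSpace_coe
  choose w b hb using fun μ : ℂ =>
    exists_hilbertBasis ℂ (Module.End.eigenspace (T : Module.End ℂ E) μ)
  let u : (Σ μ : ℂ, w μ) → E := fun p => (b p.1 p.2 : E)
  have hu : Orthonormal ℂ u :=
    hsym.orthogonalFamily_eigenspaces.orthonormal_sigma_orthonormal fun μ => (b μ).orthonormal
  have htop : (Submodule.span ℂ (Set.range u))ᗮ = ⊥ := by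
    rw [eq_bot_iff, ← orthogonalComplement_iSup_eigenspaces_eq_bot hc hsym]
    intro x hx
    rw [Submodule.mem_orthogonal]
    intro y hy
    refine Submodule.iSup_induction _ (motive := fun y => ⟪y, x⟫_ℂ = 0) hy ?_ (by simp) ?_
    · intro μ y hy
      have hsum := ((b μ).hasSum_repr ⟨y, hy⟩).mapL
        (Module.End.eigenspace (T : Module.End ℂ E) μ).subtypeL
      have hsum2 := hsum.mapL (innerSL ℂ x)
      have hz : ∀ i, innerSL ℂ x ((Module.End.eigenspace (T : Module.End ℂ E) μ).subtypeL
          ((b μ).repr ⟨y, hy⟩ i • b μ i)) = 0 := fun i => by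
        rw [map_smul, map_smul]
        have h0 : ⟪u ⟨μ, i⟩, x⟫_ℂ = 0 := Submodule.inner_right_of_mem_orthogonal
          (Submodule.subset_span (Set.mem_range_self (f := u) ⟨μ, i⟩)) hx
        have h1 : ⟪x, u ⟨μ, i⟩⟫_ℂ = 0 := inner_eq_zero_symm.1 h0
        exact (congrArg _ h1).trans (smul_zero _)
      simp only [hz] at hsum2
      have := hsum2.unique hasSum_zero
      exact inner_eq_zero_symm.1 this
    · intro y z hy hz
      rw [inner_add_left, hy, hz, add_zero]
  refine ⟨_, HilbertBasis.mkOfOrthogonalEqBot hu htop, fun p => p.1, fun p => ?_⟩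
  rw [HilbertBasis.coe_mkOfOrthogonalEqBot]
  exact Module.End.mem_eigenspace_iff.1 (b p.1 p.2).2

variable {H₁ H₂ H : Type} [NormedAddCommGroup H₁] [InnerProductSpace ℂ H₁] [CompleteSpace H₁]
  [NormedAddCommGroup H₂] [InnerProductSpace ℂ H₂] [CompleteSpace H₂]
  [NormedAddCommGroup H] [InnerProductSpace ℂ H] [CompleteSpace H]

/-- A bounded bilinear map which realises `H` as the Hilbert tensor product of `H₁` and `H₂`. -/
structure IsHilbertTensor (T : H₁ →L[ℂ] H₂ →L[ℂ] H) : Prop where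
  inner_apply : ∀ a b a' b', ⟪T a b, T a' b'⟫_ℂ = ⟪a, a'⟫_ℂ * ⟪b, b'⟫_ℂ
  total : ∀ x, (∀ a b, ⟪T a b, x⟫_ℂ = 0) → x = 0

theorem IsHilbertTensor.flip {T : H₁ →L[ℂ] H₂ →L[ℂ] H} (hT : IsHilbertTensor T) :
    IsHilbertTensor T.flip where
  inner_apply a b a' b' := by
    rw [flip_apply, flip_apply, hT.inner_apply, mul_comm]
  total x hx := hT.total x fun a b => hx b a

/-- The partial inner product of `ψ` with `x ∈ H₂`. -/
def partialInner (T : H₁ →L[ℂ] H₂ →L[ℂ] H) (ψ : H) (x : H₂) : H₁ :=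
  adjoint (T.flip x) ψ

theorem inner_partialInner (T : H₁ →L[ℂ] H₂ →L[ℂ] H) (ψ : H) (x : H₂) (a : H₁) :
    ⟪a, partialInner T ψ x⟫_ℂ = ⟪T a x, ψ⟫_ℂ := by
  rw [partialInner, adjoint_inner_right, flip_apply]

/-- Products of basis vectors form a Hilbert basis of `H`; expand `ψ` in it and sum over the first
factor. -/
theorem IsHilbertTensor.hasSum_partialInner {T : H₁ →L[ℂ] H₂ →L[ℂ] H} (hT : IsHilbertTensor T)
    (ψ : H) {J : Type} (u : HilbertBasis J ℂ H₂) :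
    HasSum (fun j => T (partialInner T ψ (u j)) (u j)) ψ := by
  obtain ⟨w, e, -⟩ := exists_hilbertBasis ℂ H₁
  have ho : Orthonormal ℂ (fun p : J × w => T (e p.2) (u p.1)) := by
    classical
    rw [orthonormal_iff_ite]
    rintro ⟨j, i⟩ ⟨j', i'⟩
    rw [hT.inner_apply, orthonormal_iff_ite.1 e.orthonormal, orthonormal_iff_ite.1 u.orthonormal]
    by_cases h1 : i = i' <;> by_cases h2 : j = j' <;> simp [h1, h2]
  have htop : (Submodule.span ℂ (Set.range fun p : J × w => T (e p.2) (u p.1)))ᗮ = ⊥ := by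
    rw [eq_bot_iff]
    intro x hx
    have hz : ∀ j i, ⟪T (e i) (u j), x⟫_ℂ = 0 := fun j i =>
      Submodule.inner_right_of_mem_orthogonal (Submodule.subset_span
        (Set.mem_range_self (f := fun p : J × w => T (e p.2) (u p.1)) (j, i))) hx
    have ext1 : ∀ {K : Type} [NormedAddCommGroup K] [InnerProductSpace ℂ K] [CompleteSpace K]
        {I : Type} (f : HilbertBasis I ℂ K) (y : K), (∀ i, ⟪f i, y⟫_ℂ = 0) → y = 0 := by
      intro K _ _ _ I f y hy
      have := f.hasSum_repr y
      simp only [f.repr_apply_apply, hy, zero_smul] at this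
      exact this.unique hasSum_zero
    have h1 : ∀ j, partialInner T x (u j) = 0 := fun j =>
      ext1 e _ fun i => by rw [inner_partialInner, hz]
    refine hT.total x fun a b => ?_
    have h2 : adjoint (T a) x = 0 := ext1 u _ fun j => by
      rw [adjoint_inner_right, ← inner_partialInner, h1, inner_zero_right]
    rw [← adjoint_inner_right, h2, inner_zero_right]
  have hs := (HilbertBasis.mkOfOrthogonalEqBot ho htop).hasSum_repr ψ
  simp only [HilbertBasis.repr_apply_apply, HilbertBasis.coe_mkOfOrthogonalEqBot] at hs
  refine hs.prod_fiberwise fun j => ?_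
  have h3 := (e.hasSum_repr (partialInner T ψ (u j))).mapL (T.flip (u j))
  simpa [HilbertBasis.repr_apply_apply, inner_partialInner] using h3

theorem IsHilbertTensor.hasSum_norm_sq_partialInner {T : H₁ →L[ℂ] H₂ →L[ℂ] H}
    (hT : IsHilbertTensor T) (ψ : H) {J : Type} (u : HilbertBasis J ℂ H₂) :
    HasSum (fun j => ‖partialInner T ψ (u j)‖ ^ 2) (‖ψ‖ ^ 2) := by
  have h := Complex.hasSum_re ((hT.hasSum_partialInner ψ u).mapL (innerSL ℂ ψ))
  have e : ∀ j, (innerSL ℂ ψ (T (partialInner T ψ (u j)) (u j))).re =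
      ‖partialInner T ψ (u j)‖ ^ 2 := fun j => by
    rw [innerSL_apply_apply, ← inner_conj_symm, ← inner_partialInner, Complex.conj_re,
      ← @inner_self_eq_norm_sq ℂ]
    rfl
  have e2 : (innerSL ℂ ψ ψ).re = ‖ψ‖ ^ 2 := by
    rw [innerSL_apply_apply, ← @inner_self_eq_norm_sq ℂ]
    rfl
  simp only [e, e2] at h
  exact h

/-- The reduction of the pure state `ψ` to the second factor. -/
def reducedOp (T : H₁ →L[ℂ] H₂ →L[ℂ] H) {I : Type} (e : HilbertBasis I ℂ H₁) (ψ : H) :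
    H₂ →L[ℂ] H₂ :=
  ∑' i, adjoint (T (e i)) ∘L pureState ψ ∘L T (e i)

theorem reducedOp_term (T : H₁ →L[ℂ] H₂ →L[ℂ] H) (ψ : H) (a : H₁) :
    adjoint (T a) ∘L pureState ψ ∘L T a =
      InnerProductSpace.rankOne ℂ (partialInner T.flip ψ a) (partialInner T.flip ψ a) := by
  ext x
  simp [pureState, partialInner, adjoint_inner_left]

theorem IsHilbertTensor.hasSum_reducedOp {T : H₁ →L[ℂ] H₂ →L[ℂ] H} (hT : IsHilbertTensor T)
    {I : Type} (e : HilbertBasis I ℂ H₁) (ψ : H) :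
    HasSum (fun i => InnerProductSpace.rankOne ℂ (partialInner T.flip ψ (e i))
      (partialInner T.flip ψ (e i))) (reducedOp T e ψ) := by
  rw [reducedOp]
  simp only [reducedOp_term]
  refine Summable.hasSum (Summable.of_norm ?_)
  simp only [InnerProductSpace.norm_rankOne, ← sq]
  exact (hT.flip.hasSum_norm_sq_partialInner ψ e).summable

/-- Parseval in the traced-out factor. The arguments change places because `partialInner` is
conjugate-linear in its vector. The reduced operator is thus a Gram operator, independent of the
basis `e`. -/
theorem IsHilbertTensor.inner_reducedOp {T : H₁ →L[ℂ] H₂ →L[ℂ] H} (hT : IsHilbertTensor T)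
    {I : Type} (e : HilbertBasis I ℂ H₁) (ψ : H) (x y : H₂) :
    ⟪x, reducedOp T e ψ y⟫_ℂ = ⟪partialInner T ψ y, partialInner T ψ x⟫_ℂ := by
  have h1 := ((hT.hasSum_reducedOp e ψ).mapL (ContinuousLinearMap.apply ℂ H₂ y)).mapL (innerSL ℂ x)
  have h2 := e.hasSum_inner_mul_inner (partialInner T ψ y) (partialInner T ψ x)
  have e : ∀ i, innerSL ℂ x (ContinuousLinearMap.apply ℂ H₂ y (InnerProductSpace.rankOne ℂ
      (partialInner T.flip ψ (e i)) (partialInner T.flip ψ (e i)))) =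
      ⟪partialInner T ψ y, e i⟫_ℂ * ⟪e i, partialInner T ψ x⟫_ℂ := fun i => by
    rw [innerSL_apply_apply, apply_apply, InnerProductSpace.rankOne_apply, inner_smul_right,
      inner_partialInner, inner_partialInner, ← inner_conj_symm, inner_partialInner,
      ← inner_conj_symm (partialInner T ψ y), inner_partialInner, flip_apply, flip_apply]
  simp only [e] at h1
  exact h1.unique h2

theorem IsHilbertTensor.isSelfAdjoint_reducedOp {T : H₁ →L[ℂ] H₂ →L[ℂ] H}
    (hT : IsHilbertTensor T) {I : Type} (e : HilbertBasis I ℂ H₁) (ψ : H) :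
    IsSelfAdjoint (reducedOp T e ψ) := by
  rw [ContinuousLinearMap.isSelfAdjoint_iff_isSymmetric]
  intro x y
  change ⟪reducedOp T e ψ x, y⟫_ℂ = ⟪x, reducedOp T e ψ y⟫_ℂ
  rw [← inner_conj_symm, hT.inner_reducedOp, hT.inner_reducedOp, inner_conj_symm]

theorem IsHilbertTensor.isCompactOperator_reducedOp {T : H₁ →L[ℂ] H₂ →L[ℂ] H}
    (hT : IsHilbertTensor T) {I : Type} (e : HilbertBasis I ℂ H₁) (ψ : H) :
    IsCompactOperator (reducedOp T e ψ) := by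
  refine isCompactOperator_of_tendsto (hT.hasSum_reducedOp e ψ) (Eventually.of_forall fun s => ?_)
  refine Submodule.sum_mem (compactOperator (RingHom.id ℂ) H₂ H₂) fun i _ => ?_
  exact (isCompactOperator_of_locallyCompactSpace_dom (innerSL ℂ _)).clm_comp
    (toSpanSingleton ℂ _)

/-- Schmidt decompositions `ψ = ∑ⱼ √rⱼ vⱼ ⊗ uⱼ` of unit vectors. -/
structure IsSchmidt (T : H₁ →L[ℂ] H₂ →L[ℂ] H) (ψ : H) {J : Type} (r : J → ℝ) (v : J → H₁)
    (u : J → H₂) : Prop where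
  left : Orthonormal ℂ v
  right : Orthonormal ℂ u
  pos : ∀ j, 0 < r j
  hasSum_one : HasSum r 1
  hasSum_vec : HasSum (fun j => (Real.sqrt (r j) : ℂ) • T (v j) (u j)) ψ

theorem IsSchmidt.flip {T : H₁ →L[ℂ] H₂ →L[ℂ] H} {ψ : H} {J : Type} {r : J → ℝ} {v : J → H₁}
    {u : J → H₂} (h : IsSchmidt T ψ r v u) : IsSchmidt T.flip ψ r u v :=
  ⟨h.right, h.left, h.pos, h.hasSum_one, h.hasSum_vec⟩

/-- The reduced operator is compact and self-adjoint, so it has an eigenbasis. By `inner_reducedOp`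
the partial inner products of `ψ` with that basis are orthogonal; normalising the nonzero ones gives
the other Schmidt family, and dropping the zero ones makes every coefficient positive. -/
theorem IsHilbertTensor.exists_schmidt {T : H₁ →L[ℂ] H₂ →L[ℂ] H} (hT : IsHilbertTensor T)
    {ψ : H} (hψ : ‖ψ‖ = 1) :
    ∃ (J : Type) (r : J → ℝ) (v : J → H₁) (u : J → H₂), IsSchmidt T ψ r v u := by
  obtain ⟨w, e, -⟩ := exists_hilbertBasis ℂ H₁
  obtain ⟨J, b, μ, hb⟩ := exists_eigenbasis (hT.isCompactOperator_reducedOp e ψ)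
    (hT.isSelfAdjoint_reducedOp e ψ)
  set a : J → H₁ := fun j => partialInner T ψ (b j) with ha
  have hgram : ∀ j k, ⟪a j, a k⟫_ℂ = μ j * ⟪b k, b j⟫_ℂ := fun j k => by
    rw [ha, ← hT.inner_reducedOp e, hb, inner_smul_right]
  have hnorm := hT.hasSum_norm_sq_partialInner ψ b
  have hdec := hT.hasSum_partialInner ψ b
  have hinj : Function.Injective (Subtype.val : {j // a j ≠ 0} → J) := Subtype.val_injective
  have hrange : ∀ j, j ∉ Set.range (Subtype.val : {j // a j ≠ 0} → J) → a j = 0 := fun j hj => by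
    by_contra h
    exact hj ⟨⟨j, h⟩, rfl⟩
  refine ⟨{j // a j ≠ 0}, fun j => ‖a j‖ ^ 2, fun j => ((‖a j‖ : ℂ)⁻¹) • a j, fun j => b j,
    ?_, b.orthonormal.comp _ hinj, fun j => by have := j.2; positivity, ?_, ?_⟩
  · refine ⟨fun j => ?_, fun j k hjk => ?_⟩
    · rw [norm_smul, norm_inv, Complex.norm_real, norm_norm,
        inv_mul_cancel₀ (norm_ne_zero_iff.2 j.2)]
    · simp only
      rw [inner_smul_left, inner_smul_right, hgram,
        b.orthonormal.2 fun h => hjk (Subtype.ext h.symm)]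
      simp
  · rw [hψ, one_pow] at hnorm
    exact (hinj.hasSum_iff fun j hj => by
      change ‖a j‖ ^ 2 = 0
      simp [hrange j hj]).2 hnorm
  · have h := (hinj.hasSum_iff fun j hj => by
      change T (a j) (b j) = 0
      simp [hrange j hj]).2 hdec
    have e : ∀ j : {j // a j ≠ 0}, (Real.sqrt (‖a j‖ ^ 2) : ℂ) • T ((‖a j‖ : ℂ)⁻¹ • a j) (b j) =
        T (partialInner T ψ (b j)) (b j) := fun j => by
      have hj : (‖a j‖ : ℂ) ≠ 0 := by exact_mod_cast norm_ne_zero_iff.2 j.2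
      rw [Real.sqrt_sq (norm_nonneg _), map_smul, smul_apply, smul_smul, mul_inv_cancel₀ hj,
        one_smul]
    simp only [e]
    exact h

theorem IsSchmidt.hasSum_inner {T : H₁ →L[ℂ] H₂ →L[ℂ] H} (hT : IsHilbertTensor T) {ψ : H}
    {J : Type} {r : J → ℝ} {v : J → H₁} {u : J → H₂} (h : IsSchmidt T ψ r v u) (a : H₁) (y : H₂) :
    HasSum (fun j => (Real.sqrt (r j) : ℂ) * (⟪a, v j⟫_ℂ * ⟪y, u j⟫_ℂ)) ⟪T a y, ψ⟫_ℂ := by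
  have := h.hasSum_vec.mapL (innerSL ℂ (T a y))
  simpa only [innerSL_apply_apply, inner_smul_right, hT.inner_apply] using this

theorem IsSchmidt.inner_left {T : H₁ →L[ℂ] H₂ →L[ℂ] H} (hT : IsHilbertTensor T) {ψ : H}
    {J : Type} {r : J → ℝ} {v : J → H₁} {u : J → H₂} (h : IsSchmidt T ψ r v u) (k : J) (y : H₂) :
    ⟪T (v k) y, ψ⟫_ℂ = (Real.sqrt (r k) : ℂ) * ⟪y, u k⟫_ℂ := by
  refine (h.hasSum_inner hT (v k) y).unique ?_
  convert hasSum_single k fun j hj => ?_ using 1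
  · rw [inner_self_eq_norm_sq_to_K, h.left.1 k]; simp
  · rw [h.left.2 hj.symm]; simp

/-- The Schmidt vectors are eigenvectors with eigenvalues `r`, and the reduced operator kills their
orthogonal complement. Applied to `T.flip`, it gives the same value for the other side. -/
theorem IsSchmidt.vonNeumannEntropy_reducedOp {T : H₁ →L[ℂ] H₂ →L[ℂ] H} (hT : IsHilbertTensor T)
    {ψ : H} {J : Type} {r : J → ℝ} {v : J → H₁} {u : J → H₂} (h : IsSchmidt T ψ r v u)
    {I : Type} (e : HilbertBasis I ℂ H₁) :
    vonNeumannEntropy (reducedOp T e ψ) = ∑' j, ENNReal.ofReal (Real.negMulLog (r j)) := by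
  refine vonNeumannEntropy_eq_tsum h.right (hT.isSelfAdjoint_reducedOp e ψ) (fun j => (h.pos j).le)
    (fun j => le_hasSum h.hasSum_one j fun i _ => (h.pos i).le) (fun k => ?_) fun y hy => ?_
  · refine ext_inner_left ℂ fun x => ?_
    have hk : partialInner T ψ (u k) = (Real.sqrt (r k) : ℂ) • v k :=
      ext_inner_left ℂ fun a => by
        rw [inner_partialInner, inner_smul_right]
        exact h.flip.inner_left hT.flip k a
    rw [hT.inner_reducedOp, hk, inner_smul_left, inner_partialInner, h.inner_left hT,
      inner_smul_right, ← mul_assoc, Complex.conj_ofReal, ← Complex.ofReal_mul,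
      Real.mul_self_sqrt (h.pos k).le]
  · refine ext_inner_left ℂ fun x => ?_
    have hk : partialInner T ψ y = 0 := ext_inner_left ℂ fun a => by
      rw [inner_partialInner, inner_zero_right]
      refine (h.hasSum_inner hT a y).unique ?_
      convert hasSum_zero using 2 with j
      rw [inner_eq_zero_symm.1 (hy j)]
      simp
    rw [hT.inner_reducedOp, hk, inner_zero_left, inner_zero_right]

end Schmidt

/-! ### Totality of product vectors. -/

section TensorTotal

variable {α β : Type} [Fintype α] [Fintype β]

/-- The wave packet `x ↦ exp (2πi k·x) exp (-|x|²)`. -/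
def planeWavePacket {ι : Type} [Fintype ι] (k x : ι → ℝ) : ℂ :=
  Complex.exp (((2 * Real.pi * (k ⬝ᵥ x) : ℝ) : ℂ) * Complex.I) * (Real.exp (-∑ i, x i ^ 2) : ℂ)

theorem memLp_planeWavePacket {ι : Type} [Fintype ι] (k : ι → ℝ) :
    MemLp (planeWavePacket k) 2 volume := by
  have hc : Continuous (planeWavePacket k) := by unfold planeWavePacket; fun_prop
  rw [memLp_two_iff_integrable_sq_norm hc.aestronglyMeasurable]
  have h := integrable_exp_quadratic (ι := ι) two_pos 0
  refine h.congr (Eventually.of_forall fun x => ?_)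
  simp only [planeWavePacket, norm_mul, Complex.norm_exp_ofReal_mul_I, one_mul, Complex.norm_real,
    Real.norm_eq_abs, Real.abs_exp, ← Real.exp_nat_mul]
  simp

/-- Product vectors are total in `L²(ℝ^(α ⊕ β))`. -/
theorem eq_zero_of_forall_inner_tensor_eq_zero {f : Modes (α ⊕ β)}
    (hf : ∀ φ χ, ⟪tensor φ χ, f⟫_ℂ = 0) : f = 0 := by
  -- The Gaussian factor makes `f` integrable. The Fourier integral of `g` at `k` is the inner
  -- product of `f` with a product of wave packets, hence zero, and Plancherel gives `g = 0`.
  set g : (α ⊕ β → ℝ) → ℂ := fun z => (Real.exp (-∑ i, z i ^ 2) : ℂ) * f z with hg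
  have hcont : Continuous fun z : α ⊕ β → ℝ => (Real.exp (-∑ i, z i ^ 2) : ℂ) := by fun_prop
  have hexp : MemLp (fun z : α ⊕ β → ℝ => (Real.exp (-∑ i, z i ^ 2) : ℂ)) 2 volume := by
    have h := memLp_planeWavePacket (ι := α ⊕ β) 0
    refine h.congr_norm hcont.aestronglyMeasurable (Eventually.of_forall fun z => ?_)
    simp [planeWavePacket]
  have h1 : Integrable g := hexp.integrable_mul (Lp.memLp f)
  have h2 : MemLp g 2 volume := by
    refine (Lp.memLp f).of_le (hcont.aestronglyMeasurable.mul (Lp.aestronglyMeasurable f))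
      (Eventually.of_forall fun z => ?_)
    rw [hg, norm_mul, Complex.norm_real, Real.norm_eq_abs, Real.abs_exp]
    refine mul_le_of_le_one_left (norm_nonneg _) (Real.exp_le_one_iff.2 ?_)
    have : 0 ≤ ∑ i, z i ^ 2 := Finset.sum_nonneg fun i _ => sq_nonneg _
    linarith
  have hF : ∀ k, coordFourier g k = 0 := fun k => by
    set φ : Modes α := (memLp_planeWavePacket fun i => k (.inl i)).toLp _
    set χ : Modes β := (memLp_planeWavePacket fun i => k (.inr i)).toLp _
    rw [← hf φ χ, L2.inner_def, coordFourier]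
    refine integral_congr_ae ?_
    filter_upwards [tensor_coeFn φ χ,
      quasiMeasurePreserving_inl.ae (memLp_planeWavePacket fun i => k (.inl i)).coeFn_toLp,
      quasiMeasurePreserving_inr.ae (memLp_planeWavePacket fun i => k (.inr i)).coeFn_toLp]
      with z e1 e2 e3
    rw [RCLike.inner_apply, e1, e2, e3, hg, mul_comm (f z), ← mul_assoc]
    congr 1
    simp only [planeWavePacket, Complex.ofReal_exp, ← Complex.exp_add, ← Complex.exp_conj]
    congr 1
    simp only [map_add, map_mul, Complex.conj_ofReal, Complex.conj_I]
    simp only [dotProduct, Fintype.sum_sum_type]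
    push_cast
    ring
  obtain ⟨-, hP⟩ := plancherel_coordFourier h1 h2 h1 h2
  have conv : ∀ z : ℂ, star z * z = ((‖z‖ ^ 2 : ℝ) : ℂ) := fun z => by
    rw [← Complex.normSq_eq_norm_sq, Complex.normSq_eq_conj_mul_self]; rfl
  simp only [conv, hF, integral_complex_ofReal] at hP
  have hP' : ∫ z, ‖g z‖ ^ 2 = 0 := by
    have := (Complex.ofReal_injective hP).symm
    simpa using this
  rw [integral_eq_zero_iff_of_nonneg (fun z => by positivity)
    ((memLp_two_iff_integrable_sq_norm h1.1).1 h2)] at hP'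
  refine Lp.ext ?_
  filter_upwards [hP', Lp.coeFn_zero ℂ 2 (volume : Measure (α ⊕ β → ℝ))] with z hz h0
  rw [h0]
  simpa [hg] using hz

theorem isHilbertTensor_tensor : IsHilbertTensor (tensor (α := α) (β := β)) :=
  ⟨fun a b a' b' => inner_tensor_tensor a a' b b', fun _ h => eq_zero_of_forall_inner_tensor_eq_zero h⟩

end TensorTotal

end GaussianErgotropy

end

noncomputable section

namespace GaussianErgotropy

/-! ### Husimi functions and their characteristic functions. -/

section Husimi

open Matrix

variable {ι : Type} [Fintype ι]

/-- The vacuum wave function `π^(-N/4) exp (-|a|² / 2)`. -/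
def gaussRoot (a : ι → ℝ) : ℝ :=
  Real.sqrt (∫ y : ι → ℝ, Real.exp (-∑ i, y i ^ 2))⁻¹ * Real.exp (-(∑ i, a i ^ 2) / 2)

theorem gaussRoot_sq (a : ι → ℝ) : gaussRoot a ^ 2 = gaussDensity a := by
  have : 0 ≤ ∫ y : ι → ℝ, Real.exp (-∑ i, y i ^ 2) := integral_nonneg fun _ => by positivity
  rw [gaussRoot, gaussDensity, mul_pow, Real.sq_sqrt (inv_nonneg.2 this), ← Real.exp_nat_mul]
  congr 2
  push_cast
  ring

theorem continuous_gaussRoot : Continuous (gaussRoot (ι := ι)) := by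
  unfold gaussRoot; fun_prop

theorem gaussRoot_nonneg (a : ι → ℝ) : 0 ≤ gaussRoot a := by
  unfold gaussRoot; positivity

theorem gaussRoot_le (a : ι → ℝ) : gaussRoot a ≤ gaussRoot (0 : ι → ℝ) := by
  unfold gaussRoot
  refine mul_le_mul_of_nonneg_left (Real.exp_le_exp.2 ?_) (Real.sqrt_nonneg _)
  have : 0 ≤ ∑ i, a i ^ 2 := Finset.sum_nonneg fun i _ => sq_nonneg _
  simp
  linarith

theorem integral_gaussDensity : ∫ x : ι → ℝ, gaussDensity x = 1 := by
  have h := integral_cexp_mul_gaussDensity (ι := ι) 0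
  simp only [Pi.zero_apply, zero_mul, Finset.sum_const_zero, Complex.ofReal_zero, Complex.exp_zero,
    one_mul, ne_eq, OfNat.ofNat_ne_zero, not_false_eq_true, zero_pow, neg_zero, zero_div,
    integral_complex_ofReal] at h
  exact_mod_cast h

theorem memLp_gaussRoot_sub (x : ι → ℝ) :
    MemLp (fun y : ι → ℝ => (gaussRoot (y - x) : ℂ)) 2 volume := by
  have hc : Continuous fun y : ι → ℝ => (gaussRoot (y - x) : ℂ) :=
    Complex.continuous_ofReal.comp (continuous_gaussRoot.comp (continuous_sub_right x))
  rw [memLp_two_iff_integrable_sq_norm hc.aestronglyMeasurable]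
  have h := (integrable_gaussDensity (ι := ι)).comp_sub_right x
  refine h.congr (Eventually.of_forall fun y => ?_)
  simp only [Complex.norm_real, Real.norm_eq_abs, sq_abs, gaussRoot_sq]

/-- A vector localised by the Gaussian window centred at `x`. -/
def windowed (v : Modes ι) (x y : ι → ℝ) : ℂ := (gaussRoot (y - x) : ℂ) * v y

theorem integrable_windowed (v : Modes ι) (x : ι → ℝ) : Integrable (windowed v x) :=
  (memLp_gaussRoot_sub x).integrable_mul (Lp.memLp v)

theorem memLp_windowed (v : Modes ι) (x : ι → ℝ) : MemLp (windowed v x) 2 volume := by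
  refine (Lp.memLp v).of_le_mul (c := gaussRoot (0 : ι → ℝ)) (integrable_windowed v x).1
    (Eventually.of_forall fun y => ?_)
  rw [windowed, norm_mul, Complex.norm_real, Real.norm_eq_abs, abs_of_nonneg (gaussRoot_nonneg _)]
  exact mul_le_mul_of_nonneg_right (gaussRoot_le _) (norm_nonneg _)

/-- The Husimi function `(x, k) ↦ |⟨g_{x,k}, v⟩|²`, with momentum coordinate `p = 2π k`. -/
def husimi (v : Modes ι) (p : (ι → ℝ) × (ι → ℝ)) : ℝ := ‖coordFourier (windowed v p.1) p.2‖ ^ 2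

theorem husimi_nonneg (v : Modes ι) (p : (ι → ℝ) × (ι → ℝ)) : 0 ≤ husimi v p := by
  unfold husimi; positivity

theorem stronglyMeasurable_husimi (v : Modes ι) : StronglyMeasurable (husimi v) := by
  have h : StronglyMeasurable fun p : (ι → ℝ) × (ι → ℝ) =>
      coordFourier (windowed v p.1) p.2 := by
    unfold coordFourier
    refine StronglyMeasurable.integral_prod_right' (f := fun q : ((ι → ℝ) × (ι → ℝ)) × (ι → ℝ) =>
      Complex.exp (((-(2 * Real.pi * (q.1.2 ⬝ᵥ q.2)) : ℝ) : ℂ) * Complex.I) *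
        windowed v q.1.1 q.2) ?_
    refine StronglyMeasurable.mul ?_ (StronglyMeasurable.mul ?_ ?_)
    · exact (by fun_prop : Continuous fun q : ((ι → ℝ) × (ι → ℝ)) × (ι → ℝ) =>
        Complex.exp (((-(2 * Real.pi * (q.1.2 ⬝ᵥ q.2)) : ℝ) : ℂ) * Complex.I)).stronglyMeasurable
    · exact (Complex.continuous_ofReal.comp (continuous_gaussRoot.comp
        (by fun_prop : Continuous fun q : ((ι → ℝ) × (ι → ℝ)) × (ι → ℝ) =>
          q.2 - q.1.1))).stronglyMeasurable
    · exact (Lp.stronglyMeasurable v).comp_measurable measurable_snd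
  exact h.norm.pow 2

/-- Coherent states are unit vectors, so Bessel's inequality bounds sums of Husimi functions. -/
theorem sum_husimi_le_one {J : Type} {v : J → Modes ι} (hv : Orthonormal ℂ v) (F : Finset J)
    (p : (ι → ℝ) × (ι → ℝ)) : ∑ j ∈ F, husimi (v j) p ≤ 1 := by
  have hm : MemLp (fun y : ι → ℝ => Complex.exp (((2 * Real.pi * (p.2 ⬝ᵥ y) : ℝ) : ℂ) *
      Complex.I) * (gaussRoot (y - p.1) : ℂ)) 2 volume := by
    refine (memLp_gaussRoot_sub p.1).congr_norm ?_ (Eventually.of_forall fun y => ?_)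
    · exact (by fun_prop : Continuous fun y : ι → ℝ => Complex.exp
        (((2 * Real.pi * (p.2 ⬝ᵥ y) : ℝ) : ℂ) * Complex.I)).aestronglyMeasurable.mul
        (memLp_gaussRoot_sub p.1).1
    · rw [norm_mul, Complex.norm_exp_ofReal_mul_I, one_mul]
  set g : Modes ι := hm.toLp _
  have hgn : ‖g‖ ^ 2 = 1 := by
    rw [norm_sq_modes, ← integral_gaussDensity (ι := ι), ← integral_sub_right_eq_self (gaussDensity (ι := ι)) p.1]
    refine integral_congr_ae ?_
    filter_upwards [hm.coeFn_toLp] with y hy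
    rw [hy, norm_mul, Complex.norm_exp_ofReal_mul_I, one_mul, Complex.norm_real,
      Real.norm_eq_abs, sq_abs, gaussRoot_sq]
  have hin : ∀ j, husimi (v j) p = ‖⟪v j, g⟫_ℂ‖ ^ 2 := fun j => by
    rw [husimi, ← inner_conj_symm, RCLike.norm_conj, L2.inner_def, coordFourier]
    congr 2
    refine integral_congr_ae ?_
    filter_upwards [hm.coeFn_toLp] with y hy
    rw [RCLike.inner_apply, hy, map_mul, Complex.conj_ofReal, ← Complex.exp_conj, windowed,
      map_mul, Complex.conj_ofReal, Complex.conj_I]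
    push_cast
    ring_nf
  simp only [hin]
  exact (hv.sum_inner_products_le g).trans hgn.le

theorem coordFourier_translate (G : (ι → ℝ) → ℂ) (s k : ι → ℝ) :
    coordFourier (fun y => G (y + s)) k =
      Complex.exp (((2 * Real.pi * (k ⬝ᵥ s) : ℝ) : ℂ) * Complex.I) * coordFourier G k := by
  rw [coordFourier, coordFourier, ← integral_const_mul,
    ← integral_add_right_eq_self (fun y => Complex.exp (((2 * Real.pi * (k ⬝ᵥ s) : ℝ) : ℂ) *
      Complex.I) * (Complex.exp (((-(2 * Real.pi * (k ⬝ᵥ y)) : ℝ) : ℂ) * Complex.I) * G y)) s]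
  refine integral_congr_ae (Eventually.of_forall fun y => ?_)
  simp only
  rw [← mul_assoc, ← Complex.exp_add, dotProduct_add]
  congr 2
  push_cast
  ring

/-- The Gaussian overlap in the characteristic function of a Husimi function. -/
def windowOverlap (u s a : ι → ℝ) : ℂ :=
  Complex.exp (((u ⬝ᵥ a : ℝ) : ℂ) * Complex.I) * ((gaussRoot (-a) * gaussRoot (s - a) : ℝ) : ℂ)

theorem windowOverlap_eq (u s a : ι → ℝ) :
    windowOverlap u s a = ((∫ y : ι → ℝ, Real.exp (-∑ i, y i ^ 2) : ℝ) : ℂ)⁻¹ *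
      Complex.exp (-((s ⬝ᵥ s : ℝ) : ℂ) / 2) * Complex.exp (-((1 : ℝ) : ℂ) * ∑ i, (a i : ℂ) ^ 2 +
        ∑ i, ((s i : ℂ) + u i * Complex.I) * a i) := by
  have hZ : 0 ≤ (∫ y : ι → ℝ, Real.exp (-∑ i, y i ^ 2))⁻¹ :=
    inv_nonneg.2 (integral_nonneg fun _ => by positivity)
  rw [windowOverlap, gaussRoot, gaussRoot, mul_mul_mul_comm, Real.mul_self_sqrt hZ,
    Complex.ofReal_mul, mul_left_comm, mul_assoc, Complex.ofReal_inv]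
  congr 1
  rw [← Real.exp_add, Complex.ofReal_exp, ← Complex.exp_add, ← Complex.exp_add]
  congr 1
  push_cast [dotProduct, Pi.neg_apply, Pi.sub_apply]
  have e1 : ∑ i, ((s i : ℂ) - a i) ^ 2 =
      ∑ i, (s i : ℂ) * s i - 2 * ∑ i, (s i : ℂ) * a i + ∑ i, (a i : ℂ) ^ 2 := by
    rw [Finset.mul_sum, ← Finset.sum_sub_distrib, ← Finset.sum_add_distrib]
    exact Finset.sum_congr rfl fun i _ => by ring
  have e2 : ∑ i, ((s i : ℂ) + u i * Complex.I) * a i =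
      ∑ i, (s i : ℂ) * a i + (∑ i, (u i : ℂ) * a i) * Complex.I := by
    rw [Finset.sum_mul, ← Finset.sum_add_distrib]
    exact Finset.sum_congr rfl fun i _ => by ring
  have e3 : ∑ i, (-(a i : ℂ)) ^ 2 = ∑ i, (a i : ℂ) ^ 2 :=
    Finset.sum_congr rfl fun i _ => by ring
  rw [e1, e2, e3]
  ring

theorem integrable_windowOverlap (u s : ι → ℝ) : Integrable (windowOverlap u s) := by
  have h := (GaussianFourier.integrable_cexp_neg_mul_sum_add (b := ((1 : ℝ) : ℂ)) (by simp)
    (fun i : ι => (s i : ℂ) + u i * Complex.I)).const_mul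
    (((∫ y : ι → ℝ, Real.exp (-∑ i, y i ^ 2) : ℝ) : ℂ)⁻¹ *
      Complex.exp (-((s ⬝ᵥ s : ℝ) : ℂ) / 2))
  exact h.congr (Eventually.of_forall fun a => (windowOverlap_eq u s a).symm)

theorem integral_windowOverlap (u s : ι → ℝ) :
    ∫ a, windowOverlap u s a =
      Complex.exp (-((u ⬝ᵥ u + s ⬝ᵥ s : ℝ) : ℂ) / 4) *
        Complex.exp (((u ⬝ᵥ s / 2 : ℝ) : ℂ) * Complex.I) := by
  have hpos := integral_exp_quadratic_pos (ι := ι) one_pos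
  simp only [windowOverlap_eq]
  rw [integral_const_mul, integral_cexp_quadratic_ratio one_pos]
  simp only [neg_mul, one_mul] at hpos ⊢
  rw [mul_mul_mul_comm, inv_mul_cancel₀ (by exact_mod_cast hpos.ne'), one_mul, ← Complex.exp_add,
    ← Complex.exp_add]
  congr 1
  have e : ∑ i, ((s i : ℂ) + u i * Complex.I) ^ 2 =
      ∑ i, (s i : ℂ) * s i - ∑ i, (u i : ℂ) * u i + 2 * (∑ i, (u i : ℂ) * s i) * Complex.I := by
    rw [Finset.mul_sum, Finset.sum_mul, ← Finset.sum_sub_distrib, ← Finset.sum_add_distrib]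
    refine Finset.sum_congr rfl fun i _ => ?_
    linear_combination ((u i : ℂ) ^ 2) * Complex.I_sq
  rw [e]
  push_cast [dotProduct]
  ring

/-- The product of windowed translates, weighted by a character. -/
theorem integrable_windowed_mul (v : Modes ι) (u s : ι → ℝ) :
    Integrable (fun p : (ι → ℝ) × (ι → ℝ) => Complex.exp (((u ⬝ᵥ p.1 : ℝ) : ℂ) * Complex.I) *
        (star (windowed v p.1 p.2) * windowed v p.1 (p.2 + s))) (volume.prod volume) ∧
    ∫ p : (ι → ℝ) × (ι → ℝ), Complex.exp (((u ⬝ᵥ p.1 : ℝ) : ℂ) * Complex.I) *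
        (star (windowed v p.1 p.2) * windowed v p.1 (p.2 + s)) ∂(volume.prod volume) =
      Complex.exp (-((u ⬝ᵥ u + s ⬝ᵥ s : ℝ) : ℂ) / 4) * ⟪v, weyl (Sum.elim u s) v⟫_ℂ := by
  set m : (ι → ℝ) → ℂ := fun y => Complex.exp (((u ⬝ᵥ y : ℝ) : ℂ) * Complex.I) *
    (star (v y) * v (y + s)) with hm
  have hvs : MemLp (fun y => v (y + s)) 2 volume :=
    (Lp.memLp v).comp_measurePreserving (measurePreserving_add_right volume s)
  have hmi : Integrable m := by
    have h1 : Integrable fun y => star (v y) * v (y + s) := (Lp.memLp v).star.integrable_mul hvs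
    refine h1.mono ?_ (Eventually.of_forall fun y => ?_)
    · exact (by fun_prop : Continuous fun y : ι → ℝ => Complex.exp
        (((u ⬝ᵥ y : ℝ) : ℂ) * Complex.I)).aestronglyMeasurable.mul h1.1
    · rw [hm, norm_mul, Complex.norm_exp_ofReal_mul_I, one_mul]
  -- The shear `(x, y) ↦ (x - y, y)` separates the integrand into the overlap of two Gaussian
  -- windows and the matrix element of the Weyl operator.
  have mp := measurePreserving_sub_prod (volume : Measure (ι → ℝ)) (volume : Measure (ι → ℝ))
  have e : ∀ p : (ι → ℝ) × (ι → ℝ), Complex.exp (((u ⬝ᵥ p.1 : ℝ) : ℂ) * Complex.I) *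
        (star (windowed v p.1 p.2) * windowed v p.1 (p.2 + s)) =
      windowOverlap u s (p.1 - p.2) * m p.2 := fun p => by
    have h1 : p.2 - p.1 = -(p.1 - p.2) := by abel
    have h2 : p.2 + s - p.1 = s - (p.1 - p.2) := by abel
    have h3 : u ⬝ᵥ p.1 = u ⬝ᵥ (p.1 - p.2) + u ⬝ᵥ p.2 := by rw [← dotProduct_add, sub_add_cancel]
    rw [windowed, windowed, windowOverlap, hm, h1, h2, h3]
    simp only [star_mul', RCLike.star_def, Complex.conj_ofReal]
    rw [Complex.ofReal_add, add_mul, Complex.exp_add, Complex.ofReal_mul]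
    ring
  have hprod := (integrable_windowOverlap u s).mul_prod hmi
  simp only [e]
  constructor
  · exact mp.integrable_comp_of_integrable hprod
  · have h1 := integral_map (μ := (volume : Measure (ι → ℝ)).prod volume)
      (φ := fun z : (ι → ℝ) × (ι → ℝ) => (z.1 - z.2, z.2))
      (f := fun p : (ι → ℝ) × (ι → ℝ) => windowOverlap u s p.1 * m p.2)
      mp.measurable.aemeasurable (by rw [mp.map_eq]; exact hprod.1)
    rw [mp.map_eq, integral_prod_mul] at h1
    refine h1.symm.trans ?_
    rw [integral_windowOverlap, mul_assoc, inner_weyl_eq_integral, ← integral_const_mul]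
    congr 1
    refine integral_congr_ae (Eventually.of_forall fun y => ?_)
    simp only [hm, weylPhase, Sum.elim_inl, Sum.elim_inr]
    rw [← mul_assoc, ← Complex.exp_add, mul_left_comm (star (v y))]
    change _ = _ * (star (v y) * v (y + s))
    congr 2
    push_cast [dotProduct]
    ring

/-- For fixed `x`, Plancherel in `k` replaces the Husimi function by the squared windowed vector;
integrability in `x` is then `integrable_windowed_mul` at `u = s = 0`. -/
theorem integrable_husimi (v : Modes ι) : Integrable (husimi v) (volume.prod volume) := by
  rw [integrable_prod_iff (stronglyMeasurable_husimi v).aestronglyMeasurable]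
  have hP := fun x => plancherel_coordFourier (integrable_windowed v x) (memLp_windowed v x)
    (integrable_windowed v x) (memLp_windowed v x)
  constructor
  · refine Eventually.of_forall fun x => ?_
    exact (memLp_two_iff_integrable_sq_norm (hP x).1.1).1 (hP x).1
  · have h := ((integrable_windowed_mul v 0 0).1.integral_prod_left).re
    refine h.congr (Eventually.of_forall fun x => ?_)
    have conv : ∀ z : ℂ, star z * z = ((‖z‖ ^ 2 : ℝ) : ℂ) := fun z => by
      rw [← Complex.normSq_eq_norm_sq, Complex.normSq_eq_conj_mul_self]; rfl
    have h2 := (hP x).2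
    simp only [conv, integral_complex_ofReal] at h2
    simp only [zero_dotProduct, Complex.ofReal_zero, zero_mul, Complex.exp_zero, one_mul, add_zero,
      conv, integral_complex_ofReal, RCLike.re_to_complex, Complex.ofReal_re, Real.norm_eq_abs,
      abs_of_nonneg (husimi_nonneg v _)]
    exact (Complex.ofReal_injective h2).symm

/-- The phase-space point of the pair `(x, k)`. -/
def phasePoint (p : (ι → ℝ) × (ι → ℝ)) : ι ⊕ ι → ℝ := Sum.elim p.1 ((2 * Real.pi) • p.2)

theorem continuous_phasePoint {κ : Type} : Continuous (phasePoint (ι := κ)) := by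
  refine continuous_pi fun i => ?_
  rcases i with i | i
  · exact (continuous_apply i).comp continuous_fst
  · exact ((continuous_apply i).comp continuous_snd).const_smul (2 * Real.pi)

/-- The characteristic function of the Husimi function. -/
theorem integral_husimi_mul_exp (v : Modes ι) (ξ : ι ⊕ ι → ℝ) :
    ∫ p, Complex.exp (((ξ ⬝ᵥ phasePoint p : ℝ) : ℂ) * Complex.I) * (husimi v p : ℂ)
        ∂(volume.prod volume) =
      Complex.exp (-((ξ ⬝ᵥ ξ : ℝ) : ℂ) / 4) * ⟪v, weyl ξ v⟫_ℂ := by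
  obtain ⟨u, s, rfl⟩ : ∃ u s, ξ = Sum.elim u s :=
    ⟨fun i => ξ (.inl i), fun i => ξ (.inr i), by ext (i | i) <;> rfl⟩
  have hw := integrable_windowed_mul v u s
  rw [sumElim_dotProduct_sumElim, ← hw.2, integral_prod _ hw.1]
  have hint : Integrable (fun p : (ι → ℝ) × (ι → ℝ) =>
      Complex.exp (((Sum.elim u s ⬝ᵥ phasePoint p : ℝ) : ℂ) * Complex.I) * (husimi v p : ℂ))
      (volume.prod volume) := by
    refine (integrable_husimi v).ofReal (𝕜 := ℂ) |>.mono ?_ (Eventually.of_forall fun p => ?_)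
    · have hc := continuous_phasePoint (κ := ι)
      exact (by fun_prop : Continuous fun p : (ι → ℝ) × (ι → ℝ) => Complex.exp
        (((Sum.elim u s ⬝ᵥ phasePoint p : ℝ) : ℂ) * Complex.I)).aestronglyMeasurable.mul
        (integrable_husimi v).ofReal.1
    · rw [norm_mul, Complex.norm_exp_ofReal_mul_I, one_mul]; rfl
  rw [integral_prod _ hint]
  refine integral_congr_ae (Eventually.of_forall fun x => ?_)
  have hG1 := integrable_windowed v x
  have hG2 := memLp_windowed v x
  -- The momentum character is the Fourier multiplier of a translation by `s`, so Plancherel pairs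
  -- the windowed vector with its translate.
  have hP := (plancherel_coordFourier hG1 hG2 (hG1.comp_add_right s)
    (hG2.comp_measurePreserving (measurePreserving_add_right volume s))).2
  simp only
  rw [integral_const_mul, ← hP, ← integral_const_mul]
  refine integral_congr_ae (Eventually.of_forall fun k => ?_)
  have ht := coordFourier_translate (windowed v x) s k
  simp only [ht, phasePoint, husimi, sumElim_dotProduct_sumElim,
    dotProduct_smul, smul_eq_mul]
  rw [Complex.ofReal_add, add_mul, Complex.exp_add, mul_assoc, dotProduct_comm s k]
  congr 1
  rw [mul_left_comm]
  congr 1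
  rw [← Complex.normSq_eq_norm_sq, Complex.normSq_eq_conj_mul_self]
  rfl

end Husimi

end GaussianErgotropy

end

noncomputable section

namespace GaussianErgotropy

/-! ### The strict maximum-entropy bound. -/

section EntropyBound

variable {ι : Type} [Fintype ι]

theorem integral_husimi_mul_cos (v : Modes ι) (ξ : ι ⊕ ι → ℝ) :
    Integrable (fun p => husimi v p * Real.cos (ξ ⬝ᵥ phasePoint p)) (volume.prod volume) ∧
    ∫ p, husimi v p * Real.cos (ξ ⬝ᵥ phasePoint p) ∂(volume.prod volume) =
      Real.exp (-(ξ ⬝ᵥ ξ) / 4) * (⟪v, weyl ξ v⟫_ℂ).re := by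
  have hc := continuous_phasePoint (κ := ι)
  have hint : Integrable (fun p : (ι → ℝ) × (ι → ℝ) =>
      Complex.exp (((ξ ⬝ᵥ phasePoint p : ℝ) : ℂ) * Complex.I) * (husimi v p : ℂ))
      (volume.prod volume) := by
    refine (integrable_husimi v).ofReal (𝕜 := ℂ) |>.mono ?_ (Eventually.of_forall fun p => ?_)
    · exact (by fun_prop : Continuous fun p : (ι → ℝ) × (ι → ℝ) => Complex.exp
        (((ξ ⬝ᵥ phasePoint p : ℝ) : ℂ) * Complex.I)).aestronglyMeasurable.mul
        (integrable_husimi v).ofReal.1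
    · rw [norm_mul, Complex.norm_exp_ofReal_mul_I, one_mul]; rfl
  have hre : ∀ p, RCLike.re (Complex.exp (((ξ ⬝ᵥ phasePoint p : ℝ) : ℂ) * Complex.I) *
      (husimi v p : ℂ)) = husimi v p * Real.cos (ξ ⬝ᵥ phasePoint p) := fun p => by
    rw [RCLike.re_eq_complex_re, Complex.re_mul_ofReal, Complex.exp_ofReal_mul_I_re, mul_comm]
  refine ⟨hint.re.congr (Eventually.of_forall hre), ?_⟩
  have h := congrArg Complex.re (integral_husimi_mul_exp v ξ)
  have h2 := integral_re hint
  simp only [hre] at h2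
  rw [h2, RCLike.re_eq_complex_re, h]
  have : Complex.exp (-((ξ ⬝ᵥ ξ : ℝ) : ℂ) / 4) = ((Real.exp (-(ξ ⬝ᵥ ξ) / 4) : ℝ) : ℂ) := by
    push_cast; rfl
  rw [this, Complex.re_ofReal_mul]

theorem integral_husimi (v : Modes ι) : ∫ p, husimi v p ∂(volume.prod volume) = ‖v‖ ^ 2 := by
  have h := (integral_husimi_mul_cos v 0).2
  simp only [zero_dotProduct, Real.cos_zero, mul_one, neg_zero, zero_div, Real.exp_zero, one_mul,
    weyl_zero] at h
  rw [h, inner_self_eq_norm_sq_to_K]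
  norm_cast

/-- Without the factor `exp (-ξ·ξ / 4)` in the characteristic function this would be an equality
with the first term alone. The factor costs at most `ξ·ξ / 2` times the squared norm, since `1 - exp
(-x) ≤ x`. -/
theorem integral_husimi_mul_one_sub_cos_le (v : Modes ι) (ξ : ι ⊕ ι → ℝ) :
    ∫ p, husimi v p * (2 - 2 * Real.cos (ξ ⬝ᵥ phasePoint p)) ∂(volume.prod volume) ≤
      ‖weyl ξ v - v‖ ^ 2 + (ξ ⬝ᵥ ξ) / 2 * ‖v‖ ^ 2 := by
  have h := integral_husimi_mul_cos v ξ
  have e1 : ∫ p, husimi v p * (2 - 2 * Real.cos (ξ ⬝ᵥ phasePoint p)) ∂(volume.prod volume) =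
      2 * ‖v‖ ^ 2 - 2 * (Real.exp (-(ξ ⬝ᵥ ξ) / 4) * (⟪v, weyl ξ v⟫_ℂ).re) := by
    rw [← integral_husimi v, ← h.2, ← integral_const_mul, ← integral_const_mul,
      ← integral_sub ((integrable_husimi v).const_mul 2) (h.1.const_mul 2)]
    exact integral_congr_ae (Eventually.of_forall fun p => by simp only; ring)
  have e2 : ‖weyl ξ v - v‖ ^ 2 = 2 * ‖v‖ ^ 2 - 2 * (⟪v, weyl ξ v⟫_ℂ).re := by
    rw [norm_sub_sq (𝕜 := ℂ), norm_weyl, ← inner_conj_symm, RCLike.conj_re,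
      RCLike.re_eq_complex_re]
    ring
  have hR : (⟪v, weyl ξ v⟫_ℂ).re ≤ ‖v‖ ^ 2 := by
    refine (re_inner_le_norm (𝕜 := ℂ) v (weyl ξ v)).trans_eq ?_
    rw [norm_weyl, sq]
  have hs : 0 ≤ ξ ⬝ᵥ ξ := Finset.sum_nonneg fun i _ => mul_self_nonneg _
  have hE := Real.add_one_le_exp (-(ξ ⬝ᵥ ξ) / 4)
  have hE1 : Real.exp (-(ξ ⬝ᵥ ξ) / 4) ≤ 1 := Real.exp_le_one_iff.2 (by linarith)
  rw [e1, e2]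
  have k1 : (1 - Real.exp (-(ξ ⬝ᵥ ξ) / 4)) * (⟪v, weyl ξ v⟫_ℂ).re ≤
      (1 - Real.exp (-(ξ ⬝ᵥ ξ) / 4)) * ‖v‖ ^ 2 :=
    mul_le_mul_of_nonneg_left hR (by linarith)
  have k2 : (1 - Real.exp (-(ξ ⬝ᵥ ξ) / 4)) * ‖v‖ ^ 2 ≤ (ξ ⬝ᵥ ξ) / 4 * ‖v‖ ^ 2 :=
    mul_le_mul_of_nonneg_right (by linarith) (sq_nonneg _)
  linarith

/-- Exhibits `(2 - 2 cos (t x)) / t²` as a continuous function of `t` with value `x²` at `0`, so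
that second moments arise as limits of difference quotients. -/
theorem two_sub_two_mul_cos (x : ℝ) : 2 - 2 * Real.cos x = (x * Real.sinc (x / 2)) ^ 2 := by
  rcases eq_or_ne x 0 with rfl | hx
  · simp
  · rw [Real.sinc_of_ne_zero (by simpa using hx), mul_pow, div_pow]
    have : Real.cos x = 1 - 2 * Real.sin (x / 2) ^ 2 := by
      rw [← Real.cos_sq_add_sin_sq (x / 2)]
      have h := Real.cos_two_mul (x / 2)
      rw [mul_div_cancel₀ x two_ne_zero] at h
      nlinarith [Real.cos_sq_add_sin_sq (x / 2)]
    rw [this]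
    field_simp
    ring

theorem norm_sq_weylQuot (ξ : ι ⊕ ι → ℝ) (φ : Modes ι) (t : ℝ) :
    ‖weylQuot ξ φ t‖ ^ 2 = ‖weyl (t • ξ) φ - φ‖ ^ 2 / t ^ 2 := by
  rw [weylQuot, norm_smul, norm_inv, norm_mul, Complex.norm_I, one_mul, Complex.norm_real,
    Real.norm_eq_abs, mul_pow, inv_pow, sq_abs]
  ring

/-- The Husimi function of the truncated mixture `∑_{j ∈ F} r j |v j⟩⟨v j|`. -/
def husimiMix {J : Type} (r : J → ℝ) (v : J → Modes ι) (F : Finset J)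
    (p : (ι → ℝ) × (ι → ℝ)) : ℝ := ∑ j ∈ F, r j * husimi (v j) p

theorem integrable_husimiMix {J : Type} (r : J → ℝ) (v : J → Modes ι) (F : Finset J) :
    Integrable (husimiMix r v F) (volume.prod volume) :=
  integrable_finsetSum _ fun j _ => (integrable_husimi (v j)).const_mul (r j)

theorem husimiMix_nonneg {J : Type} {r : J → ℝ} (hr : ∀ j, 0 ≤ r j) (v : J → Modes ι)
    (F : Finset J) (p : (ι → ℝ) × (ι → ℝ)) : 0 ≤ husimiMix r v F p :=
  Finset.sum_nonneg fun j _ => mul_nonneg (hr j) (husimi_nonneg _ _)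

section Second

variable [DecidableEq ι] {J : Type} {r : J → ℝ} {v : J → Modes ι}

theorem integral_husimiMix_sinc_le (hr : ∀ j, 0 ≤ r j) (hv : ∀ j, ‖v j‖ = 1) (F : Finset J)
    (hF : ∑ j ∈ F, r j ≤ 1) (k : ι ⊕ ι) {t : ℝ} (ht : t ≠ 0) :
    Integrable (fun p => husimiMix r v F p *
      (phasePoint p k * Real.sinc (t * phasePoint p k / 2)) ^ 2) (volume.prod volume) ∧
    ∫ p, husimiMix r v F p * (phasePoint p k * Real.sinc (t * phasePoint p k / 2)) ^ 2
      ∂(volume.prod volume) ≤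
      ∑ j ∈ F, r j * ‖weylQuot (Pi.single k 1) (v j) t‖ ^ 2 + 1 / 2 := by
  have hdot : ∀ p : (ι → ℝ) × (ι → ℝ),
      (t • Pi.single k (1 : ℝ)) ⬝ᵥ phasePoint p = t * phasePoint p k := fun p => by
    rw [smul_dotProduct, single_dotProduct, one_mul, smul_eq_mul]
  have hsq : (t • Pi.single k (1 : ℝ)) ⬝ᵥ (t • Pi.single k (1 : ℝ)) = t ^ 2 := by
    rw [smul_dotProduct, single_dotProduct, one_mul, Pi.smul_apply, Pi.single_eq_same]
    simp [sq]
  have ht2 : 0 < t ^ 2 := by positivity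
  have hterm : ∀ j p, husimi (v j) p *
      (phasePoint p k * Real.sinc (t * phasePoint p k / 2)) ^ 2 =
      (husimi (v j) p * (2 - 2 * Real.cos ((t • Pi.single k (1 : ℝ)) ⬝ᵥ phasePoint p))) / t ^ 2 :=
    fun j p => by
      rw [hdot, two_sub_two_mul_cos]
      field_simp
  have hi : ∀ j, Integrable (fun p => husimi (v j) p *
      (phasePoint p k * Real.sinc (t * phasePoint p k / 2)) ^ 2) (volume.prod volume) := fun j => by
    simp only [hterm]
    refine Integrable.div_const ?_ _
    refine (((integrable_husimi (v j)).const_mul 2).sub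
      ((integral_husimi_mul_cos (v j) (t • Pi.single k (1 : ℝ))).1.const_mul 2)).congr
      (Eventually.of_forall fun p => ?_)
    simp only [Pi.sub_apply]
    ring
  have hle : ∀ j, ∫ p, husimi (v j) p *
      (phasePoint p k * Real.sinc (t * phasePoint p k / 2)) ^ 2 ∂(volume.prod volume) ≤
      ‖weylQuot (Pi.single k 1) (v j) t‖ ^ 2 + 1 / 2 := fun j => by
    simp only [hterm]
    rw [integral_div, norm_sq_weylQuot, div_le_iff₀ ht2, add_mul, div_mul_cancel₀ _ ht2.ne']
    refine (integral_husimi_mul_one_sub_cos_le (v j) _).trans_eq ?_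
    rw [hsq, hv j]
    ring
  have hsum : ∀ p, husimiMix r v F p *
      (phasePoint p k * Real.sinc (t * phasePoint p k / 2)) ^ 2 = ∑ j ∈ F, r j * (husimi (v j) p *
      (phasePoint p k * Real.sinc (t * phasePoint p k / 2)) ^ 2) := fun p => by
    rw [husimiMix, Finset.sum_mul]
    exact Finset.sum_congr rfl fun j _ => mul_assoc _ _ _
  simp only [hsum]
  refine ⟨integrable_finsetSum _ fun j _ => (hi j).const_mul (r j), ?_⟩
  rw [integral_finsetSum _ fun j _ => (hi j).const_mul (r j)]
  simp only [integral_const_mul]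
  calc ∑ j ∈ F, r j * ∫ p, husimi (v j) p *
        (phasePoint p k * Real.sinc (t * phasePoint p k / 2)) ^ 2 ∂(volume.prod volume)
      ≤ ∑ j ∈ F, r j * (‖weylQuot (Pi.single k 1) (v j) t‖ ^ 2 + 1 / 2) :=
        Finset.sum_le_sum fun j _ => mul_le_mul_of_nonneg_left (hle j) (hr j)
    _ = ∑ j ∈ F, r j * ‖weylQuot (Pi.single k 1) (v j) t‖ ^ 2 + (∑ j ∈ F, r j) * (1 / 2) := by
        simp only [mul_add, Finset.sum_add_distrib, Finset.sum_mul]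
    _ ≤ _ := by linarith

/-- The second moments of the Husimi function exceed those of the state by at most `1 / 2`. -/
theorem integral_husimiMix_sq_le (hr : ∀ j, 0 ≤ r j) (hv : ∀ j, ‖v j‖ = 1) (F : Finset J)
    (hF : ∑ j ∈ F, r j ≤ 1) (k : ι ⊕ ι) {a : ℝ → ℝ} {A : ℝ} (hA : Tendsto a (𝓝[≠] 0) (𝓝 A))
    (ha : ∀ t, t ≠ 0 → ∑ j ∈ F, r j * ‖weylQuot (Pi.single k 1) (v j) t‖ ^ 2 ≤ a t) :
    Integrable (fun p => husimiMix r v F p * phasePoint p k ^ 2) (volume.prod volume) ∧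
    ∫ p, husimiMix r v F p * phasePoint p k ^ 2 ∂(volume.prod volume) ≤ A + 1 / 2 := by
  set τ : ℕ → ℝ := fun n => 1 / ((n : ℝ) + 1) with hτ
  have hτ0 : Tendsto τ atTop (𝓝 0) := tendsto_one_div_add_atTop_nhds_zero_nat
  have hτne : ∀ n, τ n ≠ 0 := fun n => by rw [hτ]; positivity
  have hτp : Tendsto τ atTop (𝓝[≠] 0) :=
    tendsto_nhdsWithin_iff.2 ⟨hτ0, Eventually.of_forall hτne⟩
  have hc := continuous_phasePoint (κ := ι)
  have hm := (integrable_husimiMix r v F).1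
  have hA0 : 0 ≤ A := ge_of_tendsto hA (eventually_mem_nhdsWithin.mono fun t ht =>
    (Finset.sum_nonneg fun j _ => mul_nonneg (hr j) (sq_nonneg _)).trans (ha t ht))
  have hnn : ∀ p, 0 ≤ husimiMix r v F p * phasePoint p k ^ 2 := fun p =>
    mul_nonneg (husimiMix_nonneg hr v F p) (sq_nonneg _)
  have hmeas : AEStronglyMeasurable (fun p => husimiMix r v F p * phasePoint p k ^ 2)
      (volume.prod volume) := hm.mul
    (by fun_prop : Continuous fun p : (ι → ℝ) × (ι → ℝ) => phasePoint p k ^ 2).aestronglyMeasurable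
  have hlim : ∀ p, Tendsto (fun n => ENNReal.ofReal (husimiMix r v F p *
      (phasePoint p k * Real.sinc (τ n * phasePoint p k / 2)) ^ 2)) atTop
      (𝓝 (ENNReal.ofReal (husimiMix r v F p * phasePoint p k ^ 2))) := fun p => by
    have hcont : Continuous fun t : ℝ => ENNReal.ofReal (husimiMix r v F p *
        (phasePoint p k * Real.sinc (t * phasePoint p k / 2)) ^ 2) := by
      have := Real.continuous_sinc
      exact ENNReal.continuous_ofReal.comp (by fun_prop)
    have := (hcont.tendsto 0).comp hτ0
    simpa [Function.comp_def] using this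
  -- Fatou along `t = 1 / (n + 1)`. Only the bound `a` on the weighted sum of quotients is used; no
  -- separate domain condition on the `v j` is needed.
  have hfatou : ∫⁻ p, ENNReal.ofReal (husimiMix r v F p * phasePoint p k ^ 2)
      ∂(volume.prod volume) ≤ ENNReal.ofReal (A + 1 / 2) := by
    calc ∫⁻ p, ENNReal.ofReal (husimiMix r v F p * phasePoint p k ^ 2) ∂(volume.prod volume)
        = ∫⁻ p, liminf (fun n => ENNReal.ofReal (husimiMix r v F p *
            (phasePoint p k * Real.sinc (τ n * phasePoint p k / 2)) ^ 2)) atTop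
            ∂(volume.prod volume) := lintegral_congr fun p => (hlim p).liminf_eq.symm
      _ ≤ liminf (fun n => ∫⁻ p, ENNReal.ofReal (husimiMix r v F p *
            (phasePoint p k * Real.sinc (τ n * phasePoint p k / 2)) ^ 2)
            ∂(volume.prod volume)) atTop := lintegral_liminf_le' fun n =>
          (integral_husimiMix_sinc_le hr hv F hF k (hτne n)).1.1.aemeasurable.ennreal_ofReal
      _ ≤ liminf (fun n => ENNReal.ofReal (a (τ n) + 1 / 2)) atTop := by
          refine liminf_le_liminf (Eventually.of_forall fun n => ?_)
          have h := integral_husimiMix_sinc_le hr hv F hF k (hτne n)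
          rw [← ofReal_integral_eq_lintegral_ofReal h.1 (Eventually.of_forall fun p =>
            mul_nonneg (husimiMix_nonneg hr v F p) (sq_nonneg _))]
          exact ENNReal.ofReal_le_ofReal (h.2.trans (by linarith [ha _ (hτne n)]))
      _ = ENNReal.ofReal (A + 1 / 2) :=
          (ENNReal.tendsto_ofReal ((hA.comp hτp).add_const (1 / 2))).liminf_eq
  have hI : Integrable (fun p => husimiMix r v F p * phasePoint p k ^ 2) (volume.prod volume) :=
    ⟨hmeas, (hasFiniteIntegral_iff_ofReal (Eventually.of_forall hnn)).2
      (hfatou.trans_lt ENNReal.ofReal_lt_top)⟩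
  refine ⟨hI, ?_⟩
  rw [← ofReal_integral_eq_lintegral_ofReal hI (Eventually.of_forall hnn)] at hfatou
  exact (ENNReal.ofReal_le_ofReal_iff (by linarith)).1 hfatou

end Second

/-- The classical oscillator energy at a phase-space point. -/
def oscillator (p : (ι → ℝ) × (ι → ℝ)) : ℝ := (∑ k, phasePoint p k ^ 2) / 2

theorem continuous_oscillator : Continuous (oscillator (ι := ι)) := by
  have hc := continuous_phasePoint (κ := ι)
  unfold oscillator
  fun_prop

/-- The measure is `dx dk` with momentum `2π k`, so each mode contributes `√(2π) * √(1 / (2π)) = 1`.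
-/
theorem integral_exp_neg_oscillator :
    Integrable (fun p : (ι → ℝ) × (ι → ℝ) => Real.exp (-oscillator p)) (volume.prod volume) ∧
    ∫ p : (ι → ℝ) × (ι → ℝ), Real.exp (-oscillator p) ∂(volume.prod volume) = 1 := by
  have hsplit : ∀ p : (ι → ℝ) × (ι → ℝ), Real.exp (-oscillator p) =
      (∏ i, Real.exp (-(1 / 2) * p.1 i ^ 2)) *
        ∏ i, Real.exp (-(2 * Real.pi ^ 2) * p.2 i ^ 2) := fun p => by
    rw [← Real.exp_sum, ← Real.exp_sum, ← Real.exp_add, oscillator, Fintype.sum_sum_type]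
    congr 1
    simp only [phasePoint, Sum.elim_inl, Sum.elim_inr, Pi.smul_apply, smul_eq_mul,
      ← Finset.mul_sum, mul_pow]
    ring
  have h1 : Integrable (fun x : ι → ℝ => ∏ i, Real.exp (-(1 / 2) * x i ^ 2)) :=
    Integrable.fintype_prod fun _ => integrable_exp_neg_mul_sq (by norm_num)
  have h2 : Integrable (fun x : ι → ℝ => ∏ i, Real.exp (-(2 * Real.pi ^ 2) * x i ^ 2)) :=
    Integrable.fintype_prod fun _ => integrable_exp_neg_mul_sq (by positivity)
  simp only [hsplit]
  refine ⟨h1.mul_prod h2, ?_⟩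
  rw [integral_prod_mul (fun x : ι → ℝ => ∏ i, Real.exp (-(1 / 2) * x i ^ 2))
    (fun x : ι → ℝ => ∏ i, Real.exp (-(2 * Real.pi ^ 2) * x i ^ 2)),
    integral_fintype_prod_volume_eq_pow (fun y : ℝ => Real.exp (-(1 / 2) * y ^ 2)),
    integral_fintype_prod_volume_eq_pow (fun y : ℝ => Real.exp (-(2 * Real.pi ^ 2) * y ^ 2)),
    integral_gaussian, integral_gaussian, ← mul_pow, ← Real.sqrt_mul (by positivity)]
  have : Real.pi / (1 / 2) * (Real.pi / (2 * Real.pi ^ 2)) = 1 := by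
    field_simp
  rw [this, Real.sqrt_one, one_pow]

/-- The slack in the entropy bound for spectra bounded by `Λ`. -/
def slackDensity (Λ : ℝ) (p : (ι → ℝ) × (ι → ℝ)) : ℝ :=
  max 0 (Real.exp (-oscillator p / 2) - √Λ) ^ 2

theorem slackDensity_nonneg (Λ : ℝ) (p : (ι → ℝ) × (ι → ℝ)) : 0 ≤ slackDensity Λ p := sq_nonneg _

theorem slackDensity_le (Λ : ℝ) (p : (ι → ℝ) × (ι → ℝ)) :
    slackDensity Λ p ≤ Real.exp (-oscillator p) := by
  have h : Real.exp (-oscillator p) = Real.exp (-oscillator p / 2) ^ 2 := by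
    rw [← Real.exp_nat_mul]; congr 1; push_cast; ring
  rw [h, slackDensity]
  refine pow_le_pow_left₀ (le_max_left _ _) (max_le (Real.exp_pos _).le ?_) 2
  linarith [Real.sqrt_nonneg Λ]

theorem continuous_slackDensity (Λ : ℝ) : Continuous (slackDensity (ι := ι) Λ) := by
  have := continuous_oscillator (ι := ι)
  unfold slackDensity
  fun_prop

theorem integrable_slackDensity (Λ : ℝ) :
    Integrable (slackDensity (ι := ι) Λ) (volume.prod volume) := by
  refine integral_exp_neg_oscillator.1.mono (continuous_slackDensity Λ).aestronglyMeasurable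
    (Eventually.of_forall fun p => ?_)
  rw [Real.norm_of_nonneg (slackDensity_nonneg Λ p), Real.norm_of_nonneg (Real.exp_pos _).le]
  exact slackDensity_le Λ p

theorem integral_slackDensity_pos {Λ : ℝ} (hΛ : Λ < 1) :
    0 < ∫ p, slackDensity (ι := ι) Λ p ∂(volume.prod volume) := by
  refine integral_pos_of_integrable_nonneg_nonzero (x := 0) (continuous_slackDensity Λ)
    (integrable_slackDensity Λ) (slackDensity_nonneg Λ) ?_
  have h0 : oscillator (0 : (ι → ℝ) × (ι → ℝ)) = 0 := by
    rw [oscillator, Fintype.sum_sum_type]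
    simp [phasePoint]
  have hs : √Λ < 1 := (Real.sqrt_lt' one_pos).2 (by simpa using hΛ)
  rw [slackDensity, h0, neg_zero, zero_div, Real.exp_zero, max_eq_right (by linarith)]
  exact pow_ne_zero 2 (by linarith)

/-- Apply `log y ≤ y - 1` to `y = exp (-h / 2) / √r` and multiply by `2 r`. Working with square
roots, instead of with `exp (-h) / r`, is what leaves the square as a gain. -/
theorem negMulLog_le_slack {r : ℝ} (hr : 0 < r) (h : ℝ) :
    Real.negMulLog r ≤ r * h + Real.exp (-h) - r - (Real.exp (-h / 2) - √r) ^ 2 := by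
  have hb : 0 < √r := Real.sqrt_pos.2 hr
  have hbb : √r ^ 2 = r := Real.sq_sqrt hr.le
  have he : Real.exp (-h) = Real.exp (-h / 2) ^ 2 := by
    rw [← Real.exp_nat_mul]; congr 1; push_cast; ring
  have hlog : Real.log (Real.exp (-h / 2) / √r) ≤ Real.exp (-h / 2) / √r - 1 :=
    Real.log_le_sub_one_of_pos (by positivity)
  rw [Real.log_div (Real.exp_pos _).ne' hb.ne', Real.log_exp, Real.log_sqrt hr.le] at hlog
  have h2 := mul_le_mul_of_nonneg_left hlog (by positivity : 0 ≤ 2 * √r ^ 2)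
  have h3 : 2 * √r ^ 2 * (Real.exp (-h / 2) / √r - 1) =
      2 * √r * Real.exp (-h / 2) - 2 * √r ^ 2 := by
    field_simp
  rw [h3, hbb] at h2
  rw [Real.negMulLog, he]
  nlinarith

/-- The pointwise inequality at `h = oscillator p`, weighted by the Husimi functions. Replacing `r
j` by its bound `Λ` leaves a nonnegative remainder independent of `j`, to which Bessel's inequality
applies. -/
theorem sum_husimi_negMulLog_le {J : Type} {r : J → ℝ} {v : J → Modes ι} (hv : Orthonormal ℂ v)
    (hr : ∀ j, 0 < r j) {Λ : ℝ} (hΛ : ∀ j, r j ≤ Λ) (F : Finset J) (p : (ι → ℝ) × (ι → ℝ)) :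
    ∑ j ∈ F, husimi (v j) p * Real.negMulLog (r j) ≤
      husimiMix r v F p * oscillator p - husimiMix r v F p +
        (Real.exp (-oscillator p) - slackDensity Λ p) := by
  have hterm : ∀ j ∈ F, husimi (v j) p * Real.negMulLog (r j) ≤
      r j * husimi (v j) p * oscillator p - r j * husimi (v j) p +
        husimi (v j) p * (Real.exp (-oscillator p) - slackDensity Λ p) := fun j _ => by
    have h1 := negMulLog_le_slack (hr j) (oscillator p)
    have h2 : slackDensity Λ p ≤ (Real.exp (-oscillator p / 2) - √(r j)) ^ 2 := by
      have hs := Real.sqrt_le_sqrt (hΛ j)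
      rw [slackDensity]
      rcases max_cases 0 (Real.exp (-oscillator p / 2) - √Λ) with ⟨h, _⟩ | ⟨h, h'⟩
      · rw [h, zero_pow two_ne_zero]; exact sq_nonneg _
      · rw [h]; exact pow_le_pow_left₀ h'.le (by linarith) 2
    have h3 := mul_le_mul_of_nonneg_left
      (h1.trans (sub_le_sub_left h2 _)) (husimi_nonneg (v j) p)
    linarith
  refine (Finset.sum_le_sum hterm).trans ?_
  rw [Finset.sum_add_distrib, Finset.sum_sub_distrib, ← Finset.sum_mul, ← Finset.sum_mul]
  have h := mul_le_mul_of_nonneg_right (sum_husimi_le_one hv F p)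
    (sub_nonneg.2 (slackDensity_le Λ p))
  rw [one_mul] at h
  exact add_le_add_right h _

variable [DecidableEq ι]

/-- The previous inequality integrated over phase space. The term `card ι / 2` is the smoothing
excess: `2 card ι` second moments, `1 / 2` for each, halved in the oscillator energy. -/
theorem sum_negMulLog_le {J : Type} {r : J → ℝ} {v : J → Modes ι} (hv : Orthonormal ℂ v)
    (hr : ∀ j, 0 < r j) {Λ : ℝ} (hΛ : ∀ j, r j ≤ Λ) (F : Finset J) (hF : ∑ j ∈ F, r j ≤ 1)
    {a : ι ⊕ ι → ℝ → ℝ} {A : ι ⊕ ι → ℝ} (hA : ∀ k, Tendsto (a k) (𝓝[≠] 0) (𝓝 (A k)))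
    (ha : ∀ k t, t ≠ 0 → ∑ j ∈ F, r j * ‖weylQuot (Pi.single k 1) (v j) t‖ ^ 2 ≤ a k t) :
    ∑ j ∈ F, Real.negMulLog (r j) ≤ (∑ k, A k) / 2 + Fintype.card ι / 2 - ∑ j ∈ F, r j +
      (1 - ∫ p, slackDensity (ι := ι) Λ p ∂(volume.prod volume)) := by
  have hn := hv.1
  have hsq := fun k => integral_husimiMix_sq_le (fun j => (hr j).le) hn F hF k (hA k) (ha k)
  have hosc : ∀ p, husimiMix r v F p * oscillator p =
      (∑ k, husimiMix r v F p * phasePoint p k ^ 2) / 2 := fun p => by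
    rw [oscillator, ← Finset.mul_sum, mul_div_assoc]
  have hi1 : Integrable (fun p => husimiMix r v F p * oscillator p) (volume.prod volume) := by
    simp only [hosc]
    exact (integrable_finsetSum _ fun k _ => (hsq k).1).div_const 2
  have hI1 : ∫ p, husimiMix r v F p * oscillator p ∂(volume.prod volume) ≤
      (∑ k, A k) / 2 + Fintype.card ι / 2 := by
    simp only [hosc]
    rw [integral_div, integral_finsetSum _ fun k _ => (hsq k).1]
    have h := Finset.sum_le_sum fun k (_ : k ∈ Finset.univ) => (hsq k).2
    rw [Finset.sum_add_distrib, Finset.sum_const, Finset.card_univ, Fintype.card_sum,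
      nsmul_eq_mul] at h
    push_cast at h
    linarith
  have hI2 : ∫ p, husimiMix r v F p ∂(volume.prod volume) = ∑ j ∈ F, r j := by
    simp only [husimiMix]
    rw [integral_finsetSum _ fun j _ => (integrable_husimi (v j)).const_mul (r j)]
    refine Finset.sum_congr rfl fun j _ => ?_
    rw [integral_const_mul, integral_husimi, hn j, one_pow, mul_one]
  have hI3 : ∫ p, ∑ j ∈ F, husimi (v j) p * Real.negMulLog (r j) ∂(volume.prod volume) =
      ∑ j ∈ F, Real.negMulLog (r j) := by
    rw [integral_finsetSum _ fun j _ => (integrable_husimi (v j)).mul_const _]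
    refine Finset.sum_congr rfl fun j _ => ?_
    rw [integral_mul_const, integral_husimi, hn j, one_pow, one_mul]
  have hexp := integral_exp_neg_oscillator (ι := ι)
  have hi2 := integrable_husimiMix r v F
  have hsl := integrable_slackDensity (ι := ι) Λ
  have hmono := integral_mono
    (integrable_finsetSum F fun j _ => (integrable_husimi (v j)).mul_const (Real.negMulLog (r j)))
    ((hi1.sub hi2).add (hexp.1.sub hsl)) (fun p => sum_husimi_negMulLog_le hv hr hΛ F p)
  rw [hI3] at hmono
  refine hmono.trans ?_
  rw [integral_add' (hi1.sub hi2) (hexp.1.sub hsl), integral_sub' hi1 hi2,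
    integral_sub' hexp.1 hsl, hI2, hexp.2]
  linarith

theorem tsum_negMulLog_add_slack_le {J : Type} {r : J → ℝ} {v : J → Modes ι}
    (hv : Orthonormal ℂ v) (hr : ∀ j, 0 < r j) (hr1 : HasSum r 1) {Λ : ℝ} (hΛ : ∀ j, r j ≤ Λ)
    {a : ι ⊕ ι → ℝ → ℝ} {A : ι ⊕ ι → ℝ} (hA : ∀ k, Tendsto (a k) (𝓝[≠] 0) (𝓝 (A k)))
    (ha : ∀ F k t, t ≠ 0 → ∑ j ∈ F, r j * ‖weylQuot (Pi.single k 1) (v j) t‖ ^ 2 ≤ a k t) :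
    (Summable fun j => Real.negMulLog (r j)) ∧ ∑' j, Real.negMulLog (r j) +
      ∫ p, slackDensity (ι := ι) Λ p ∂(volume.prod volume) ≤
        (∑ k, A k) / 2 + Fintype.card ι / 2 := by
  have hle1 : ∀ F : Finset J, ∑ j ∈ F, r j ≤ 1 := fun F =>
    sum_le_hasSum F (fun j _ => (hr j).le) hr1
  have hb := fun F => sum_negMulLog_le hv hr hΛ F (hle1 F) hA (ha F)
  have hs : Summable fun j => Real.negMulLog (r j) := by
    refine summable_of_sum_le (c := (∑ k, A k) / 2 + Fintype.card ι / 2 +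
      (1 - ∫ p, slackDensity (ι := ι) Λ p ∂(volume.prod volume))) (fun j => ?_) fun F => ?_
    · refine Real.negMulLog_nonneg (hr j).le ?_
      simpa using hle1 {j}
    · have := Finset.sum_nonneg fun j (_ : j ∈ F) => (hr j).le
      linarith [hb F]
  refine ⟨hs, ?_⟩
  -- In the limit over finite sets `-∑ r j` tends to `-1` and cancels the integral of `exp
  -- (-oscillator)`.
  have h := le_of_tendsto_of_tendsto' hs.hasSum
    ((hr1.const_sub ((∑ k, A k) / 2 + Fintype.card ι / 2 : ℝ)).add_const
      (1 - ∫ p, slackDensity (ι := ι) Λ p ∂(volume.prod volume))) hb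
  linarith

/-- The strict maximum-entropy bound: at fixed spectrum, `S + c ≤ E + m / 2` with a constant
`c > 0` that does not depend on the eigenvectors. -/
theorem exists_entropy_slack [Nonempty ι] {J : Type} {r : J → ℝ} (hr : ∀ j, 0 < r j)
    (hr1 : HasSum r 1) : ∃ c : ℝ, 0 < c ∧ ∀ (v : J → Modes ι) (a : ι ⊕ ι → ℝ → ℝ)
      (A : ι ⊕ ι → ℝ), Orthonormal ℂ v → (∀ k, Tendsto (a k) (𝓝[≠] 0) (𝓝 (A k))) →
      (∀ F k t, t ≠ 0 → ∑ j ∈ F, r j * ‖weylQuot (Pi.single k 1) (v j) t‖ ^ 2 ≤ a k t) →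
      (Summable fun j => Real.negMulLog (r j)) ∧
        ∑' j, Real.negMulLog (r j) + c ≤ (∑ k, A k) / 2 + Fintype.card ι / 2 := by
  classical
  have hle1 : ∀ F : Finset J, ∑ j ∈ F, r j ≤ 1 := fun F =>
    sum_le_hasSum F (fun j _ => (hr j).le) hr1
  by_cases h1 : ∃ i, r i = 1
  · obtain ⟨i, hi⟩ := h1
    have huniq : ∀ j, j = i := fun j => by
      by_contra hj
      have := hle1 {j, i}
      rw [Finset.sum_pair hj, hi] at this
      linarith [hr j]
    have hz : (fun j => Real.negMulLog (r j)) = fun _ => 0 := funext fun j => by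
      rw [huniq j, hi, Real.negMulLog_one]
    -- An eigenvalue `1` leaves no other index, so the entropy is zero and the whole term `card ι /
    -- 2` is slack.
    refine ⟨Fintype.card ι / 2, by have := Fintype.card_pos (α := ι); positivity,
      fun v a A _ hA ha => ?_⟩
    rw [hz]
    refine ⟨summable_zero, ?_⟩
    have hA0 : ∀ k, 0 ≤ A k := fun k => ge_of_tendsto (hA k)
      (eventually_mem_nhdsWithin.mono fun t ht => by simpa using ha ∅ k t ht)
    rw [tsum_zero, zero_add]
    linarith [Finset.sum_nonneg fun k (_ : k ∈ Finset.univ) => hA0 k]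
  · push Not at h1
    -- An eigenvalue above `1 / 2` dominates all the others because they sum to at most one;
    -- otherwise `1 / 2` is itself a bound.
    obtain ⟨Λ, hΛ1, hΛ⟩ : ∃ Λ < 1, ∀ j, r j ≤ Λ := by
      by_cases h2 : ∃ i, 1 / 2 < r i
      · obtain ⟨i, hi⟩ := h2
        have hi1 : r i ≤ 1 := by simpa using hle1 {i}
        refine ⟨r i, lt_of_le_of_ne hi1 (h1 i), fun j => ?_⟩
        by_cases hj : j = i
        · rw [hj]
        · have := hle1 {j, i}
          rw [Finset.sum_pair hj] at this
          linarith
      · push Not at h2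
        exact ⟨1 / 2, by norm_num, h2⟩
    exact ⟨_, integral_slackDensity_pos hΛ1, fun v a A hv hA ha =>
      tsum_negMulLog_add_slack_le hv hr hr1 hΛ hA ha⟩

end EntropyBound

end GaussianErgotropy

end

noncomputable section

namespace GaussianErgotropy

/-! ### From one-sided second moments to the bipartite vector. -/

section SchmidtBessel

variable {H₁ H₂ H : Type} [NormedAddCommGroup H₁] [InnerProductSpace ℂ H₁]
  [NormedAddCommGroup H₂] [InnerProductSpace ℂ H₂]
  [NormedAddCommGroup H] [InnerProductSpace ℂ H]

theorem IsHilbertTensor.norm_sq_sum {T : H₁ →L[ℂ] H₂ →L[ℂ] H} (hT : IsHilbertTensor T)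
    {J : Type} {r : J → ℝ} (hr : ∀ j, 0 ≤ r j) {d : J → H₁} {u : J → H₂} (hu : Orthonormal ℂ u)
    (F : Finset J) :
    ‖∑ j ∈ F, (Real.sqrt (r j) : ℂ) • T (d j) (u j)‖ ^ 2 = ∑ j ∈ F, r j * ‖d j‖ ^ 2 := by
  classical
  have h : (((‖∑ j ∈ F, (Real.sqrt (r j) : ℂ) • T (d j) (u j)‖ ^ 2 : ℝ)) : ℂ) =
      ((∑ j ∈ F, r j * ‖d j‖ ^ 2 : ℝ) : ℂ) := by
    have h0 := inner_self_eq_norm_sq_to_K (𝕜 := ℂ)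
      (∑ j ∈ F, (Real.sqrt (r j) : ℂ) • T (d j) (u j))
    push_cast
    refine h0.symm.trans ?_
    rw [sum_inner]
    refine Finset.sum_congr rfl fun j hj => ?_
    rw [inner_sum, Finset.sum_eq_single j]
    · rw [inner_smul_left, inner_smul_right, hT.inner_apply, inner_self_eq_norm_sq_to_K,
        inner_self_eq_norm_sq_to_K, hu.1 j, Complex.conj_ofReal, ← mul_assoc, ← Complex.ofReal_mul,
        Real.mul_self_sqrt (hr j)]
      simp
    · intro k _ hk
      rw [inner_smul_left, inner_smul_right, hT.inner_apply, hu.2 hk.symm]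
      simp
    · exact fun h => absurd hj h
  exact_mod_cast h

/-- Orthonormality of `u` removes the cross terms whatever the `d j` are. With `d j` a difference
quotient of the Schmidt vector `v j`, this controls the moments of the reduced state by a field
acting on the full vector. -/
theorem IsHilbertTensor.sum_le_norm_sq {T : H₁ →L[ℂ] H₂ →L[ℂ] H} (hT : IsHilbertTensor T)
    {J : Type} {r : J → ℝ} (hr : ∀ j, 0 ≤ r j) {d : J → H₁} {u : J → H₂} (hu : Orthonormal ℂ u)
    {Φ : H} (h : HasSum (fun j => (Real.sqrt (r j) : ℂ) • T (d j) (u j)) Φ) (F : Finset J) :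
    ∑ j ∈ F, r j * ‖d j‖ ^ 2 ≤ ‖Φ‖ ^ 2 := by
  have hlim := (Filter.Tendsto.norm h).pow 2
  refine ge_of_tendsto hlim ((eventually_ge_atTop F).mono fun G hG => ?_)
  rw [hT.norm_sq_sum hr hu]
  exact Finset.sum_le_sum_of_subset_of_nonneg hG fun j _ _ => mul_nonneg (hr j) (sq_nonneg _)

/-- The entropy bound for one side of a bipartite vector, in terms of the field operators `X`
acting on that side. -/
theorem exists_entropy_slack_of_field {ι : Type} [Fintype ι] [DecidableEq ι] [Nonempty ι]
    {T : Modes ι →L[ℂ] H₂ →L[ℂ] H} (hT : IsHilbertTensor T) {X : ι ⊕ ι → ℝ → H →L[ℂ] H}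
    (hX : ∀ k t a b, X k t (T a b) = T (weylQuot (Pi.single k 1) a t) b)
    {J : Type} {r : J → ℝ} (hr : ∀ j, 0 < r j) (hr1 : HasSum r 1) :
    ∃ c : ℝ, 0 < c ∧ ∀ (Φ : H) (v : J → Modes ι) (u : J → H₂) (η : ι ⊕ ι → H),
      IsSchmidt T Φ r v u → (∀ k, Tendsto (fun t => X k t Φ) (𝓝[≠] 0) (𝓝 (η k))) →
      (Summable fun j => Real.negMulLog (r j)) ∧
        ∑' j, Real.negMulLog (r j) + c ≤ (∑ k, ‖η k‖ ^ 2) / 2 + Fintype.card ι / 2 := by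
  obtain ⟨c, hc, h⟩ := exists_entropy_slack (ι := ι) hr hr1
  refine ⟨c, hc, fun Φ v u η hS hη => ?_⟩
  -- For each `t` the quotient `X k t` is a bounded operator, so it may be applied termwise to the
  -- Schmidt series.
  refine h v (fun k t => ‖X k t Φ‖ ^ 2) _ hS.left (fun k => (hη k).norm.pow 2) fun F k t _ => ?_
  refine hT.sum_le_norm_sq (fun j => (hr j).le) hS.right ?_ F
  have := (X k t).hasSum hS.hasSum_vec
  simpa only [map_smul, hX] using this

end SchmidtBessel

/-! ### Lower bound on the local energy and conclusion. -/

section LocalEnergy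

/-- The difference quotient of the Weyl group as an operator. -/
def weylQuotL {ι : Type} [Fintype ι] (ξ : ι ⊕ ι → ℝ) (t : ℝ) : Modes ι →L[ℂ] Modes ι :=
  (Complex.I * (t : ℂ))⁻¹ •
    ((weylIso (t • ξ)).toContinuousLinearMap - ContinuousLinearMap.id ℂ (Modes ι))

theorem parts_single_left {α β : Type} [DecidableEq α] [DecidableEq β] (k : α ⊕ α) :
    leftPart (Pi.single (Sum.map Sum.inl Sum.inl k) 1 : (α ⊕ β) ⊕ (α ⊕ β) → ℝ) = Pi.single k 1 ∧
    rightPart (Pi.single (Sum.map Sum.inl Sum.inl k) 1 : (α ⊕ β) ⊕ (α ⊕ β) → ℝ) = 0 := by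
  constructor <;> ext (i | i) <;> rcases k with k | k <;>
    simp [leftPart, rightPart, Pi.single_apply]

theorem parts_single_right {α β : Type} [DecidableEq α] [DecidableEq β] (k : β ⊕ β) :
    rightPart (Pi.single (Sum.map Sum.inr Sum.inr k) 1 : (α ⊕ β) ⊕ (α ⊕ β) → ℝ) = Pi.single k 1 ∧
    leftPart (Pi.single (Sum.map Sum.inr Sum.inr k) 1 : (α ⊕ β) ⊕ (α ⊕ β) → ℝ) = 0 := by
  constructor <;> ext (i | i) <;> rcases k with k | k <;>
    simp [leftPart, rightPart, Pi.single_apply]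

variable {α β : Type} [Fintype α] [Fintype β]

theorem weylQuot_tensor_left {ξ : (α ⊕ β) ⊕ (α ⊕ β) → ℝ} (hξ : rightPart ξ = 0) (φ : Modes α)
    (χ : Modes β) (t : ℝ) :
    weylQuot ξ (tensor φ χ) t = tensor (weylQuot (leftPart ξ) φ t) χ := by
  have h1 : leftPart (t • ξ) = t • leftPart ξ := by ext (i | i) <;> rfl
  have h2 : rightPart (t • ξ) = 0 := by
    have : rightPart (t • ξ) = t • rightPart ξ := by ext (i | i) <;> rfl
    rw [this, hξ, smul_zero]
  simp only [weylQuot, weyl_tensor, h1, h2, weyl_zero, map_smul, map_sub,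
    smul_apply, sub_apply]

theorem weylQuot_tensor_right {ξ : (α ⊕ β) ⊕ (α ⊕ β) → ℝ} (hξ : leftPart ξ = 0) (φ : Modes α)
    (χ : Modes β) (t : ℝ) :
    weylQuot ξ (tensor φ χ) t = tensor φ (weylQuot (rightPart ξ) χ t) := by
  have h1 : rightPart (t • ξ) = t • rightPart ξ := by ext (i | i) <;> rfl
  have h2 : leftPart (t • ξ) = 0 := by
    have : leftPart (t • ξ) = t • leftPart ξ := by ext (i | i) <;> rfl
    rw [this, hξ, smul_zero]
  simp only [weylQuot, weyl_tensor, h1, h2, weyl_zero, map_smul, map_sub]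

variable [DecidableEq α] [DecidableEq β]

theorem energy_eq_add (φ : Modes (α ⊕ β)) :
    energy φ = 2⁻¹ * (∑ k : α ⊕ α, quadratureSq (Sum.map Sum.inl Sum.inl k) φ +
      ∑ k : β ⊕ β, quadratureSq (Sum.map Sum.inr Sum.inr k) φ) := by
  simp only [energy, Fintype.sum_sum_type, Sum.map_inl, Sum.map_inr]
  congr 1
  ac_rfl

theorem card_le_sum_quadratureSq {ι κ : Type} [Fintype ι] [DecidableEq ι] [Fintype κ]
    (f : κ → ι) {φ : Modes ι} (hφ : ‖φ‖ = 1) :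
    (Fintype.card κ : ℝ≥0∞) ≤ ∑ k : κ ⊕ κ, quadratureSq (Sum.map f f k) φ := by
  rw [Fintype.sum_sum_type, ← Finset.sum_add_distrib]
  calc (Fintype.card κ : ℝ≥0∞) = ∑ _i : κ, 1 := by simp
    _ ≤ _ := Finset.sum_le_sum fun i _ => one_le_quadratureSq_add hφ (f i)

/-- Combination of the entropy bound on the modes embedded by `f` with the uncertainty relation on
the modes embedded by `g`. -/
theorem exists_entropy_slack_energy {ι κ ν H₂ : Type} [Fintype ι] [DecidableEq ι] [Nonempty ι]
    [Fintype κ] [DecidableEq κ] [Fintype ν] [NormedAddCommGroup H₂] [InnerProductSpace ℂ H₂]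
    {T : Modes ι →L[ℂ] H₂ →L[ℂ] Modes κ} (hT : IsHilbertTensor T)
    {f : ι → κ} {g : ν → κ}
    (hE : ∀ φ : Modes κ, energy φ = 2⁻¹ * (∑ k : ι ⊕ ι, quadratureSq (Sum.map f f k) φ +
      ∑ k : ν ⊕ ν, quadratureSq (Sum.map g g k) φ))
    (hf : ∀ (k : ι ⊕ ι) t a b, weylQuot (Pi.single (Sum.map f f k) 1) (T a b) t =
      T (weylQuot (Pi.single k 1) a t) b)
    {J : Type} {r : J → ℝ} (hr : ∀ j, 0 < r j) (hr1 : HasSum r 1) :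
    ∃ c : ℝ, 0 < c ∧ ∀ (φ : Modes κ) (v : J → Modes ι) (u : J → H₂), IsSchmidt T φ r v u →
      ‖φ‖ = 1 → energy φ ≠ ⊤ → (Summable fun j => Real.negMulLog (r j)) ∧
        ∑' j, Real.negMulLog (r j) + c + Fintype.card ν / 2 ≤
          (energy φ).toReal + Fintype.card ι / 2 := by
  obtain ⟨c, hc, h⟩ := exists_entropy_slack_of_field hT
    (X := fun k t => weylQuotL (Pi.single (Sum.map f f k) 1) t) (fun k t a b => hf k t a b) hr hr1
  refine ⟨c, hc, fun φ v u hS hφ hfin => ?_⟩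
  have hsum : ∑ k : ι ⊕ ι, quadratureSq (Sum.map f f k) φ +
      ∑ k : ν ⊕ ν, quadratureSq (Sum.map g g k) φ ≠ ⊤ := fun htop => by
    rw [hE, htop] at hfin
    exact hfin (ENNReal.mul_top (by simp))
  obtain ⟨h1, h2⟩ := ENNReal.add_ne_top.1 hsum
  have hk : ∀ k : ι ⊕ ι, quadratureSq (Sum.map f f k) φ ≠ ⊤ := fun k =>
    ENNReal.sum_ne_top.1 h1 k (Finset.mem_univ k)
  choose η hη using fun k => exists_image_of_quadratureSq_ne_top (hk k)
  obtain ⟨hs, hle⟩ := h φ v u η hS (fun k => (hη k).hasField)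
  refine ⟨hs, ?_⟩
  have e1 : (∑ k : ι ⊕ ι, quadratureSq (Sum.map f f k) φ).toReal = ∑ k, ‖η k‖ ^ 2 := by
    rw [ENNReal.toReal_sum fun k _ => hk k]
    exact Finset.sum_congr rfl fun k _ => by
      rw [quadratureSq_eq (hη k), ENNReal.toReal_ofReal (sq_nonneg _)]
  have e2 : (Fintype.card ν : ℝ) ≤ (∑ k : ν ⊕ ν, quadratureSq (Sum.map g g k) φ).toReal := by
    have := ENNReal.toReal_mono h2 (card_le_sum_quadratureSq g hφ)
    simpa using this
  have e3 : (energy φ).toReal = 2⁻¹ * (∑ k, ‖η k‖ ^ 2 +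
      (∑ k : ν ⊕ ν, quadratureSq (Sum.map g g k) φ).toReal) := by
    rw [hE, ENNReal.toReal_mul, ENNReal.toReal_add h1 h2, e1]
    simp
  rw [e3]
  linarith

/-- Only the Schmidt vectors move; the coefficients `r` stay, so the same slack serves every local
unitary. -/
theorem IsLocalGaussianUnitary.isSchmidt {U : Modes (α ⊕ β) ≃ₗᵢ[ℂ] Modes (α ⊕ β)}
    (hU : IsLocalGaussianUnitary U) {ψ : Modes (α ⊕ β)} {J : Type} {r : J → ℝ} {v : J → Modes α}
    {u : J → Modes β} (h : IsSchmidt tensor ψ r v u) :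
    ∃ v' u', IsSchmidt tensor (U ψ) r v' u' := by
  obtain ⟨U₁, U₂, -, -, hU⟩ := hU
  refine ⟨fun j => U₁ (v j), fun j => U₂ (u j), h.left.comp_linearIsometryEquiv U₁,
    h.right.comp_linearIsometryEquiv U₂, h.pos, h.hasSum_one, ?_⟩
  have e : ∀ j, (Real.sqrt (r j) : ℂ) • tensor (U₁ (v j)) (U₂ (u j)) =
      U ((Real.sqrt (r j) : ℂ) • tensor (v j) (u j)) := fun j => by rw [map_smul, hU]
  simp only [e]
  exact U.toContinuousLinearEquiv.toContinuousLinearMap.hasSum h.hasSum_vec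

theorem isLocalGaussianUnitary_refl :
    IsLocalGaussianUnitary (LinearIsometryEquiv.refl ℂ (Modes (α ⊕ β))) := by
  have h : ∀ {ι : Type} [Fintype ι] [DecidableEq ι],
      IsGaussianUnitary (LinearIsometryEquiv.refl ℂ (Modes ι)) := fun {ι} _ _ =>
    ⟨1, one_mem _, 0, fun ξ φ => by simp⟩
  exact ⟨_, _, h, h, fun _ _ => rfl⟩

theorem localMinEnergy_le (ψ : Modes (α ⊕ β)) : localMinEnergy ψ ≤ energy ψ :=
  iInf₂_le (LinearIsometryEquiv.refl ℂ (Modes (α ⊕ β))) isLocalGaussianUnitary_refl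

/-- Unitaries that lead to infinite energy may be ignored. Finiteness of `energy ψ` keeps the
infimum finite, so that its real value is meaningful. -/
theorem le_toReal_localMinEnergy {ψ : Modes (α ⊕ β)} (hψ : energy ψ ≠ ⊤) {B : ℝ}
    (h : ∀ U : Modes (α ⊕ β) ≃ₗᵢ[ℂ] Modes (α ⊕ β), IsLocalGaussianUnitary U →
      energy (U ψ) ≠ ⊤ → B ≤ (energy (U ψ)).toReal) : B ≤ (localMinEnergy ψ).toReal := by
  refine (ENNReal.ofReal_le_iff_le_toReal (ne_top_of_le_ne_top hψ (localMinEnergy_le ψ))).1 ?_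
  refine le_iInf₂ fun U hU => ?_
  by_cases ht : energy (U ψ) = ⊤
  · simp [ht]
  · exact (ENNReal.ofReal_le_iff_le_toReal ht).2 (h U hU ht)

theorem half_mutualInformation_lt [Nonempty α] [Nonempty β] {ψ : Modes (α ⊕ β)}
    (hψ : IsPureGaussian ψ) :
    vonNeumannEntropy (reducedLeft (pureState ψ)) ≠ ⊤ ∧
    vonNeumannEntropy (reducedRight (pureState ψ)) ≠ ⊤ ∧
    vonNeumannEntropy (pureState ψ) ≠ ⊤ ∧ energy ψ ≠ ⊤ ∧
    (1 / 2 : ℝ) * mutualInformation (pureState ψ) <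
      ergotropicGap ψ + ((min (Fintype.card α) (Fintype.card β) : ℕ) : ℝ) := by
  obtain ⟨Γ, hΓ⟩ := hψ
  have hn : ‖ψ‖ = 1 := hΓ.1
  have hfin : energy ψ ≠ ⊤ := by rw [hΓ.energy_eq]; exact ENNReal.ofReal_ne_top
  have hT := isHilbertTensor_tensor (α := α) (β := β)
  obtain ⟨J, r, v, u, hS⟩ := hT.exists_schmidt hn
  -- The constants `c₁` and `c₂` are fixed here, before any unitary is chosen, so the strict
  -- inequality survives the infimum.
  obtain ⟨c₁, hc₁, h₁⟩ := exists_entropy_slack_energy hT energy_eq_add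
    (fun k t a b => by
      rw [weylQuot_tensor_left (parts_single_left k).2, (parts_single_left k).1])
    hS.pos hS.hasSum_one
  obtain ⟨c₂, hc₂, h₂⟩ := exists_entropy_slack_energy hT.flip
    (f := (Sum.inr : β → α ⊕ β)) (g := (Sum.inl : α → α ⊕ β))
    (fun φ => by rw [energy_eq_add, add_comm])
    (fun k t a b => by
      rw [ContinuousLinearMap.flip_apply, weylQuot_tensor_right (parts_single_right k).2,
        (parts_single_right k).1, ContinuousLinearMap.flip_apply])
    hS.pos hS.hasSum_one
  have hs := (h₁ ψ v u hS hn hfin).1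
  have hnn : ∀ j, 0 ≤ Real.negMulLog (r j) := fun j => Real.negMulLog_nonneg (hS.pos j).le
    (le_hasSum hS.hasSum_one j fun i _ => (hS.pos i).le)
  have hR : vonNeumannEntropy (reducedRight (pureState ψ)) =
      ENNReal.ofReal (∑' j, Real.negMulLog (r j)) := by
    rw [ENNReal.ofReal_tsum_of_nonneg hnn hs]
    exact hS.vonNeumannEntropy_reducedOp hT (basis (Modes α))
  have hL : vonNeumannEntropy (reducedLeft (pureState ψ)) =
      ENNReal.ofReal (∑' j, Real.negMulLog (r j)) := by
    rw [ENNReal.ofReal_tsum_of_nonneg hnn hs]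
    exact hS.flip.vonNeumannEntropy_reducedOp hT.flip (basis (Modes β))
  have hP := vonNeumannEntropy_pureState hn
  refine ⟨hL ▸ ENNReal.ofReal_ne_top, hR ▸ ENNReal.ofReal_ne_top, by simp [hP], hfin, ?_⟩
  have hMI : (1 / 2 : ℝ) * mutualInformation (pureState ψ) = ∑' j, Real.negMulLog (r j) := by
    rw [mutualInformation, hL, hR, hP, ENNReal.toReal_ofReal (tsum_nonneg hnn),
      ENNReal.toReal_zero]
    ring
  have hglob : (globalMinEnergy ψ).toReal ≤ (Fintype.card α + Fintype.card β) / 2 := by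
    have h := ENNReal.toReal_mono ENNReal.ofReal_ne_top hΓ.globalMinEnergy_le
    rw [ENNReal.toReal_ofReal (by positivity), Fintype.card_sum] at h
    exact_mod_cast h
  have hloc₁ : ∑' j, Real.negMulLog (r j) + c₁ + Fintype.card β / 2 - Fintype.card α / 2 ≤
      (localMinEnergy ψ).toReal := le_toReal_localMinEnergy hfin fun U hU ht => by
    obtain ⟨v', u', h⟩ := hU.isSchmidt hS
    linarith [(h₁ _ v' u' h (by rw [LinearIsometryEquiv.norm_map, hn]) ht).2]
  have hloc₂ : ∑' j, Real.negMulLog (r j) + c₂ + Fintype.card α / 2 - Fintype.card β / 2 ≤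
      (localMinEnergy ψ).toReal := le_toReal_localMinEnergy hfin fun U hU ht => by
    obtain ⟨v', u', h⟩ := hU.isSchmidt hS
    linarith [(h₂ _ u' v' h.flip (by rw [LinearIsometryEquiv.norm_map, hn]) ht).2]
  rw [hMI, ergotropicGap, globalErgotropy, localErgotropy]
  -- The energy of `ψ` itself cancels in the gap. With `hglob`, the bound `hloc₁` gives the entropy
  -- plus `c₁` at most the gap plus `card α`, and `hloc₂` gives the same with `c₂` and `card β`.
  rcases min_choice (Fintype.card α) (Fintype.card β) with h | h <;> rw [h] <;> linarith

end LocalEnergy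

end GaussianErgotropy

end

/-- For every pure (displacement-free) Gaussian state `ψ` of modes split as `α | β`, each side with at
least one mode, half the mutual information is less than the 2-local ergotropic gap plus the smaller
number of modes. The first four conjuncts say that the entropies and energies involved are finite. -/
theorem mainTheorem11 {α β : Type} [Fintype α] [Fintype β] [DecidableEq α] [DecidableEq β]
    [Nonempty α] [Nonempty β] (ψ : GaussianErgotropy.Modes (α ⊕ β))
    (hψ : GaussianErgotropy.IsPureGaussian ψ) :
    GaussianErgotropy.vonNeumannEntropy
        (GaussianErgotropy.reducedLeft (GaussianErgotropy.pureState ψ)) ≠ ⊤ ∧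
    GaussianErgotropy.vonNeumannEntropy
        (GaussianErgotropy.reducedRight (GaussianErgotropy.pureState ψ)) ≠ ⊤ ∧
    GaussianErgotropy.vonNeumannEntropy (GaussianErgotropy.pureState ψ) ≠ ⊤ ∧
    GaussianErgotropy.energy ψ ≠ ⊤ ∧
    (1 / 2 : ℝ) * GaussianErgotropy.mutualInformation (GaussianErgotropy.pureState ψ) <
      GaussianErgotropy.ergotropicGap ψ + ((min (Fintype.card α) (Fintype.card β) : ℕ) : ℝ) := by
  exact GaussianErgotropy.half_mutualInformation_lt hψ
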